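/- **Setting.** Let $d\ge 0$ be an integer and $T$ a $d$-regular tree. For a coloring $\varphi: VT\to\{a,b\}$ let $b_n(\varphi)$ be the number of classes of colored closed $n$-balls of $T$ up to color-preserving (center-preserving) isomorphism of $n$-balls; $\varphi$ is *Sturmian* if $b_n(\varphi)=n+2$ for all $n\ge 0$. An *edge-indexed graph* has an index $i(v,w)\in\mathbb N$ on each oriented edge $v\to w$ (loops allowed, $i(v,w)=0$ if there is no edge). A tree $T$ with a surjection $p:VT\to VY$ is the universal cover of an edge-indexed graph $Y$ if each $x\in VT$ has exactly $i(p(x),w)$ neighbours $y$ with $p(y)=w$, for every $w\in VY$. **Concatenation.** Let $G_1,G_2$ be edge-indexed graphs with vertices $V\in G_1$, $V'\in G_2$. The $(i,j)$-concatenation is $G_1\sqcup G_2$ with a new edge of indices $i(V,V')=i$, $i(V',V)=j$, where the loop indices at $V$, $V'$ are lowered by $i$, $j$. If $V,V'$ are end vertices with the same loop index and with the same index $m$ of their unique outgoing non-loop edge, the $(i)$-concatenation is obtained by identifying $V$ with $V'$ and their loops, and giving the outgoing non-loop edges at $V=V'$ into $G_1$, $G_2$ the indices $i$, $m-i$. **Admissible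 data.** Let $(\alpha_k)_{k\ge0}$ be a sequence in $\{A,B\}$, $\overline A=B$, $\overline B=A$, $K=\min\{k\ge 0:\alpha_k=A\}\in[0,\infty]$. Let $\mathbf i_k$ be $i_k$, $(i_k,j_k)$ or $(i_k,i_k',j_k)$, with positive integer entries, and put $i_{-1}=0$; let $j_0$ denote the last entry of $\mathbf i_0$. Define $(\mathfrak i^A_K,\mathfrak i^B_K,\mathfrak i^C_K)=(i_K,i'_K,j_0)$ if $\mathbf i_K=(i_K,i_K',j_K)$ and $(i_K,i_{K-1},j_0)$ if $\mathbf i_K=(i_K,j_K)$; for $k>K$ let $\mathfrak i^C_k=\mathfrak i^{\overline{\alpha_k}}_{k-1}$, $\mathfrak i^{\alpha_k}_k=\mathfrak i^{\alpha_k}_{k-1}$, $\mathfrak i^{\overline{\alpha_k}}_k=\mathfrak i^C_{k-1}$. The sequence $(\mathbf i_k)$ is *$\alpha_k$-admissible* if - for $k<K$: $\mathbf i_k=(i_k,j_k)$ with $1\le i_k<d$, $1\le j_k\le d-i_{k-1}$; - for $k=K$: $\mathbf i_K=(i_K,i'_K,j_K)$ with $1\le i_K<i'_K\le d$, $1\le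 j_K\le d-i_{K-1}$, or, only if $K\ge1$, $\mathbf i_K=(i_K,j_K)$ with $1\le i_K\le d$, $1\le j_K\le d-i_{K-1}$; - for $k>K$: $\mathbf i_k=i_k$ with $1\le i_k<\mathfrak i^C_{k-1}$, or $\mathbf i_k=(i_k,j_k)$ with $1\le i_k,j_k\le d-\mathfrak i^C_{k-1}$. A sequence $(\beta_k)_{k\ge 0}$ in $\{A,B\}$ is *$\alpha_k$-admissible* if $\beta_k\in\{\alpha_k,\beta_{k-1}\}$ for all $k\ge 1$. **The graphs.** $F^A_{-1}$ and $F^B_{-1}$ are single vertices with a loop of index $d$, colored $a$ and $b$ respectively; all later vertices inherit their colors. - For $k<K$: $F^A_k=F^A_{k-1}$, and $F^B_k$ is the $\mathbf i_k$-concatenation of $F^A_{k-1}$ and $F^B_{k-1}$ at $V$, $V'$, where $V$ is the vertex of $F^A_{k-1}$ and $V'$ is the vertex of $F^B_{k-1}$ coming from $F^A_{k-2}$ (the only vertex of $F^B_{-1}$ if $k=0$). - For $k=K$, with the same $V,V'$: if $\mathbf i_K=(i_K,i'_K,j_K)$, then $F^A_K$, $F^B_K$ are the $(i_K,j_K)$-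 and the $(i'_K,j_K)$-concatenation of $F^A_{K-1}$ and $F^B_{K-1}$; if $\mathbf i_K=(i_K,j_K)$, then $F^A_K$ is the $(i_K,j_K)$-concatenation and $F^B_K=F^B_{K-1}$. The common end vertices of $F^A_K,F^B_K$ are the images of the end vertex of $F^B_{K-1}$ other than $V'$ (of its only vertex if $K=0$). - For $k>K$: $F^{\alpha_k}_k$ is the $\mathbf i_k$-concatenation of $F^A_{k-1}$ and $F^B_{k-1}$ at their common end vertices and $F^{\overline{\alpha_k}}_k=F^{\overline{\alpha_k}}_{k-1}$; the new common end vertices of $F^A_k,F^B_k$ are the images of the non-common end vertex of $F^{\overline{\alpha_k}}_{k-1}$. Put $n_k=|VF^{\alpha_k}_k|-2$. **Proposition.** Let $(\mathbf i_k)$ and $(\beta_k)$ be $\alpha_k$-admissible and assume $\beta_k=\alpha_k$ for infinitely many $k$. Then the natural maps $F^{\beta_k}_k\to F^{\beta_{k+1}}_{k+1}$ are injective on vertices and preserve colors, and the index between any two fixed vertices is eventually constant along them, so that there is a direct limit colored edge-indexed graph $(Y,\varphi)=\varinjlim F^{\beta_k}_k$. The $d$-regular tree $T$ is the universal cover of $Y$,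 and, for every covering map $p:T\to Y$, the lifted coloring $\varphi\circ p$ of $T$ is Sturmian: $b_n(\varphi\circ p)=n+2$ for all $n\ge0$. In particular $b_{n_k}(\varphi\circ p)=n_k+2=|VF^{\alpha_k}_k|$ for all $k\ge 0$. -/

import Mathlib

namespace SturmianTree

/-- The letters used to label the two sequences of graphs. -/
inductive Letter
  | A
  | B

/-- The two colors. -/
inductive Color
  | a
  | b

/-! ### Colorings of trees -/

/-- Every vertex of `T` has exactly `d` neighbours. -/
def IsRegularOfDeg {W : Type*} (T : SimpleGraph W) (d : ℕ) : Prop :=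
  ∀ x : W, (T.neighborSet x).encard = (d : ℕ∞)

/-- The closed `n`-ball around `x`. -/
def ball {W : Type*} (T : SimpleGraph W) (n : ℕ) (x : W) : Set W :=
  {y | T.dist x y ≤ n}

theorem mem_ball_self {W : Type*} (T : SimpleGraph W) (n : ℕ) (x : W) : x ∈ ball T n x := by
  simp [ball]

/-- The `n`-balls around `x` and `y` are equivalent: there is a color-preserving isomorphism
between them that sends the center to the center. -/
def BallEquiv {W : Type*} {C : Type*} (T : SimpleGraph W) (φ : W → C) (n : ℕ) (x y : W) : Prop :=
  ∃ f : T.induce (ball T n x) ≃g T.induce (ball T n y),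
    f ⟨x, mem_ball_self T n x⟩ = ⟨y, mem_ball_self T n y⟩ ∧
      ∀ z : ball T n x, φ (f z : W) = φ (z : W)

/-- Equivalence of `n`-balls, as an equivalence relation on their centers. -/
def ballSetoid {W : Type*} {C : Type*} (T : SimpleGraph W) (φ : W → C) (n : ℕ) : Setoid W where
  r := BallEquiv T φ n
  iseqv :=
    { refl := fun _ => ⟨SimpleGraph.Iso.refl, rfl, fun _ => rfl⟩
      symm := by
        rintro x y ⟨f, hf, hc⟩
        refine ⟨f.symm, ?_, fun z => ?_⟩
        · rw [← hf]; exact f.symm_apply_apply _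
        · have h := hc (f.symm z)
          rw [RelIso.apply_symm_apply] at h
          exact h.symm
      trans := by
        rintro x y z ⟨f, hf, hc⟩ ⟨g, hg, hd⟩
        refine ⟨f.trans g, ?_, fun w => ?_⟩
        · change g (f _) = _
          rw [hf, hg]
        · change φ (g (f w) : W) = _
          rw [hd, hc] }

/-- The factor complexity `b_n(φ)`: the number of classes of `n`-balls appearing in `(T, φ)`. -/
noncomputable def complexity {W : Type*} {C : Type*} (T : SimpleGraph W) (φ : W → C) (n : ℕ) : ℕ :=
  Nat.card (Quotient (ballSetoid T φ n))

/-- A Sturmian coloring: `b_n(φ) = n + 2` for all `n ≥ 0`. -/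
def IsSturmian {W : Type*} {C : Type*} (T : SimpleGraph W) (φ : W → C) : Prop :=
  ∀ n : ℕ, complexity T φ n = n + 2

/-! ### Colored edge-indexed graphs -/

/-- A colored edge-indexed graph (without multiple edges). `idx v w` is the index of the oriented
edge from `v` to `w` (of the loop at `v`, if `v = w`); the value `0` means that there is no
such edge. -/
structure ColoredGraph where
  V : Type
  idx : V → V → ℕ
  color : V → Color

/-- `p` exhibits the tree `T` as the universal cover of the edge-indexed graph `Y`: a lift of `v`
has exactly `idx v w` neighbours that are lifts of `w`. -/
structure IsUniversalCover {W : Type*} (T : SimpleGraph W) (Y : ColoredGraph) (p : W → Y.V) :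
    Prop where
  isTree : T.IsTree
  surjective : Function.Surjective p
  index : ∀ (x : W) (v : Y.V), {y : W | T.Adj x y ∧ p y = v}.encard = (Y.idx (p x) v : ℕ∞)

/-- One vertex of color `c` with a loop of index `d`. -/
def onePoint (d : ℕ) (c : Color) : ColoredGraph where
  V := Unit
  idx := fun _ _ => d
  color := fun _ => c

/-- The index data `(i)`, `(i, j)` or `(i, i', j)`. -/
inductive IndexData
  | one (i : ℕ)
  | two (i j : ℕ)
  | three (i i' j : ℕ)

/-- The `(i)`-concatenation of `G` and `H` at `(v, v')`, used when `v`, `v'` are end vertices with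
the same loop index and the same index `m` of their non-loop edge. The vertices `v` and `v'` are
identified (the result is kept as `v`), the loops at them are identified, and the non-loop edges
at `v = v'` going to `G` and to `H` get the indices `i` and `m - i`. -/
noncomputable def concatOne (G H : ColoredGraph) (v : G.V) (v' : H.V) (i : ℕ) : ColoredGraph :=
  open Classical in
  { V := G.V ⊕ {w : H.V // w ≠ v'}
    idx := fun s t =>
      match s, t with
      | .inl x, .inl y => if x = v ∧ y ≠ v ∧ G.idx v y ≠ 0 then i else G.idx x y
      | .inl x, .inr y => if x = v then H.idx v' y.1 - i else 0
      | .inr x, .inl y => if y = v then H.idx x.1 v' else 0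
      | .inr x, .inr y => H.idx x.1 y.1
    color := Sum.elim G.color (fun w => H.color w.1) }

/-- The `(i, j)`-concatenation of `G` and `H` at `(v, v')`: the disjoint union, together with a new
edge between `v` and `v'` of index `i` from `v` to `v'` and `j` from `v'` to `v`; the indices of the
loops at `v`, `v'` are lowered by `i`, `j`. -/
noncomputable def concatTwo (G H : ColoredGraph) (v : G.V) (v' : H.V) (i j : ℕ) : ColoredGraph :=
  open Classical in
  { V := G.V ⊕ H.V
    idx := fun s t =>
      match s, t with
      | .inl x, .inl y => if x = v ∧ y = v then G.idx v v - i else G.idx x y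
      | .inl x, .inr y => if x = v ∧ y = v' then i else 0
      | .inr x, .inl y => if x = v' ∧ y = v then j else 0
      | .inr x, .inr y => if x = v' ∧ y = v' then H.idx v' v' - j else H.idx x y
    color := Sum.elim G.color H.color }

/-- The concatenation of `G` and `H` at `(v, v')` with data `(i)` or `(i, j)`. (Data `(i, i', j)`
is never used here; it is treated as `(i, j)`.) -/
noncomputable def concat (G H : ColoredGraph) (v : G.V) (v' : H.V) : IndexData → ColoredGraph
  | .one i => concatOne G H v v' i
  | .two i j => concatTwo G H v v' i j
  | .three i _ j => concatTwo G H v v' i j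

/-- The image in the concatenation of a vertex of the first graph. -/
noncomputable def concatLeft (G H : ColoredGraph) (v : G.V) (v' : H.V) :
    (e : IndexData) → G.V → (concat G H v v' e).V
  | .one _ => fun x => Sum.inl x
  | .two _ _ => fun x => Sum.inl x
  | .three _ _ _ => fun x => Sum.inl x

/-- The image in the concatenation of a vertex of the second graph. -/
noncomputable def concatRight (G H : ColoredGraph) (v : G.V) (v' : H.V) :
    (e : IndexData) → H.V → (concat G H v v' e).V
  | .one _ => fun w => open Classical in if h : w = v' then Sum.inl v else Sum.inr ⟨w, h⟩
  | .two _ _ => fun w => Sum.inr w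
  | .three _ _ _ => fun w => Sum.inr w

/-! ### The recursive construction -/

/-- A pair of graphs `F^A`, `F^B` (which are segments) with their end vertices. `joinA`, `joinB` are
the end vertices at which the next concatenation takes place, `farA`, `farB` the other end
vertices. (If the graph has only one vertex, both are that vertex.) -/
structure Stage where
  FA : ColoredGraph
  FB : ColoredGraph
  joinA : FA.V
  joinB : FB.V
  farA : FA.V
  farB : FB.V

/-- The graph `F^X`. -/
def Stage.F (S : Stage) : Letter → ColoredGraph
  | .A => S.FA
  | .B => S.FB

/-- A next stage together with the natural maps `F^X → F^Y` from the old graphs to the new ones.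
Where there is no natural map the entry is an irrelevant constant map. -/
structure Step (S : Stage) where
  next : Stage
  map : ∀ X Y : Letter, (S.F X).V → (next.F Y).V

/-- `F^A` is replaced by the concatenation and `F^B` is kept. The new common end vertices are the
images of the far end vertex of `F^B`. -/
noncomputable def growA (S : Stage) (e : IndexData) : Step S where
  next :=
    { FA := concat S.FA S.FB S.joinA S.joinB e
      FB := S.FB
      joinA := concatRight S.FA S.FB S.joinA S.joinB e S.farB
      joinB := S.farB
      farA := concatLeft S.FA S.FB S.joinA S.joinB e S.farA
      farB := S.joinB }
  map := fun X Y =>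
    match X, Y with
    | .A, .A => concatLeft S.FA S.FB S.joinA S.joinB e
    | .B, .A => concatRight S.FA S.FB S.joinA S.joinB e
    | .B, .B => fun x => x
    | .A, .B => fun _ => S.farB

/-- `F^B` is replaced by the concatenation and `F^A` is kept. The new joining vertices are the
images of the far end vertex of `F^A`. As long as `F^A` is a single vertex, these are the vertex
of `F^A` and the vertex of `F^B` that comes from it. -/
noncomputable def growB (S : Stage) (e : IndexData) : Step S where
  next :=
    { FA := S.FA
      FB := concat S.FA S.FB S.joinA S.joinB e
      joinA := S.farA
      joinB := concatLeft S.FA S.FB S.joinA S.joinB e S.farA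
      farA := S.joinA
      farB := concatRight S.FA S.FB S.joinA S.joinB e S.farB }
  map := fun X Y =>
    match X, Y with
    | .A, .B => concatLeft S.FA S.FB S.joinA S.joinB e
    | .B, .B => concatRight S.FA S.FB S.joinA S.joinB e
    | .A, .A => fun x => x
    | .B, .A => fun _ => S.farA

/-- Data `(i, i', j)`: both graphs are replaced, `F^A` by the `(i, j)`-concatenation and `F^B` by
the `(i', j)`-concatenation. -/
noncomputable def growBoth (S : Stage) (i i' j : ℕ) : Step S where
  next :=
    { FA := concat S.FA S.FB S.joinA S.joinB (.two i j)
      FB := concat S.FA S.FB S.joinA S.joinB (.two i' j)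
      joinA := concatRight S.FA S.FB S.joinA S.joinB (.two i j) S.farB
      joinB := concatRight S.FA S.FB S.joinA S.joinB (.two i' j) S.farB
      farA := concatLeft S.FA S.FB S.joinA S.joinB (.two i j) S.farA
      farB := concatLeft S.FA S.FB S.joinA S.joinB (.two i' j) S.farA }
  map := fun X Y =>
    match X, Y with
    | .A, .A => concatLeft S.FA S.FB S.joinA S.joinB (.two i j)
    | .B, .A => concatRight S.FA S.FB S.joinA S.joinB (.two i j)
    | .A, .B => concatLeft S.FA S.FB S.joinA S.joinB (.two i' j)
    | .B, .B => concatRight S.FA S.FB S.joinA S.joinB (.two i' j)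

/-- The passage from one stage to the next, with letter `X = α_k` and data `e = i_k`. (For
admissible data, `(i, i', j)` occurs only at the first `k` with `α_k = A`.) -/
noncomputable def step (S : Stage) : Letter → IndexData → Step S
  | .A, .three i i' j => growBoth S i i' j
  | .A, .one i => growA S (.one i)
  | .A, .two i j => growA S (.two i j)
  | .B, e => growB S e

/-- `stage d α ι k` is the pair `F^A_{k-1}`, `F^B_{k-1}`, starting with `F^A_{-1}`, `F^B_{-1}`. -/
noncomputable def stage (d : ℕ) (α : ℕ → Letter) (ι : ℕ → IndexData) : ℕ → Stage
  | 0 =>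
    { FA := onePoint d .a
      FB := onePoint d .b
      joinA := ()
      joinB := ()
      farA := ()
      farB := () }
  | k + 1 => (step (stage d α ι k) (α k) (ι k)).next

/-- The colored edge-indexed graph `F^X_k`, `k ≥ 0`. -/
noncomputable def graphF (d : ℕ) (α : ℕ → Letter) (ι : ℕ → IndexData) (X : Letter) (k : ℕ) :
    ColoredGraph :=
  (stage d α ι (k + 1)).F X

/-- The natural map `F^X_k → F^Y_{k+1}`; it is meaningful if `Y = X` or `Y = α_{k+1}`. -/
noncomputable def incl (d : ℕ) (α : ℕ → Letter) (ι : ℕ → IndexData) (k : ℕ) (X Y : Letter) :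
    (graphF d α ι X k).V → (graphF d α ι Y (k + 1)).V :=
  (step (stage d α ι (k + 1)) (α (k + 1)) (ι (k + 1))).map X Y

/-- `n_k = |V F^{α_k}_k| - 2`. -/
noncomputable def nSeq (d : ℕ) (α : ℕ → Letter) (ι : ℕ → IndexData) (k : ℕ) : ℕ :=
  Nat.card (graphF d α ι (α k) k).V - 2

/-! ### Admissible sequences -/

/-- `K = min {k ≥ 0 : α_k = A}`, with `K = ∞` if there is no such `k`. -/
noncomputable def firstA (α : ℕ → Letter) : ℕ∞ :=
  sInf {n : ℕ∞ | ∃ k : ℕ, n = (k : ℕ∞) ∧ α k = Letter.A}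

/-- The first entry of the index data. -/
def IndexData.fst : IndexData → ℕ
  | .one i => i
  | .two i _ => i
  | .three i _ _ => i

/-- The last entry of the index data. -/
def IndexData.last : IndexData → ℕ
  | .one i => i
  | .two _ j => j
  | .three _ _ j => j

/-- `i_{k-1}`, with `i_{-1} = 0`. -/
def prevFst (ι : ℕ → IndexData) : ℕ → ℕ
  | 0 => 0
  | k + 1 => (ι k).fst

/-- The triple `𝔦^A_k, 𝔦^B_k, 𝔦^C_k`. -/
structure EndIndices where
  a : ℕ
  b : ℕ
  c : ℕ

/-- The values for `k = K`. -/
def startIndices (ι : ℕ → IndexData) (k : ℕ) : EndIndices :=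
  match ι k with
  | .three i i' _ => ⟨i, i', (ι 0).last⟩
  | e => ⟨e.fst, prevFst ι k, (ι 0).last⟩

/-- The end indices `(𝔦^A_k, 𝔦^B_k, 𝔦^C_k)`, for `k ≥ K` (the values for `k < K` are irrelevant). -/
noncomputable def endIndices (α : ℕ → Letter) (ι : ℕ → IndexData) : ℕ → EndIndices
  | 0 => startIndices ι 0
  | k + 1 =>
    open Classical in
    if ((k + 1 : ℕ) : ℕ∞) ≤ firstA α then startIndices ι (k + 1)
    else
      match α (k + 1) with
      | .A => ⟨(endIndices α ι k).a, (endIndices α ι k).c, (endIndices α ι k).b⟩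
      | .B => ⟨(endIndices α ι k).c, (endIndices α ι k).b, (endIndices α ι k).a⟩

/-- `ι` is an `α`-admissible sequence of indices for the degree `d`. -/
structure AdmissibleIndices (d : ℕ) (α : ℕ → Letter) (ι : ℕ → IndexData) : Prop where
  before : ∀ k : ℕ, (k : ℕ∞) < firstA α →
    ∃ i j : ℕ, ι k = .two i j ∧ 1 ≤ i ∧ i < d ∧ 1 ≤ j ∧ j ≤ d - prevFst ι k
  first : ∀ k : ℕ, (k : ℕ∞) = firstA α →
    (∃ i i' j : ℕ, ι k = .three i i' j ∧
      1 ≤ i ∧ i < i' ∧ i' ≤ d ∧ 1 ≤ j ∧ j ≤ d - prevFst ι k) ∨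
    (k ≠ 0 ∧ ∃ i j : ℕ, ι k = .two i j ∧ 1 ≤ i ∧ i ≤ d ∧ 1 ≤ j ∧ j ≤ d - prevFst ι k)
  after : ∀ k : ℕ, firstA α < ((k + 1 : ℕ) : ℕ∞) →
    (∃ i : ℕ, ι (k + 1) = .one i ∧ 1 ≤ i ∧ i < (endIndices α ι k).c) ∨
    (∃ i j : ℕ, ι (k + 1) = .two i j ∧
      1 ≤ i ∧ i ≤ d - (endIndices α ι k).c ∧ 1 ≤ j ∧ j ≤ d - (endIndices α ι k).c)

/-- `β` is an `α`-admissible sequence of letters: `β_k = α_k` or `β_k = β_{k-1}` for `k ≥ 1`. -/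
def AdmissibleLetters (α β : ℕ → Letter) : Prop :=
  ∀ k : ℕ, β (k + 1) = α (k + 1) ∨ β (k + 1) = β k

/-! ### The direct limit -/

/-- The vertices of all `F^{β_k}_k`. -/
abbrev Vertices (d : ℕ) (α : ℕ → Letter) (ι : ℕ → IndexData) (β : ℕ → Letter) : Type :=
  Σ k : ℕ, (graphF d α ι (β k) k).V

/-- A vertex is related to its image under `F^{β_k}_k → F^{β_{k+1}}_{k+1}`. -/
inductive LimitRel (d : ℕ) (α : ℕ → Letter) (ι : ℕ → IndexData) (β : ℕ → Letter) :
    Vertices d α ι β → Vertices d α ι β → Prop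
  | step (k : ℕ) (x : (graphF d α ι (β k) k).V) :
      LimitRel d α ι β ⟨k, x⟩ ⟨k + 1, incl d α ι k (β k) (β (k + 1)) x⟩

/-- The composite map `F^{β_k}_k → F^{β_{k+m}}_{k+m}`. -/
noncomputable def inclIter (d : ℕ) (α : ℕ → Letter) (ι : ℕ → IndexData) (β : ℕ → Letter) (k : ℕ) :
    (m : ℕ) → (graphF d α ι (β k) k).V → (graphF d α ι (β (k + m)) (k + m)).V
  | 0 => fun x => x
  | m + 1 => fun x =>
      incl d α ι (k + m) (β (k + m)) (β (k + (m + 1))) (inclIter d α ι β k m x)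

/-- The direct limit `(Y, φ)` of the `F^{β_k}_k`. Its vertex set is the direct limit of the vertex
sets. The index between two vertices is the value at which the indices between their
representatives stabilize, and the color is that of the representatives. -/
noncomputable def limitGraph (d : ℕ) (α : ℕ → Letter) (ι : ℕ → IndexData) (β : ℕ → Letter) :
    ColoredGraph :=
  open Classical in
  { V := Quot (LimitRel d α ι β)
    idx := fun p q => sInf {n : ℕ | ∃ (k : ℕ) (x y : (graphF d α ι (β k) k).V),
      Quot.mk (LimitRel d α ι β) ⟨k, x⟩ = p ∧ Quot.mk (LimitRel d α ι β) ⟨k, y⟩ = q ∧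
        ∀ m : ℕ, (graphF d α ι (β (k + m)) (k + m)).idx
          (inclIter d α ι β k m x) (inclIter d α ι β k m y) = n}
    color := fun p =>
      if ∃ (k : ℕ) (x : (graphF d α ι (β k) k).V),
          Quot.mk (LimitRel d α ι β) ⟨k, x⟩ = p ∧ (graphF d α ι (β k) k).color x = Color.a
      then Color.a else Color.b }

/-- The canonical map from `F^{β_k}_k` to the direct limit. -/
noncomputable def toLimit (d : ℕ) (α : ℕ → Letter) (ι : ℕ → IndexData) (β : ℕ → Letter) (k : ℕ)
    (x : (graphF d α ι (β k) k).V) : (limitGraph d α ι β).V :=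
  Quot.mk (LimitRel d α ι β) ⟨k, x⟩

/-- The direct limit is well behaved: the canonical maps are injective, preserve colors, and the
edge-indices of `F^{β_k}_k` eventually agree with those of the limit. -/
structure LimitWellDefined (d : ℕ) (α : ℕ → Letter) (ι : ℕ → IndexData) (β : ℕ → Letter) :
    Prop where
  injective : ∀ k : ℕ, Function.Injective (toLimit d α ι β k)
  color : ∀ (k : ℕ) (x : (graphF d α ι (β k) k).V),
    (limitGraph d α ι β).color (toLimit d α ι β k x) = (graphF d α ι (β k) k).color x
  index : ∀ (k : ℕ) (x y : (graphF d α ι (β k) k).V), ∃ m₀ : ℕ, ∀ m : ℕ, m₀ ≤ m →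
    (graphF d α ι (β (k + m)) (k + m)).idx (inclIter d α ι β k m x) (inclIter d α ι β k m y) =
      (limitGraph d α ι β).idx (toLimit d α ι β k x) (toLimit d α ι β k y)

end SturmianTree

/-! Every `F^X_k` is a segment. Number its vertices 0, 1, ..., L from the end at which the next
concatenation takes place. Let L_k be the length of `F^{α_k}_k` and s_k the length of the other
graph of level k. The indices of the two graphs agree at the positions below s_k and differ at s_k.
Passing to level k + 1 turns the graph of the letter other than α_{k+1} around and puts the graph of
α_{k+1} behind it, with a new edge (ε = 1) or with two vertices identified (ε = 0), so L_{k+1} = L_k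
+ s_k + ε.

The map `fold` sends a position of level k + 1 back to the position of level k that it comes from.
It respects the multiset of neighbours: a new edge folds into the loop from which its index was
subtracted, and the two edges at an identified vertex fold onto one edge whose index is their sum.
Hence each vertex of the limit, and of the tree, has a label l_k in {0, ..., L_k} for every k. Each
label determines the previous ones, and l_0 is the color. `SegmentSystem` and `Labeling` collect
what is needed of this.

Upper bound (`Labeling.refine_eq`, `ballEquiv_of_refine`): vertices with the same label l_k are
indistinguishable for L_k - 1 + |l_k - s_k| rounds of color refinement. Away from s_k the label
determines the labels of the neighbours; at s_k one falls back on level k - 1. On a tree, equality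
after n rounds yields isomorphic n-balls. So there are at most L_k + 1 classes of balls of radius
L_k - 1.

Lower bound (`Labeling.eq_of_stable`): in a partition that refines the colors and is stable under
passing to neighbours, all labels are constant on each class. If two vertices of one class lay on
different sides of the fold, walking from both towards s_k would reach the position where the two
graphs differ. As the number of labels is unbounded, no finite partition is stable, so b_0 ≥ 2 and
b_n < b_{n+1}. Together with b = L_k + 1 at radius L_k - 1, for L_k arbitrarily large, this forces
b_n = n + 2.

It remains to match the graphs with the segments (`segmentStep`, `describes`) and to control the
limit. An integer coordinate on the limit gives injectivity. The neighbours of a vertex change only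
when it is the joining end of a growing segment; after that it is interior for ever, so indices
stabilize (`exists_level_stable`). The limit is connected with symmetric adjacency and total index d
at each vertex, so T covers it (`exists_universalCover`). -/

namespace SturmianTree

/-! ### Regular trees: matching neighbours and gluing local choices -/

section Trees

variable {W : Type*} {T : SimpleGraph W}

/-- The neighbours of a vertex, as a multiset (empty if there are infinitely many). -/
noncomputable def nbrs (T : SimpleGraph W) (x : W) : Multiset W :=
  open Classical in if h : (T.neighborSet x).Finite then h.toFinset.val else 0

theorem IsRegularOfDeg.finite {d : ℕ} (hd : IsRegularOfDeg T d) (x : W) :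
    (T.neighborSet x).Finite :=
  Set.finite_of_encard_eq_coe (hd x)

theorem IsRegularOfDeg.mem_nbrs {d : ℕ} (hd : IsRegularOfDeg T d) {x y : W} :
    y ∈ nbrs T x ↔ T.Adj x y := by
  simp [nbrs, hd.finite x]

theorem nodup_nbrs (x : W) : (nbrs T x).Nodup := by
  unfold nbrs
  split_ifs with h
  · exact h.toFinset.nodup
  · exact Multiset.nodup_zero

theorem IsRegularOfDeg.card_nbrs {d : ℕ} (hd : IsRegularOfDeg T d) (x : W) :
    (nbrs T x).card = d := by
  have h := hd x
  rw [(hd.finite x).encard_eq_coe_toFinset_card] at h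
  simpa [nbrs, hd.finite x] using h

/-- Bridge between the `encard` of `IsUniversalCover` and multisets: being a covering means that the
image of `nbrs` is a prescribed multiset. -/
theorem count_map_nbrs {d : ℕ} (hd : IsRegularOfDeg T d) {S : Type*} [DecidableEq S] (p : W → S)
    (x : W) (v : S) :
    ((((nbrs T x).map p).count v : ℕ) : ℕ∞) = {y : W | T.Adj x y ∧ p y = v}.encard := by
  classical
  have hs : {y : W | T.Adj x y ∧ p y = v} =
      (((hd.finite x).toFinset.filter (fun y => v = p y) : Finset W) : Set W) := by
    ext y
    simp [eq_comm]
  rw [hs, Set.encard_coe_eq_coe_finsetCard, Multiset.count_map]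
  simp [nbrs, hd.finite x, Finset.card, Finset.filter]

/-- Equal multisets of labels can be matched entry by entry. Only the source must be free of
repetitions, since the matching has to be a function on it. -/
theorem exists_map_eq_of_map_eq {α β γ : Type*} [Nonempty β] (f : α → γ) (h : β → γ)
    (s : Multiset α) (hs : s.Nodup) (t : Multiset β) (e : s.map f = t.map h) :
    ∃ g : α → β, s.map g = t ∧ ∀ a ∈ s, h (g a) = f a := by
  classical
  induction s using Multiset.induction_on generalizing t with
  | empty =>
    have ht : t = 0 := by simpa using e.symm
    exact ⟨fun _ => Classical.arbitrary β, by simp [ht], by simp⟩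
  | cons a s ih =>
    rw [Multiset.nodup_cons] at hs
    have ha : f a ∈ t.map h := by rw [← e]; simp
    obtain ⟨b, hb, hab⟩ := Multiset.mem_map.1 ha
    obtain ⟨t', rfl⟩ := Multiset.exists_cons_of_mem hb
    rw [Multiset.map_cons, Multiset.map_cons, hab, Multiset.cons_inj_right] at e
    obtain ⟨g, hg, hg'⟩ := ih hs.2 t' e
    have hne : ∀ x ∈ s, x ≠ a := fun x hx hxa => hs.1 (hxa ▸ hx)
    refine ⟨Function.update g a b, ?_, ?_⟩
    · rw [Multiset.map_cons, Function.update_self, ← hg]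
      congr 1
      exact Multiset.map_congr rfl fun x hx => Function.update_of_ne (hne x hx) _ _
    · intro x hx
      rcases Multiset.mem_cons.1 hx with rfl | hx
      · simpa using hab
      · rw [Function.update_of_ne (hne x hx)]
        exact hg' x hx

/-- Uniqueness of the parent of `v` for the root `u`: geodesics to `w` and `w'` extend to geodesics
to `v`, and a tree has only one path from `u` to `v`. -/
theorem IsTree.eq_of_dist_eq (hT : T.IsTree) {u v w w' : W} (h : T.Adj v w) (h' : T.Adj v w')
    (e : T.dist u v = T.dist u w + 1) (e' : T.dist u v = T.dist u w' + 1) : w = w' := by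
  obtain ⟨p, hp, hl⟩ := hT.connected.exists_path_of_dist u w
  obtain ⟨p', hp', hl'⟩ := hT.connected.exists_path_of_dist u w'
  have h1 : (p.concat h.symm).IsPath :=
    SimpleGraph.Walk.isPath_of_length_eq_dist _ (by simp [hl, e])
  have h2 : (p'.concat h'.symm).IsPath :=
    SimpleGraph.Walk.isPath_of_length_eq_dist _ (by simp [hl', e'])
  have := (hT.existsUnique_path u v).unique h1 h2
  simpa using congrArg SimpleGraph.Walk.penultimate this

theorem IsTree.exists_adj_dist (hT : T.IsTree) {u v : W} (h : u ≠ v) :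
    ∃ w, T.Adj w v ∧ T.dist u v = T.dist u w + 1 := by
  obtain ⟨p, hl⟩ := hT.connected.exists_walk_length_eq_dist v u
  cases p with
  | nil => exact (h rfl).elim
  | cons ha q =>
    rename_i w
    refine ⟨w, ha.symm, ?_⟩
    rcases hT.dist_eq_dist_add_one_of_adj u ha with e | e
    · exact e
    · have := SimpleGraph.dist_le q
      simp at hl
      rw [SimpleGraph.dist_comm] at this
      rw [SimpleGraph.dist_comm] at hl
      omega

/-- Local choices along a tree, compatible with the choice at the parent, glue to a global map. -/
theorem exists_tree_extension (hT : T.IsTree) {S : Type*} (x₀ : W) (Q : W → (W → S) → Prop)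
    (hQ : ∀ x g g', (∀ y, y = x ∨ T.Adj x y → g y = g' y) → Q x g → Q x g')
    (g₀ : W → S) (h₀ : Q x₀ g₀)
    (hext : ∀ u x, T.Adj u x → T.dist x₀ x = T.dist x₀ u + 1 → ∀ g, Q u g →
      ∃ g', g' x = g x ∧ g' u = g u ∧ Q x g') :
    ∃ p : W → S, p x₀ = g₀ x₀ ∧ ∀ x, Q x p := by
  classical
  have hpar : ∀ x : W, ∃ u, x₀ ≠ x → T.Adj u x ∧ T.dist x₀ x = T.dist x₀ u + 1 := by
    intro x
    by_cases h : x₀ = x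
    · exact ⟨x, fun h' => (h' h).elim⟩
    · obtain ⟨u, hu⟩ := IsTree.exists_adj_dist hT h
      exact ⟨u, fun _ => hu⟩
  choose par hpar using hpar
  have hstep : ∀ x : W, ∀ g : W → S, ∃ g' : W → S, x₀ ≠ x → Q (par x) g →
      g' x = g x ∧ g' (par x) = g (par x) ∧ Q x g' := by
    intro x g
    by_cases h : x₀ ≠ x ∧ Q (par x) g
    · obtain ⟨g', hg'⟩ := hext (par x) x (hpar x h.1).1 (hpar x h.1).2 g h.2
      exact ⟨g', fun _ _ => hg'⟩
    · exact ⟨g, fun h1 h2 => (h ⟨h1, h2⟩).elim⟩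
  choose nx hnx using hstep
  -- Recursion on the distance to the root: `loc x` is the local choice at `x`, made from that of
  -- its parent. Only its values at `x` and at the neighbours of `x` matter, and the glued map is
  -- the diagonal `x ↦ loc x x`.
  let aux : ℕ → W → (W → S) := fun n => Nat.rec (fun _ => g₀) (fun _ r x => nx x (r (par x))) n
  let loc : W → (W → S) := fun x => aux (T.dist x₀ x) x
  have hloc0 : loc x₀ = g₀ := by simp [loc, aux]
  have hloc : ∀ x, x₀ ≠ x → loc x = nx x (loc (par x)) := by
    intro x hx
    have e := (hpar x hx).2
    show aux (T.dist x₀ x) x = _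
    rw [e]
  have hQl : ∀ n x, T.dist x₀ x = n → Q x (loc x) := by
    intro n
    induction n with
    | zero =>
      intro x hx
      have : x₀ = x := (hT.connected.dist_eq_zero_iff).1 hx
      subst this
      rwa [hloc0]
    | succ n ih =>
      intro x hx
      have hne : x₀ ≠ x := by rintro rfl; simp at hx
      rw [hloc x hne]
      exact (hnx x _ hne (ih _ (by have := (hpar x hne).2; omega))).2.2
  have hQl' := fun x => hQl _ x rfl
  have hx : ∀ x, x₀ ≠ x → loc x x = loc (par x) x ∧ loc x (par x) = loc (par x) (par x) := by
    intro x hx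
    have h := hnx x (loc (par x)) hx (hQl' _)
    rw [hloc x hx]
    exact ⟨h.1, h.2.1⟩
  refine ⟨fun x => loc x x, by simp [hloc0], fun x => hQ x (loc x) _ ?_ (hQl' x)⟩
  rintro y (rfl | hy)
  · rfl
  -- A neighbour of `x` is its parent or one of its children; in either case the two local choices
  -- agree at both ends of the edge.
  rcases hT.dist_eq_dist_add_one_of_adj x₀ hy with e | e
  · have hne : x₀ ≠ x := by rintro rfl; simp at e
    have : y = par x := IsTree.eq_of_dist_eq hT hy (hpar x hne).1.symm e (hpar x hne).2
    rw [this]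
    exact (hx x hne).2
  · have hne : x₀ ≠ y := by rintro rfl; simp at e
    have : x = par y := IsTree.eq_of_dist_eq hT hy.symm (hpar y hne).1.symm e (hpar y hne).2
    rw [this]
    exact (hx y hne).1.symm

/-- A map that is bijective on the neighbours of each vertex preserves distances. -/
theorem dist_map_of_nbrs {d : ℕ} (hd : IsRegularOfDeg T d) (hT : T.IsTree) (f : W → W)
    (hf : ∀ x, (nbrs T x).map f = nbrs T (f x)) (x z : W) : T.dist (f x) (f z) = T.dist x z := by
  have hadj : ∀ {x y}, T.Adj x y → T.Adj (f x) (f y) := by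
    intro x y h
    rw [← hd.mem_nbrs, ← hf]
    exact Multiset.mem_map_of_mem f (hd.mem_nbrs.2 h)
  have hinj : ∀ {x y y'}, T.Adj x y → T.Adj x y' → f y = f y' → y = y' := by
    intro x y y' h h' e
    exact Multiset.inj_on_of_nodup_map (by rw [hf]; exact nodup_nbrs _) y (hd.mem_nbrs.2 h) y'
      (hd.mem_nbrs.2 h') e
  suffices H : ∀ n z, T.dist x z = n → T.dist (f x) (f z) = n from H _ z rfl
  intro n
  induction n using Nat.strong_induction_on with
  | _ n ih =>
  intro z hz
  by_cases hxz : x = z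
  · subst hxz
    simp at hz ⊢
    exact hz
  obtain ⟨u, hu, hzu⟩ := IsTree.exists_adj_dist hT hxz
  have iu := ih (T.dist x u) (by omega) u rfl
  rcases hT.dist_eq_dist_add_one_of_adj (f x) (hadj hu) with e | e
  -- Here the image would turn back at `f u`. Then `f z` and `f v` are both the parent of `f u`, and
  -- injectivity on the neighbours of `u` gives `z = v`, against the distances.
  · exfalso
    have hxu : x ≠ u := by rintro rfl; simp at iu; simp at e
    obtain ⟨v, hv, huv⟩ := IsTree.exists_adj_dist hT hxu
    have iv := ih (T.dist x v) (by omega) v rfl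
    have : f z = f v := IsTree.eq_of_dist_eq hT (hadj hu) (hadj hv.symm) e (by omega)
    have := hinj hu hv.symm this
    subst this
    omega
  · omega

theorem surjective_of_nbrs {d : ℕ} (hd : IsRegularOfDeg T d) (hT : T.IsTree) (f : W → W)
    (hf : ∀ x, (nbrs T x).map f = nbrs T (f x)) : Function.Surjective f := by
  intro y
  obtain ⟨x⟩ := hT.connected.nonempty
  suffices H : ∀ n y, T.dist (f x) y = n → ∃ z, f z = y from H _ y rfl
  intro n
  induction n with
  | zero =>
    intro y hy
    exact ⟨x, (hT.connected.dist_eq_zero_iff).1 hy⟩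
  | succ n ih =>
    intro y hy
    have hne : f x ≠ y := by rintro rfl; simp at hy
    obtain ⟨u, hu, hyu⟩ := IsTree.exists_adj_dist hT hne
    obtain ⟨v, rfl⟩ := ih u (by omega)
    have hy' : y ∈ (nbrs T v).map f := by rw [hf]; exact hd.mem_nbrs.2 hu
    obtain ⟨z, -, hz⟩ := Multiset.mem_map.1 hy'
    exact ⟨z, hz⟩

/-- The types of the rounds of color refinement. -/
def RefineType (C : Type) : ℕ → Type
  | 0 => C
  | n + 1 => C × Multiset (RefineType C n)

/-- Color refinement: the color after `n` rounds. -/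
noncomputable def refine {C : Type} (T : SimpleGraph W) (φ : W → C) : (n : ℕ) → W → RefineType C n
  | 0 => φ
  | n + 1 => fun x => (φ x, (nbrs T x).map (refine T φ n))

/-! ### Color refinement and equivalence of balls -/

variable {C : Type} {φ : W → C}

theorem refine_succ_iff {n : ℕ} {x y : W} : refine T φ (n + 1) x = refine T φ (n + 1) y ↔
    φ x = φ y ∧ (nbrs T x).map (refine T φ n) = (nbrs T y).map (refine T φ n) :=
  Prod.ext_iff

theorem color_eq_of_refine {n : ℕ} {x y : W} (h : refine T φ n x = refine T φ n y) :
    φ x = φ y := by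
  cases n with
  | zero => exact h
  | succ n => exact (refine_succ_iff.1 h).1

/-- A label function with values in `α` refining the rounds up to `n` turns equality of the
multisets of neighbour labels into equality of the multisets of neighbour colors. -/
theorem map_refine_of_map {S : Type*} {n : ℕ} {x y : W} (μ : W → S)
    (h : (nbrs T x).map μ = (nbrs T y).map μ)
    (hμ : ∀ z ∈ nbrs T x, ∀ z' ∈ nbrs T y, μ z = μ z' → refine T φ n z = refine T φ n z') :
    (nbrs T x).map (refine T φ n) = (nbrs T y).map (refine T φ n) := by
  have : Nonempty W := ⟨x⟩
  obtain ⟨g, hg, hg'⟩ := exists_map_eq_of_map_eq μ μ _ (nodup_nbrs x) _ h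
  rw [← hg, Multiset.map_map]
  refine Multiset.map_congr rfl fun z hz => ?_
  exact hμ z hz (g z) (by rw [← hg]; exact Multiset.mem_map_of_mem g hz) (hg' z hz).symm

theorem refine_of_succ {n : ℕ} {x y : W} (h : refine T φ (n + 1) x = refine T φ (n + 1) y) :
    refine T φ n x = refine T φ n y := by
  induction n generalizing x y with
  | zero => exact color_eq_of_refine h
  | succ n ih =>
    have h' := refine_succ_iff.1 h
    exact refine_succ_iff.2 ⟨h'.1, map_refine_of_map _ h'.2 fun z _ z' _ e => ih e⟩

theorem refine_of_le {m n : ℕ} (hmn : m ≤ n) {x y : W} (h : refine T φ n x = refine T φ n y) :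
    refine T φ m x = refine T φ m y := by
  induction n, hmn using Nat.le_induction with
  | base => exact h
  | succ n _ ih => exact ih (refine_of_succ h)

/-- Extension of a neighbour bijection that has been prescribed at one neighbour. -/
theorem exists_nbrs_map {S : Type*} {d : ℕ} (hd : IsRegularOfDeg T d) (μ : W → S) {u v x y : W}
    (hu : T.Adj x u) (hv : T.Adj y v) (huv : μ u = μ v)
    (h : (nbrs T x).map μ = (nbrs T y).map μ) :
    ∃ g : W → W, g x = y ∧ g u = v ∧ (nbrs T x).map g = nbrs T y ∧
      ∀ z, T.Adj x z → μ z = μ (g z) := by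
  classical
  obtain ⟨s, hs⟩ := Multiset.exists_cons_of_mem (hd.mem_nbrs.2 hu)
  obtain ⟨t, ht⟩ := Multiset.exists_cons_of_mem (hd.mem_nbrs.2 hv)
  rw [hs, ht, Multiset.map_cons, Multiset.map_cons, huv, Multiset.cons_inj_right] at h
  have hns : (u ::ₘ s).Nodup := hs ▸ nodup_nbrs x
  rw [Multiset.nodup_cons] at hns
  have : Nonempty W := ⟨x⟩
  obtain ⟨g, hg, hg'⟩ := exists_map_eq_of_map_eq μ μ s hns.2 t h
  have hxu : u ≠ x := hu.ne'
  have hsx : ∀ z ∈ s, z ≠ x ∧ z ≠ u := by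
    intro z hz
    constructor
    · rintro rfl
      exact T.loopless.irrefl z (hd.mem_nbrs.1 (hs ▸ Multiset.mem_cons_of_mem hz))
    · rintro rfl
      exact hns.1 hz
  have hgs : ∀ z ∈ s, (Function.update (Function.update g u v) x y) z = g z := by
    intro z hz
    rw [Function.update_of_ne (hsx z hz).1, Function.update_of_ne (hsx z hz).2]
  have hgu : (Function.update (Function.update g u v) x y) u = v := by
    rw [Function.update_of_ne hxu, Function.update_self]
  refine ⟨Function.update (Function.update g u v) x y, by simp, hgu, ?_, ?_⟩
  · rw [hs, ht, Multiset.map_cons, hgu, ← hg]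
    congr 1
    exact Multiset.map_congr rfl hgs
  · intro z hz
    rw [← hd.mem_nbrs, hs, Multiset.mem_cons] at hz
    rcases hz with rfl | hz
    · rw [hgu, huv]
    · rw [hgs z hz, hg' z hz]

/-- Vertices of equal refined color have equivalent balls. -/
theorem ballEquiv_of_refine {d : ℕ} (hd : IsRegularOfDeg T d) (hT : T.IsTree) {n : ℕ} {x y : W}
    (h : refine T φ n x = refine T φ n y) : BallEquiv T φ n x y := by
  classical
  have : Nonempty W := ⟨x⟩
  -- A vertex at distance `r` must keep its color of round `n - r`. Beyond distance `n` only
  -- bijectivity on neighbours is required, so the glued map is an isometry of the whole tree that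
  -- respects colors inside the ball.
  let Q : W → (W → W) → Prop := fun z g => (nbrs T z).map g = nbrs T (g z) ∧
    ∀ w, (w = z ∨ T.Adj z w) → T.dist x w ≤ n →
      refine T φ (n - T.dist x w) w = refine T φ (n - T.dist x w) (g w)
  have hcard : ∀ a b : W, (nbrs T a).map (fun _ => ()) = (nbrs T b).map (fun _ => ()) := by
    intro a b
    simp [Multiset.map_const', hd.card_nbrs]
  have hQ : ∀ z g g', (∀ w, w = z ∨ T.Adj z w → g w = g' w) → Q z g → Q z g' := by
    intro z g g' e hg
    refine ⟨?_, fun w hw hwn => ?_⟩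
    · rw [← e z (Or.inl rfl), ← hg.1]
      exact Multiset.map_congr rfl fun w hw => (e w (Or.inr (hd.mem_nbrs.1 hw))).symm
    · rw [← e w hw]
      exact hg.2 w hw hwn
  have h₀ : ∃ g₀ : W → W, g₀ x = y ∧ Q x g₀ := by
    have key : ∃ g : W → W, (nbrs T x).map g = nbrs T y ∧
        ∀ z ∈ nbrs T x, 1 ≤ n → refine T φ (n - 1) (g z) = refine T φ (n - 1) z := by
      cases n with
      | zero =>
        obtain ⟨g, hg, -⟩ := exists_map_eq_of_map_eq _ _ _ (nodup_nbrs x) _ (hcard x y)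
        exact ⟨g, hg, by simp⟩
      | succ n =>
        obtain ⟨g, hg, hg'⟩ := exists_map_eq_of_map_eq _ _ _ (nodup_nbrs x) _
          (refine_succ_iff.1 h).2
        exact ⟨g, hg, fun z hz _ => hg' z hz⟩
    obtain ⟨g, hg, hg'⟩ := key
    have hne : ∀ z, T.Adj x z → Function.update g x y z = g z := fun z hz =>
      Function.update_of_ne hz.ne' _ _
    refine ⟨Function.update g x y, by simp, ?_, ?_⟩
    · rw [Function.update_self, ← hg]
      exact Multiset.map_congr rfl fun z hz => hne z (hd.mem_nbrs.1 hz)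
    · rintro w (rfl | hw) hwn
      · rw [Function.update_self, SimpleGraph.dist_self, Nat.sub_zero]
        exact h
      · rw [hne w hw]
        have h1 : T.dist x w = 1 := SimpleGraph.dist_eq_one_iff_adj.2 hw
        rw [h1] at hwn ⊢
        exact (hg' w (hd.mem_nbrs.2 hw) hwn).symm
  obtain ⟨g₀, hg₀, hQ₀⟩ := h₀
  obtain ⟨f, hfx, hf⟩ := exists_tree_extension hT x Q hQ g₀ hQ₀ (by
    intro u z huz hdist g hg
    have hadj : T.Adj (g z) (g u) := by
      rw [SimpleGraph.adj_comm, ← hd.mem_nbrs, ← hg.1]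
      exact Multiset.mem_map_of_mem g (hd.mem_nbrs.2 huz)
    have key : ∃ g' : W → W, g' z = g z ∧ g' u = g u ∧ (nbrs T z).map g' = nbrs T (g z) ∧
        ∀ w, T.Adj z w → T.dist x z + 1 ≤ n →
          refine T φ (n - (T.dist x z + 1)) w = refine T φ (n - (T.dist x z + 1)) (g' w) := by
      -- Inside the ball, the refined color of `z` matches its neighbours one round lower. The value
      -- at the parent `u` may be prescribed because `u` agrees for even more rounds. Outside, any
      -- bijection extending the value at `u` will do.
      by_cases hn : T.dist x z + 1 ≤ n
      · have hz := hg.2 z (Or.inr huz) (by omega)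
        have hu := hg.2 u (Or.inl rfl) (by omega)
        obtain ⟨r, hr⟩ : ∃ r, n - T.dist x z = r + 1 := ⟨n - T.dist x z - 1, by omega⟩
        have hr' : n - (T.dist x z + 1) = r := by omega
        rw [hr] at hz
        obtain ⟨g', h1, h2, h3, h4⟩ := exists_nbrs_map hd (refine T φ r) huz.symm hadj
          (refine_of_le (by omega) hu) (refine_succ_iff.1 hz).2
        exact ⟨g', h1, h2, h3, fun w hw _ => by rw [hr']; exact h4 w hw⟩
      · obtain ⟨g', h1, h2, h3, -⟩ := exists_nbrs_map hd (fun _ => ()) huz.symm hadj rfl (hcard _ _)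
        exact ⟨g', h1, h2, h3, fun w _ h => (hn h).elim⟩
    obtain ⟨g', h1, h2, h3, h4⟩ := key
    refine ⟨g', h1, h2, by rw [h1]; exact h3, ?_⟩
    rintro w (rfl | hw) hwn
    · rw [h1]
      exact hg.2 w (Or.inr huz) hwn
    · rcases hT.dist_eq_dist_add_one_of_adj x hw with e | e
      · have : w = u := IsTree.eq_of_dist_eq hT hw huz.symm e hdist
        subst this
        rw [h2]
        exact hg.2 w (Or.inl rfl) hwn
      · have := h4 w hw (by omega)
        rwa [← e] at this)
  have hfn := fun z => (hf z).1
  have hdist := dist_map_of_nbrs hd hT f hfn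
  have hfy : f x = y := hfx.trans hg₀
  have hfinj : Function.Injective f := by
    intro a b e
    have := hdist a b
    rw [e] at this
    simp at this
    exact (hT.connected.dist_eq_zero_iff).1 this.symm
  have hadj : ∀ a b, T.Adj (f a) (f b) ↔ T.Adj a b := by
    intro a b
    rw [← SimpleGraph.dist_eq_one_iff_adj, hdist, SimpleGraph.dist_eq_one_iff_adj]
  have hball : ∀ z, z ∈ ball T n x ↔ f z ∈ ball T n y := by
    intro z
    show T.dist x z ≤ n ↔ T.dist y (f z) ≤ n
    rw [← hfy, hdist]
  let e : W ≃ W := Equiv.ofBijective f ⟨hfinj, surjective_of_nbrs hd hT f hfn⟩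
  refine ⟨⟨e.subtypeEquiv hball, ?_⟩, ?_, ?_⟩
  · rintro ⟨a, ha⟩ ⟨b, hb⟩
    exact hadj a b
  · exact Subtype.ext hfy
  · rintro ⟨z, hz⟩
    exact (color_eq_of_refine ((hf z).2 z (Or.inl rfl) hz)).symm

/-- A geodesic of length at most `n` from `x` stays in the `n`-ball, hence in `s`, so `f` carries it
to a walk of the same length. -/
theorem dist_le_of_iso (hT : T.IsTree) {s s' : Set W} (f : T.induce s ≃g T.induce s') {n : ℕ}
    {x : W} (hs : ball T n x ⊆ s) (hx : x ∈ s) {w : W} (hw : w ∈ s) (hn : T.dist x w ≤ n) :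
    T.dist (f ⟨x, hx⟩ : W) (f ⟨w, hw⟩ : W) ≤ T.dist x w := by
  suffices H : ∀ k, ∀ w (hw : w ∈ s), T.dist x w = k → k ≤ n →
      T.dist (f ⟨x, hx⟩ : W) (f ⟨w, hw⟩ : W) ≤ k from H _ w hw rfl hn
  intro k
  induction k with
  | zero =>
    intro w hw h _
    have : x = w := (hT.connected.dist_eq_zero_iff).1 h
    subst this
    simp
  | succ k ih =>
    intro w hw h hk
    have hne : x ≠ w := by rintro rfl; simp at h
    obtain ⟨u, hu, hwu⟩ := IsTree.exists_adj_dist hT hne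
    have hus : u ∈ s := hs (show T.dist x u ≤ n by omega)
    have hadj : T.Adj (f ⟨u, hus⟩ : W) (f ⟨w, hw⟩ : W) :=
      f.map_rel_iff.2 (show (T.induce s).Adj ⟨u, hus⟩ ⟨w, hw⟩ from hu)
    have h1 := ih u hus (by omega) (by omega)
    have h2 := hT.connected.dist_triangle (u := (f ⟨x, hx⟩ : W)) (v := (f ⟨u, hus⟩ : W))
      (w := (f ⟨w, hw⟩ : W))
    rw [SimpleGraph.dist_eq_one_iff_adj.2 hadj] at h2
    omega

/-- Applying `dist_le_of_iso` to `f` and to its inverse shows that `f` restricts to `n`-balls. This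
serves for smaller concentric balls and for balls around neighbours of the center. -/
theorem ballEquiv_of_iso (hT : T.IsTree) {s s' : Set W} (f : T.induce s ≃g T.induce s')
    (hf : ∀ z : s, φ (f z : W) = φ (z : W)) {n : ℕ} {x : W} (hx : x ∈ s) (hs : ball T n x ⊆ s)
    (hs' : ball T n (f ⟨x, hx⟩ : W) ⊆ s') : BallEquiv T φ n x (f ⟨x, hx⟩ : W) := by
  have hball : ∀ w : s, (w : W) ∈ ball T n x ↔ (f w : W) ∈ ball T n (f ⟨x, hx⟩ : W) := by
    rintro ⟨w, hw⟩
    constructor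
    · intro h
      exact (dist_le_of_iso hT f hs hx hw h).trans h
    · intro h
      have h1 := dist_le_of_iso hT f.symm hs' (f ⟨x, hx⟩).2 (f ⟨w, hw⟩).2 h
      simp only [Subtype.coe_eta, RelIso.symm_apply_apply] at h1
      exact h1.trans h
  let g : ball T n x → ball T n (f ⟨x, hx⟩ : W) := fun w =>
    ⟨f ⟨w, hs w.2⟩, (hball ⟨w, hs w.2⟩).1 w.2⟩
  have hg : Function.Bijective g := by
    constructor
    · intro a b e
      have := congrArg Subtype.val e
      have := f.injective (Subtype.ext this)
      exact Subtype.ext (congrArg (fun z : s => (z : W)) this)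
    · intro b
      have hb : ((f (f.symm ⟨b, hs' b.2⟩) : s') : W) = b := by simp
      refine ⟨⟨f.symm ⟨b, hs' b.2⟩, (hball _).2 (by rw [hb]; exact b.2)⟩, Subtype.ext ?_⟩
      exact hb
  refine ⟨⟨Equiv.ofBijective g hg, ?_⟩, ?_, ?_⟩
  · intro a b
    exact f.map_rel_iff (a := ⟨a, hs a.2⟩) (b := ⟨b, hs b.2⟩)
  · rfl
  · intro z
    exact hf _

theorem BallEquiv.of_succ (hT : T.IsTree) {n : ℕ} {x y : W} (h : BallEquiv T φ (n + 1) x y) :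
    BallEquiv T φ n x y := by
  obtain ⟨f, hf, hc⟩ := h
  have := ballEquiv_of_iso (n := n) hT f hc (mem_ball_self T (n + 1) x)
    (fun z (hz : T.dist x z ≤ n) => show T.dist x z ≤ n + 1 by omega) (by
      rw [hf]
      exact fun z (hz : T.dist y z ≤ n) => show T.dist y z ≤ n + 1 by omega)
  rwa [hf] at this

theorem BallEquiv.color_eq {n : ℕ} {x y : W} (h : BallEquiv T φ n x y) : φ x = φ y := by
  obtain ⟨f, hf, hc⟩ := h
  have := hc ⟨x, mem_ball_self T n x⟩
  rw [hf] at this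
  exact this.symm

/-- The `n`-ball around a neighbour lies in the `(n + 1)`-ball, so the isomorphism restricts to it.
Hence the partition by `n`-balls is stable as soon as it coincides with that by `(n + 1)`-balls. -/
theorem BallEquiv.map_nbrs {d : ℕ} (hd : IsRegularOfDeg T d) (hT : T.IsTree) {n : ℕ} {x y : W}
    (h : BallEquiv T φ (n + 1) x y) :
    (nbrs T x).map (Quotient.mk (ballSetoid T φ n)) =
      (nbrs T y).map (Quotient.mk (ballSetoid T φ n)) := by
  classical
  obtain ⟨f, hf, hc⟩ := h
  have hsub : ∀ {x z : W}, T.Adj x z → ball T n z ⊆ ball T (n + 1) x := by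
    intro x z hz w hw
    have h1 := hT.connected.dist_triangle (u := x) (v := z) (w := w)
    rw [SimpleGraph.dist_eq_one_iff_adj.2 hz] at h1
    have : T.dist z w ≤ n := hw
    show T.dist x w ≤ n + 1
    omega
  have hmem : ∀ {x z : W}, T.Adj x z → z ∈ ball T (n + 1) x := fun {x z} hz =>
    hsub hz (mem_ball_self T n z)
  have hadj : ∀ z (hz : T.Adj x z), T.Adj y (f ⟨z, hmem hz⟩ : W) := by
    intro z hz
    have : (T.induce (ball T (n + 1) y)).Adj (f ⟨x, mem_ball_self T (n + 1) x⟩)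
        (f ⟨z, hmem hz⟩) := f.map_rel_iff.2 hz
    rw [hf] at this
    exact this
  let g : W → W := fun z => if h : z ∈ ball T (n + 1) x then f ⟨z, h⟩ else z
  have hg : ∀ z (hz : z ∈ ball T (n + 1) x), g z = f ⟨z, hz⟩ := fun z hz => by simp [g, hz]
  have hgm : (nbrs T x).map g = nbrs T y := by
    refine Multiset.Nodup.toFinset_inj ?_ (nodup_nbrs y) ?_
    · refine Multiset.Nodup.map_on ?_ (nodup_nbrs x)
      intro a ha b hb e
      rw [hg a (hmem (hd.mem_nbrs.1 ha)), hg b (hmem (hd.mem_nbrs.1 hb))] at e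
      exact congrArg Subtype.val (f.injective (Subtype.ext e))
    · ext w
      simp only [Multiset.mem_toFinset, Multiset.mem_map]
      constructor
      · rintro ⟨z, hz, rfl⟩
        have hz' := hd.mem_nbrs.1 hz
        rw [hg z (hmem hz')]
        exact hd.mem_nbrs.2 (hadj z hz')
      · intro hw
        have hw' := hd.mem_nbrs.1 hw
        let z := f.symm ⟨w, hmem hw'⟩
        have hfz : f z = ⟨w, hmem hw'⟩ := by simp [z]
        have hz : T.Adj x z := by
          have : (T.induce (ball T (n + 1) x)).Adj ⟨x, mem_ball_self T (n + 1) x⟩ z := by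
            rw [← f.map_rel_iff, hf, hfz]
            exact hw'
          exact this
        exact ⟨z, hd.mem_nbrs.2 hz, by rw [hg z z.2]; exact congrArg Subtype.val hfz⟩
  rw [← hgm, Multiset.map_map]
  refine Multiset.map_congr rfl fun z hz => Quotient.sound ?_
  have hz' := hd.mem_nbrs.1 hz
  show BallEquiv T φ n z (g z)
  rw [hg z (hmem hz')]
  exact ballEquiv_of_iso hT f hc (hmem hz') (hsub hz') (hsub (hadj z hz'))

/-- A regular tree covers every connected edge-indexed graph whose indices at each vertex add up
to the degree. -/
theorem exists_universalCover {d : ℕ} (hd : IsRegularOfDeg T d) (hT : T.IsTree) (Y : ColoredGraph)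
    (row : Y.V → Multiset Y.V)
    (hrow : ∀ v w, open Classical in (row v).count w = Y.idx v w) (hcard : ∀ v, (row v).card = d)
    (hsymm : ∀ v w, w ∈ row v → v ∈ row w) (y₀ : Y.V)
    (hconn : ∀ v w, Relation.ReflTransGen (fun v w => w ∈ row v) v w) :
    ∃ p : W → Y.V, IsUniversalCover T Y p := by
  classical
  have : Nonempty Y.V := ⟨y₀⟩
  obtain ⟨x₀⟩ := hT.connected.nonempty
  let Q : W → (W → Y.V) → Prop := fun x g => (nbrs T x).map g = row (g x)
  have hconst : ∀ x y, (nbrs T x).map (fun _ => ()) = (row y).map (fun _ => ()) := by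
    intro x y
    simp [Multiset.map_const', hd.card_nbrs, hcard]
  obtain ⟨k₀, hk₀, -⟩ := exists_map_eq_of_map_eq _ _ _ (nodup_nbrs x₀) _ (hconst x₀ y₀)
  obtain ⟨p, -, hp⟩ := exists_tree_extension hT (S := Y.V) x₀ Q (by
      intro x g g' e hg
      show _ = _
      rw [← e x (Or.inl rfl), ← (show _ = _ from hg)]
      exact Multiset.map_congr rfl fun w hw => (e w (Or.inr (hd.mem_nbrs.1 hw))).symm)
    (fun z => if z = x₀ then y₀ else k₀ z) (by
      show Multiset.map _ _ = row (if x₀ = x₀ then y₀ else k₀ x₀)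
      rw [if_pos rfl, ← hk₀]
      exact Multiset.map_congr rfl fun w hw => if_neg (hd.mem_nbrs.1 hw).ne')
    (by
      intro u x hux _ g hg
      have hmem : g x ∈ row (g u) := by
        rw [← (show _ = _ from hg)]
        exact Multiset.mem_map_of_mem g (hd.mem_nbrs.2 hux)
      -- Symmetry reserves an entry of the row at `g x` for the parent `u`; the remaining neighbours
      -- of `x` are matched arbitrarily with the remaining entries.
      obtain ⟨t, ht⟩ := Multiset.exists_cons_of_mem (hsymm _ _ hmem)
      obtain ⟨s, hs⟩ := Multiset.exists_cons_of_mem (hd.mem_nbrs.2 hux.symm)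
      have hns : (u ::ₘ s).Nodup := hs ▸ nodup_nbrs x
      rw [Multiset.nodup_cons] at hns
      have e : s.map (fun _ => ()) = t.map (fun _ => ()) := by
        have := hconst x (g x)
        rwa [hs, ht, Multiset.map_cons, Multiset.map_cons, Multiset.cons_inj_right] at this
      obtain ⟨k, hk, -⟩ := exists_map_eq_of_map_eq _ _ s hns.2 t e
      have hks : ∀ z ∈ s, (if z = u then g u else if z = x then g x else k z) = k z := by
        intro z hz
        rw [if_neg, if_neg]
        · rintro rfl
          exact T.loopless.irrefl z (hd.mem_nbrs.1 (hs ▸ Multiset.mem_cons_of_mem hz))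
        · rintro rfl
          exact hns.1 hz
      refine ⟨fun z => if z = u then g u else if z = x then g x else k z, ?_, by simp, ?_⟩
      · simp [hux.ne']
      · show Multiset.map _ _ = row (if x = u then g u else if x = x then g x else k x)
        rw [if_neg hux.ne', if_pos rfl, ht, hs, Multiset.map_cons, if_pos rfl, ← hk]
        congr 1
        exact Multiset.map_congr rfl hks)
  have hp' : ∀ x, (nbrs T x).map p = row (p x) := hp
  refine ⟨p, hT, ?_, ?_⟩
  · have hstep : ∀ v w, w ∈ row v → v ∈ Set.range p → w ∈ Set.range p := by
      rintro v w hw ⟨x, rfl⟩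
      rw [← hp'] at hw
      obtain ⟨z, -, hz⟩ := Multiset.mem_map.1 hw
      exact ⟨z, hz⟩
    have hall : ∀ v w, Relation.ReflTransGen (fun v w => w ∈ row v) v w → v ∈ Set.range p →
        w ∈ Set.range p := by
      intro v w h hv
      induction h with
      | refl => exact hv
      | tail _ h ih => exact hstep _ _ h ih
    exact fun w => hall _ w (hconn (p x₀) w) ⟨x₀, rfl⟩
  · intro x v
    rw [← count_map_nbrs hd p x v, hp', ← hrow]

end Trees
end SturmianTree

/-! ### Segments, folding maps and labelings -/

namespace SturmianTree

/-- The other letter. -/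
def Letter.other : Letter → Letter
  | .A => .B
  | .B => .A

/-- A segment with positions `0, …, L`; `lo t` and `hi t` are the indices of the edges from the
position `t` to `t - 1` and to `t + 1`. -/
structure Segment where
  L : ℕ
  lo : ℕ → ℕ
  hi : ℕ → ℕ

/-- The positions of the `d` neighbours of a lift of the position `t`. -/
def Segment.row (d : ℕ) (P : Segment) (t : ℕ) : Multiset ℕ :=
  Multiset.replicate (P.lo t) (t - 1) + Multiset.replicate (P.hi t) (t + 1) +
    Multiset.replicate (d - P.lo t - P.hi t) t

/-- The bound `le` makes the truncated subtraction in the loop index exact, so rows have `d`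
entries. The zeros at the ends prevent the meaningless positions `t - 1` at 0 and `t + 1` at `L`
from contributing. -/
structure Segment.Valid (d : ℕ) (P : Segment) : Prop where
  lo_zero : P.lo 0 = 0
  hi_last : P.hi P.L = 0
  lo_pos : ∀ t, 0 < t → t ≤ P.L → 0 < P.lo t
  hi_pos : ∀ t, t < P.L → 0 < P.hi t
  le : ∀ t, t ≤ P.L → P.lo t + P.hi t ≤ d

theorem Segment.mem_row {d : ℕ} {P : Segment} {t u : ℕ} (h : u ∈ P.row d t) :
    u ≤ t + 1 ∧ t ≤ u + 1 := by
  simp only [Segment.row, Multiset.mem_add, Multiset.mem_replicate] at h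
  omega

theorem Segment.row_congr {d : ℕ} {P Q : Segment} {t : ℕ} (h : P.lo t = Q.lo t)
    (h' : P.hi t = Q.hi t) : P.row d t = Q.row d t := by
  simp only [Segment.row, h, h']

theorem Segment.Valid.row_inj {d : ℕ} {P Q : Segment} (hP : P.Valid d) (hQ : Q.Valid d) {t : ℕ}
    (h : P.row d t = Q.row d t) : P.lo t = Q.lo t ∧ P.hi t = Q.hi t := by
  constructor
  -- At 0 the truncated `t - 1` is `t` itself, and counting it would include the loop; validity
  -- settles this case.
  · rcases Nat.eq_zero_or_pos t with rfl | ht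
    · rw [hP.lo_zero, hQ.lo_zero]
    · have := congrArg (Multiset.count (t - 1)) h
      simpa [Segment.row, Multiset.count_replicate, show ¬ (t = t - 1) by omega,
        show ¬ (t + 1 = t - 1) by omega] using this
  · have := congrArg (Multiset.count (t + 1)) h
    simpa [Segment.row, Multiset.count_replicate, show ¬ (t - 1 = t + 1) by omega] using this

/-- The length of the segment that is kept (and turned around) in the step from level `k` to level
`k + 1`. -/
def cut (seg : ℕ → Letter → Segment) (α : ℕ → Letter) (k : ℕ) : ℕ :=
  (seg k (α (k + 1)).other).L

/-- The map from positions of level `k + 1` to positions of level `k`. -/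
def fold (seg : ℕ → Letter → Segment) (α : ℕ → Letter) (ε : ℕ → ℕ) (k t : ℕ) : ℕ :=
  if t ≤ cut seg α k then cut seg α k - t else t - cut seg α k - ε k

/-- The numerical properties of the segments `F^X_k`: the long one is that of the letter `α k`, and
`ε k` tells whether the concatenation in the step to level `k + 1` adds an edge. -/
structure SegmentSystem (d : ℕ) (seg : ℕ → Letter → Segment) (α : ℕ → Letter) (ε : ℕ → ℕ) :
    Prop where
  valid : ∀ k X, (seg k X).Valid d
  short_le : ∀ k, (seg k (α k).other).L ≤ (seg k (α k)).L
  length_zero : (seg 0 (α 0)).L = 1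
  length_succ : ∀ k, (seg (k + 1) (α (k + 1))).L =
    (seg k (α k)).L + (seg k (α k).other).L + ε k
  agree : ∀ k t X Y, t < (seg k (α k).other).L →
    (seg k X).lo t = (seg k Y).lo t ∧ (seg k X).hi t = (seg k Y).hi t
  differ : ∀ k t, t = (seg k (α k).other).L → ¬ ((seg k (α k)).lo t = (seg k (α k).other).lo t ∧
    (seg k (α k)).hi t = (seg k (α k).other).hi t)
  -- The alternatives correspond to identified vertices, to a new edge with the other segment turned
  -- around, and to a new edge in both segments.
  eps : ∀ k, (ε k = 0 ∧ 0 < (seg k (α k).other).L ∧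
      (seg (k + 1) (α (k + 1)).other).L = cut seg α k) ∨
    (ε k = 1 ∧ (seg (k + 1) (α (k + 1)).other).L = cut seg α k ∧
      ∀ X Y, (seg (k + 1) X).lo (cut seg α k) = (seg (k + 1) Y).lo (cut seg α k)) ∨
    (ε k = 1 ∧ (seg (k + 1) (α (k + 1)).other).L = cut seg α k + 1 ∧
      (seg (k + 1) (α (k + 1))).L = cut seg α k + 1)
  -- On the right side of `fold_left` and `fold_right` the letter does not depend on `X`: left of
  -- the cut a position looks, at level `k`, like the segment that is turned around, and right of it
  -- like the other one.
  fold_left : ∀ k X t, t ≤ (seg (k + 1) X).L → t ≤ cut seg α k →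
    ((seg (k + 1) X).row d t).map (fold seg α ε k) =
      (seg k (α (k + 1)).other).row d (fold seg α ε k t)
  fold_right : ∀ k X t, t ≤ (seg (k + 1) X).L → cut seg α k < t →
    fold seg α ε k t ≤ (seg k (α (k + 1))).L ∧
    ((seg (k + 1) X).row d t).map (fold seg α ε k) =
      (seg k (α (k + 1))).row d (fold seg α ε k t)

/-- Labels of the vertices of a tree by the positions of all levels. -/
structure Labeling {W C : Type*} (d : ℕ) (T : SimpleGraph W) (φ : W → C)
    (seg : ℕ → Letter → Segment) (α : ℕ → Letter) (ε : ℕ → ℕ) (l : ℕ → W → ℕ) : Prop where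
  fold : ∀ k x, l k x = fold seg α ε k (l (k + 1) x)
  row : ∀ k x, ∃ X, l k x ≤ (seg k X).L ∧ (nbrs T x).map (l k) = (seg k X).row d (l k x)
  color : ∀ x y, φ x = φ y ↔ l 0 x = l 0 y
  top : ∀ n, ∃ k, n ≤ k ∧ ∃ x, l k x = (seg k (α k)).L

/-! ### Counting classes of balls by labels -/

section Count

variable {W : Type*} {T : SimpleGraph W} {d : ℕ} {C : Type} {φ : W → C}
  {seg : ℕ → Letter → Segment} {α : ℕ → Letter} {ε : ℕ → ℕ} {l : ℕ → W → ℕ}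

theorem Letter.eq_or_eq_other (X Y : Letter) : X = Y ∨ X = Y.other := by
  cases X <;> cases Y <;> simp [Letter.other]

theorem SegmentSystem.length_le (S : SegmentSystem d seg α ε) (k : ℕ) (X : Letter) :
    (seg k X).L ≤ (seg k (α k)).L := by
  rcases X.eq_or_eq_other (α k) with h | h
  · rw [h]
  · rw [h]
    exact S.short_le k

theorem SegmentSystem.lt_length (S : SegmentSystem d seg α ε) (k : ℕ) :
    k < (seg k (α k)).L := by
  induction k with
  | zero => simp [S.length_zero]
  | succ k ih =>
    have h1 := S.length_succ k
    have h2 := S.eps k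
    omega

namespace Labeling

theorem le_length (H : Labeling d T φ seg α ε l) (S : SegmentSystem d seg α ε) (k : ℕ) (x : W) :
    l k x ≤ (seg k (α k)).L := by
  obtain ⟨X, hX, -⟩ := H.row k x
  exact hX.trans (S.length_le k X)

theorem color_eq (H : Labeling d T φ seg α ε l) {k : ℕ} {x y : W} (h : l k x = l k y) :
    φ x = φ y := by
  induction k with
  | zero => exact (H.color x y).2 h
  | succ k ih => exact ih (by rw [H.fold k x, H.fold k y, h])

theorem adj (H : Labeling d T φ seg α ε l) (k : ℕ) {x z : W} (hz : z ∈ nbrs T x) :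
    l k z ≤ l k x + 1 ∧ l k x ≤ l k z + 1 := by
  obtain ⟨X, -, hX⟩ := H.row k x
  exact Segment.mem_row (d := d) (P := seg k X) (by rw [← hX]; exact Multiset.mem_map_of_mem _ hz)

/-- Below the exceptional position both segments have the same indices, and above it only the long
segment has positions. So the row is determined by the label. -/
theorem map_eq_of_ne (H : Labeling d T φ seg α ε l) (S : SegmentSystem d seg α ε) {k : ℕ} {x y : W}
    (h : l k x = l k y) (hs : l k x ≠ (seg k (α k).other).L) :
    (nbrs T x).map (l k) = (nbrs T y).map (l k) := by
  obtain ⟨X, hX, hX'⟩ := H.row k x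
  obtain ⟨Y, hY, hY'⟩ := H.row k y
  rw [hX', hY', ← h]
  rw [← h] at hY
  rcases lt_or_gt_of_ne hs with hlt | hgt
  · have := S.agree k _ X Y hlt
    exact Segment.row_congr this.1 this.2
  · have aux : ∀ Z, l k x ≤ (seg k Z).L → Z = α k := by
      intro Z hZ
      rcases Z.eq_or_eq_other (α k) with e | e
      · exact e
      · rw [e] at hZ
        omega
    rw [aux X hX, aux Y hY]

/-- At the join of the new segment, the neighbours agree up to exchanging the two positions at
which the new edge has been added. -/
theorem map_min_eq (H : Labeling d T φ seg α ε l) (S : SegmentSystem d seg α ε) {k : ℕ} {x y : W}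
    (h : l (k + 1) x = (seg (k + 1) (α (k + 1)).other).L)
    (h' : l (k + 1) y = (seg (k + 1) (α (k + 1)).other).L) (hε : ε k = 1) :
    (nbrs T x).map (fun z => min (l (k + 1) z) (cut seg α k)) =
      (nbrs T y).map (fun z => min (l (k + 1) z) (cut seg α k)) := by
  obtain ⟨X, hX, hX'⟩ := H.row (k + 1) x
  obtain ⟨Y, hY, hY'⟩ := H.row (k + 1) y
  have e : ∀ w : W, (nbrs T w).map (fun z => min (l (k + 1) z) (cut seg α k)) =
      ((nbrs T w).map (l (k + 1))).map (fun t => min t (cut seg α k)) := by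
    intro w
    rw [Multiset.map_map]
    rfl
  rw [e, e, hX', hY', h, h']
  rw [h] at hX
  rw [h'] at hY
  rcases S.eps k with h0 | ⟨-, hc, hlo⟩ | ⟨-, hc, hL⟩
  · omega
  -- The exceptional position is the cut. The minimum merges the new edge with the loop, so only
  -- `lo` still matters, and it is common to both segments.
  · rw [hc] at hX hY ⊢
    have aux : ∀ Z, cut seg α k ≤ (seg (k + 1) Z).L →
        ((seg (k + 1) Z).row d (cut seg α k)).map (fun t => min t (cut seg α k)) =
        Multiset.replicate ((seg (k + 1) Z).lo (cut seg α k)) (cut seg α k - 1) +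
        Multiset.replicate (d - (seg (k + 1) Z).lo (cut seg α k)) (cut seg α k) := by
      intro Z hZ
      have hv := (S.valid (k + 1) Z).le _ hZ
      simp only [Segment.row, Multiset.map_add, Multiset.map_replicate]
      rw [min_eq_left (by omega), min_eq_right (by omega), min_self, add_assoc,
        ← Multiset.replicate_add]
      congr 2
      omega
    rw [aux X hX, aux Y hY, hlo X Y]
  -- The exceptional position is just after the cut. All its neighbours lie at the cut or beyond, so
  -- the minimum is constant.
  · rw [hc] at hX hY ⊢
    have aux : ∀ Z, cut seg α k + 1 ≤ (seg (k + 1) Z).L →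
        ((seg (k + 1) Z).row d (cut seg α k + 1)).map (fun t => min t (cut seg α k)) =
        Multiset.replicate d (cut seg α k) := by
      intro Z hZ
      have hv := (S.valid (k + 1) Z).le _ hZ
      simp only [Segment.row, Multiset.map_add, Multiset.map_replicate]
      rw [min_eq_right (by omega), min_eq_right (by omega), min_eq_right (by omega),
        ← Multiset.replicate_add, ← Multiset.replicate_add]
      congr 1
      omega
    rw [aux X hX, aux Y hY]

/-- Vertices with the same label of level `k` stay equivalent for as many rounds of color
refinement as the distance to the exceptional position allows. -/
theorem refine_eq (H : Labeling d T φ seg α ε l) (S : SegmentSystem d seg α ε) (k r : ℕ) {x y : W}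
    (h : l k x = l k y)
    (hr : r + 1 ≤ (seg k (α k)).L + (l k x - (seg k (α k).other).L) +
      ((seg k (α k).other).L - l k x)) :
    refine T φ r x = refine T φ r y := by
  -- The two truncated differences in `hr` add up to the distance of the label from the exceptional
  -- position. Elsewhere a round lowers `r` by 1 and this distance by at most 1; at the exceptional
  -- position itself one descends a level.
  induction k generalizing r x y with
  | zero =>
    induction r generalizing x y with
    | zero => exact H.color_eq h
    | succ r ihr =>
      have h0 := S.length_zero
      refine refine_succ_iff.2 ⟨H.color_eq h, map_refine_of_map (l 0)
        (H.map_eq_of_ne S h (by omega)) fun z hz z' _ e => ihr e ?_⟩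
      have := H.adj 0 hz
      omega
  | succ k ihk =>
    induction r generalizing x y with
    | zero => exact H.color_eq h
    | succ r ihr =>
      by_cases hs : l (k + 1) x = (seg (k + 1) (α (k + 1)).other).L
      · have hlen := S.length_succ k
        have hfold : ∀ w, (l (k + 1) w = cut seg α k ∨
            l (k + 1) w = cut seg α k + 1 ∧ ε k = 1) → l k w = 0 := by
          intro w hw
          rw [H.fold]
          unfold SturmianTree.fold
          split_ifs <;> omega
        -- Without a new edge the vertex has label 0 at level `k`, at distance s_k from the
        -- exceptional position, and L_{k+1} = L_k + s_k is exactly the allowance there.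
        by_cases hε : ε k = 0
        · have hc : (seg (k + 1) (α (k + 1)).other).L = cut seg α k := by
            have := S.eps k
            omega
          have hx0 := hfold x (Or.inl (hs.trans hc))
          have hy0 := hfold y (Or.inl (h.symm.trans (hs.trans hc)))
          exact ihk (r + 1) (hx0.trans hy0.symm) (by omega)
        · have hε1 : ε k = 1 := by have := S.eps k; omega
          -- Neighbours below the cut have equal labels of level `k + 1`, away from the exceptional
          -- position. The others sit at the ends of the new edge, so they have label 0 at level
          -- `k`; the allowance L_k + s_k there is L_{k+1} minus the round just spent.
          refine refine_succ_iff.2 ⟨H.color_eq h, map_refine_of_map _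
            (H.map_min_eq S hs (h.symm.trans hs) hε1) fun z hz z' hz' e => ?_⟩
          have hzx := H.adj (k + 1) hz
          have hzy := H.adj (k + 1) hz'
          have hzN := H.le_length S (k + 1) z
          have hzN' := H.le_length S (k + 1) z'
          by_cases hzc : l (k + 1) z < cut seg α k
          · exact ihr (by omega) (by omega)
          · have hc : (seg (k + 1) (α (k + 1)).other).L = cut seg α k ∨
                (seg (k + 1) (α (k + 1)).other).L = cut seg α k + 1 ∧
                  (seg (k + 1) (α (k + 1))).L = cut seg α k + 1 := by
              rcases S.eps k with h1 | h1 | h1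
              · omega
              · exact Or.inl h1.2.1
              · exact Or.inr h1.2
            have hz0 := hfold z (by omega)
            have hz0' := hfold z' (by omega)
            exact ihk r (hz0.trans hz0'.symm) (by omega)
      · refine refine_succ_iff.2 ⟨H.color_eq h, map_refine_of_map (l (k + 1))
          (H.map_eq_of_ne S h hs) fun z hz z' _ e => ihr e ?_⟩
        have := H.adj (k + 1) hz
        omega

/-- The labels are constant on the classes of any partition that is stable under color
refinement. -/
theorem eq_of_stable (H : Labeling d T φ seg α ε l) (S : SegmentSystem d seg α ε) {X : Type*}
    (f : W → X) (hf : ∀ x y, f x = f y → φ x = φ y)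
    (hf' : ∀ x y, f x = f y → (nbrs T x).map f = (nbrs T y).map f) (k : ℕ) {x y : W}
    (h : f x = f y) : l k x = l k y := by
  induction k generalizing x y with
  | zero => exact (H.color x y).1 (hf x y h)
  | succ k ih =>
    -- `fold` is injective on either side of the cut, as labels beyond it start at `cut + ε`. So
    -- only a pair on different sides must be excluded, by induction on the distance `n` of its
    -- common label of level `k` from s_k.
    suffices main : ∀ n x y, f x = f y → (seg k (α k).other).L = l k x + n →
        l (k + 1) x ≤ cut seg α k → cut seg α k < l (k + 1) y → False by
      have key : ∀ x y, f x = f y →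
          ¬ (l (k + 1) x ≤ cut seg α k ∧ cut seg α k < l (k + 1) y) := by
        rintro x y h ⟨h1, h2⟩
        have e := ih h
        obtain ⟨Y, hY, -⟩ := H.row (k + 1) y
        have hY' := (S.fold_right k Y _ hY h2).1
        rw [← H.fold] at hY'
        have hx := H.fold k x
        unfold SturmianTree.fold at hx
        rw [if_pos h1] at hx
        have hle : l k x ≤ (seg k (α k).other).L := by
          rcases (α (k + 1)).eq_or_eq_other (α k) with e' | e'
          · have : l k x ≤ cut seg α k := by omega
            rwa [cut, e'] at this
          · rwa [e', ← e] at hY'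
        exact main ((seg k (α k).other).L - l k x) x y h (by omega) h1 h2
      have k1 := key x y h
      have k2 := key y x h.symm
      have e := ih h
      rw [H.fold k x, H.fold k y] at e
      unfold SturmianTree.fold at e
      have hε := S.eps k
      have : ∀ w, cut seg α k < l (k + 1) w → cut seg α k + ε k ≤ l (k + 1) w := by
        intro w hw
        omega
      have hx := this x
      have hy := this y
      split_ifs at e <;> omega
    intro n
    induction n with
    | zero =>
      -- At s_k, `x` sees the row of the segment turned around and `y` that of the other one.
      -- Stability makes the rows equal, whereas the segments differ at s_k.
      intro x y h hn h1 h2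
      have e := ih h
      obtain ⟨X, hX, hX'⟩ := H.row (k + 1) x
      obtain ⟨Y, hY, hY'⟩ := H.row (k + 1) y
      have hmap : ∀ w, (nbrs T w).map (l k) =
          ((nbrs T w).map (l (k + 1))).map (SturmianTree.fold seg α ε k) := by
        intro w
        rw [Multiset.map_map]
        exact Multiset.map_congr rfl fun z _ => H.fold k z
      have rx : (nbrs T x).map (l k) = (seg k (α (k + 1)).other).row d (l k x) := by
        rw [hmap, hX', S.fold_left k X _ hX h1, ← H.fold]
      have ry : (nbrs T y).map (l k) = (seg k (α (k + 1))).row d (l k x) := by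
        rw [hmap, hY', (S.fold_right k Y _ hY h2).2, ← H.fold, e]
      have : Nonempty W := ⟨x⟩
      obtain ⟨g, hg, hg'⟩ := exists_map_eq_of_map_eq f f _ (nodup_nbrs x) _ (hf' x y h)
      have rxy : (nbrs T x).map (l k) = (nbrs T y).map (l k) := by
        rw [← hg, Multiset.map_map]
        exact Multiset.map_congr rfl fun z hz => ih (hg' z hz).symm
      rw [rx, ry] at rxy
      have hrow := (S.valid k _).row_inj (S.valid k _) rxy
      have hd := S.differ k (l k x) (by omega)
      rcases (α (k + 1)).eq_or_eq_other (α k) with e' | e'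
      · rw [e'] at hrow
        exact hd ⟨hrow.1.symm, hrow.2.symm⟩
      · have e'' : (α (k + 1)).other = α k := by rw [e']; cases α k <;> rfl
        rw [e'', e'] at hrow
        exact hd hrow
    | succ n ihn =>
      intro x y h hn h1 h2
      have hx := H.fold k x
      unfold SturmianTree.fold at hx
      rw [if_pos h1] at hx
      obtain ⟨X, hX, hX'⟩ := H.row (k + 1) x
      have hc : l k x < cut seg α k := by
        have : (seg k (α k).other).L ≤ cut seg α k := by
          unfold cut
          rcases (α (k + 1)).other.eq_or_eq_other (α k) with e' | e'
          · rw [e']; exact S.short_le k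
          · rw [e']
        omega
      -- Step from `x` away from the cut, which raises the label of level `k` by 1. The
      -- corresponding neighbour of `y` has this positive label too, so it has not crossed the cut:
      -- otherwise it would sit at the cut and fold to 0.
      have hlo := (S.valid (k + 1) X).lo_pos (l (k + 1) x) (by omega) hX
      have hmem : l (k + 1) x - 1 ∈ (nbrs T x).map (l (k + 1)) := by
        rw [hX']
        simp only [Segment.row, Multiset.mem_add, Multiset.mem_replicate]
        exact Or.inl (Or.inl ⟨hlo.ne', trivial⟩)
      obtain ⟨z, hz, hzl⟩ := Multiset.mem_map.1 hmem
      have hfz : f z ∈ (nbrs T y).map f := by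
        rw [← hf' x y h]
        exact Multiset.mem_map_of_mem f hz
      obtain ⟨z', hz', hzz⟩ := Multiset.mem_map.1 hfz
      have hzk := H.fold k z
      unfold SturmianTree.fold at hzk
      rw [if_pos (by omega)] at hzk
      have hzy := H.adj (k + 1) hz'
      by_cases hz2 : l (k + 1) z' ≤ cut seg α k
      · have e := ih hzz
        have hzk' := H.fold k z'
        unfold SturmianTree.fold at hzk'
        rw [if_pos hz2] at hzk'
        omega
      · exact ihn z z' hzz.symm (by omega) (by omega) (by omega)

theorem exists_label_eq (H : Labeling d T φ seg α ε l) (S : SegmentSystem d seg α ε) {k : ℕ}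
    (hk : ∃ x, l k x = (seg k (α k)).L) (t : ℕ) (ht : t ≤ (seg k (α k)).L) : ∃ x, l k x = t := by
  induction ht using Nat.decreasingInduction with
  | self => exact hk
  | of_succ t _ ih =>
    obtain ⟨x, hx⟩ := ih
    obtain ⟨X, hX, hX'⟩ := H.row k x
    have hlo := (S.valid k X).lo_pos (l k x) (by omega) hX
    have hmem : t ∈ (nbrs T x).map (l k) := by
      rw [hX']
      simp only [Segment.row, Multiset.mem_add, Multiset.mem_replicate]
      omega
    obtain ⟨z, -, hz⟩ := Multiset.mem_map.1 hmem
    exact ⟨z, hz⟩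

theorem ballEquiv (H : Labeling d T φ seg α ε l) (S : SegmentSystem d seg α ε)
    (hd : IsRegularOfDeg T d) (hT : T.IsTree) {k : ℕ} {x y : W} (h : l k x = l k y) :
    BallEquiv T φ ((seg k (α k)).L - 1) x y :=
  ballEquiv_of_refine hd hT (H.refine_eq S k _ h (by have := S.lt_length k; omega))

/-- With `L = L_k`, there are at most `L + 1` labels of level `k`, and each determines the ball of
radius `L - 1`. -/
theorem finite_and_card_le (H : Labeling d T φ seg α ε l) (S : SegmentSystem d seg α ε)
    (hd : IsRegularOfDeg T d) (hT : T.IsTree) (k : ℕ) :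
    Finite (Quotient (ballSetoid T φ ((seg k (α k)).L - 1))) ∧
      complexity T φ ((seg k (α k)).L - 1) ≤ (seg k (α k)).L + 1 := by
  classical
  obtain ⟨x₀⟩ := hT.connected.nonempty
  let g : Fin ((seg k (α k)).L + 1) → Quotient (ballSetoid T φ ((seg k (α k)).L - 1)) := fun i =>
    if h : ∃ x, l k x = i then Quotient.mk _ h.choose else Quotient.mk _ x₀
  have hg : Function.Surjective g := by
    intro q
    induction q using Quotient.inductionOn with
    | _ x =>
    have hx : ∃ z, l k z = l k x := ⟨x, rfl⟩
    refine ⟨⟨l k x, Nat.lt_succ_of_le (H.le_length S k x)⟩, ?_⟩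
    simp only [g, hx, dif_pos]
    exact Quotient.sound (H.ballEquiv S hd hT hx.choose_spec)
  refine ⟨Finite.of_surjective g hg, ?_⟩
  exact (Nat.card_le_card_of_surjective g hg).trans (by simp)

theorem isSturmian (H : Labeling d T φ seg α ε l) (S : SegmentSystem d seg α ε)
    (hd : IsRegularOfDeg T d) (hT : T.IsTree) : IsSturmian T φ := by
  classical
  let pr : ∀ n, Quotient (ballSetoid T φ (n + 1)) → Quotient (ballSetoid T φ n) := fun n =>
    Quotient.map' id fun x y h => BallEquiv.of_succ hT h
  have hpr : ∀ n, Function.Surjective (pr n) := by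
    intro n q
    induction q using Quotient.inductionOn with
    | _ x => exact ⟨Quotient.mk _ x, rfl⟩
  have hfin' : ∀ m n, n ≤ m → Finite (Quotient (ballSetoid T φ m)) →
      Finite (Quotient (ballSetoid T φ n)) := by
    intro m n hnm hm
    induction m, hnm using Nat.le_induction with
    | base => exact hm
    | succ m _ ih => exact ih (Finite.of_surjective (pr m) (hpr m))
  have hfin : ∀ n, Finite (Quotient (ballSetoid T φ n)) := fun n =>
    hfin' _ n (by have := S.lt_length (n + 1); omega) (H.finite_and_card_le S hd hT (n + 1)).1
  -- No finite partition refining the colors is stable: for arbitrarily large `k` all `L_k + 1`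
  -- labels occur, and a class carries only one of them.
  have hunb : ∀ (X : Type _) [Finite X] (f : W → X), (∀ x y, f x = f y → φ x = φ y) →
      (∀ x y, f x = f y → (nbrs T x).map f = (nbrs T y).map f) → False := by
    intro X _ f h1 h2
    obtain ⟨k, hk, hx⟩ := H.top (Nat.card X)
    have hs := H.exists_label_eq S hx
    have := hT.connected.nonempty
    choose! x hx using hs
    let g : Fin ((seg k (α k)).L + 1) → X := fun i => f (x i)
    have hg : Function.Injective g := by
      intro i j e
      have := H.eq_of_stable S f h1 h2 k e
      rw [hx i (by omega), hx j (by omega)] at this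
      exact Fin.ext this
    have h3 := Nat.card_le_card_of_injective g hg
    have h4 := S.lt_length k
    simp only [Nat.card_eq_fintype_card, Fintype.card_fin] at h3 hk
    omega
  have hmono : ∀ n, complexity T φ n < complexity T φ (n + 1) := by
    intro n
    have := hfin n
    have := hfin (n + 1)
    refine lt_of_le_of_ne (Nat.card_le_card_of_surjective (pr n) (hpr n)) fun e => ?_
    -- If the complexity did not grow, restriction of balls would be injective on classes, and the
    -- partition into `n`-balls would be stable.
    have hbij := (Nat.bijective_iff_surjective_and_card (pr n)).2 ⟨hpr n, e.symm⟩
    have hball : ∀ x y, BallEquiv T φ n x y → BallEquiv T φ (n + 1) x y := by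
      intro x y h
      have h' : pr n (Quotient.mk _ x) = pr n (Quotient.mk _ y) := Quotient.sound h
      exact Quotient.exact (hbij.1 h')
    refine hunb _ (Quotient.mk (ballSetoid T φ n)) (fun x y h => ?_) (fun x y h => ?_)
    · exact BallEquiv.color_eq (Quotient.exact h)
    · exact BallEquiv.map_nbrs hd hT (hball x y (Quotient.exact h))
  have hzero : 2 ≤ complexity T φ 0 := by
    by_contra hlt
    have := hfin 0
    have hsub : Subsingleton (Quotient (ballSetoid T φ 0)) :=
      Finite.card_le_one_iff_subsingleton.1 (by unfold complexity at hlt; omega)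
    refine hunb PUnit (fun _ => PUnit.unit) (fun x y _ => ?_) (fun x y _ => ?_)
    · exact BallEquiv.color_eq (Quotient.exact
        (Subsingleton.elim (Quotient.mk (ballSetoid T φ 0) x) (Quotient.mk _ y)))
    · simp [Multiset.map_const', hd.card_nbrs]
  have hlow : ∀ n m, complexity T φ n + m ≤ complexity T φ (n + m) := by
    intro n m
    induction m with
    | zero => simp
    | succ m ih => have := hmono (n + m); rw [Nat.add_assoc] at this; omega
  intro n
  have h1 := hlow 0 n
  have h2 := (H.finite_and_card_le S hd hT (n + 1)).2
  have h3 := S.lt_length (n + 1)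
  -- From radius `n` to `L - 1` the complexity gains at least `L - 1 - n`, yet ends at most at `L +
  -- 1`; this leaves at most `n + 2` at radius `n`.
  have h4 := hlow n ((seg (n + 1) (α (n + 1))).L - 1 - n)
  rw [show n + ((seg (n + 1) (α (n + 1))).L - 1 - n) = (seg (n + 1) (α (n + 1))).L - 1 by omega]
    at h4
  rw [zero_add] at h1
  omega

end Labeling

end Count
end SturmianTree

/-! ### Reversing, joining and gluing segments, and folding them back -/

namespace SturmianTree

namespace Segment

/-- The segment `P` turned around. -/
def rev (P : Segment) : Segment where
  L := P.L
  lo t := P.hi (P.L - t)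
  hi t := P.lo (P.L - t)

/-- The segment `P` turned around, followed by `Q`, with a new edge between the positions `0` of `P`
and `Q` with index `e` at `P` and index `f` at `Q`. -/
def join (P Q : Segment) (e f : ℕ) : Segment where
  L := P.L + Q.L + 1
  lo t := if t ≤ P.L then P.hi (P.L - t) else if t = P.L + 1 then f else Q.lo (t - P.L - 1)
  hi t := if t < P.L then P.lo (P.L - t) else if t = P.L then e else Q.hi (t - P.L - 1)

/-- The segment `P` turned around and `Q`, with their positions `0` identified, where the indices
are `e` towards `Q` and `f` towards `P`. -/
def glue (P Q : Segment) (e f : ℕ) : Segment where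
  L := P.L + Q.L
  lo t := if t < P.L then P.hi (P.L - t) else if t = P.L then f else Q.lo (t - P.L)
  hi t := if t < P.L then P.lo (P.L - t) else if t = P.L then e else Q.hi (t - P.L)

variable {d : ℕ} {P Q R : Segment} {g : ℕ → ℕ} {t u : ℕ}

theorem replicate_congr {n : ℕ} (h : 0 < n → t = u) :
    Multiset.replicate n t = Multiset.replicate n u := by
  rcases Nat.eq_zero_or_pos n with rfl | hn
  · simp
  · rw [h hn]

theorem map_row : (P.row d t).map g = Multiset.replicate (P.lo t) (g (t - 1)) +
    Multiset.replicate (P.hi t) (g (t + 1)) +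
    Multiset.replicate (d - P.lo t - P.hi t) (g t) := by
  simp [row]

/-- For positions where `g` reverses the orientation. The values at the neighbouring positions are
only required where an edge exists, so the ends are covered as well. -/
theorem map_row_flip (hlo : P.lo t = Q.hi u) (hhi : P.hi t = Q.lo u) (h0 : g t = u)
    (h1 : 0 < P.lo t → g (t - 1) = u + 1) (h2 : 0 < P.hi t → g (t + 1) = u - 1) :
    (P.row d t).map g = Q.row d u := by
  rw [map_row, replicate_congr h1, replicate_congr h2, h0, row, hlo, hhi,
    add_comm (Multiset.replicate (Q.hi u) (u + 1)), Nat.sub_right_comm]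

theorem map_row_shift (hlo : P.lo t = Q.lo u) (hhi : P.hi t = Q.hi u) (h0 : g t = u)
    (h1 : 0 < P.lo t → g (t - 1) = u - 1) (h2 : 0 < P.hi t → g (t + 1) = u + 1) :
    (P.row d t).map g = Q.row d u := by
  rw [map_row, replicate_congr h1, replicate_congr h2, h0, row, hlo, hhi]

theorem Valid.row_zero (hQ : Q.Valid d) :
    Q.row d 0 = Multiset.replicate (Q.hi 0) 1 + Multiset.replicate (d - Q.hi 0) 0 := by
  simp [row, hQ.lo_zero]

/-- At an end of the new edge: its other end also folds to 0, so its index returns to the loop it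
was taken from. -/
theorem map_row_join_left (hQ : Q.Valid d) (hlo : P.lo t = Q.hi 0) (hd : Q.hi 0 + P.hi t ≤ d)
    (h0 : g t = 0) (h1 : 0 < P.lo t → g (t - 1) = 1) (h2 : g (t + 1) = 0) :
    (P.row d t).map g = Q.row d 0 := by
  rw [map_row, replicate_congr h1, h2, h0, hQ.row_zero, hlo, add_assoc, ← Multiset.replicate_add]
  congr 2
  omega

theorem map_row_join_right (hQ : Q.Valid d) (hhi : P.hi t = Q.hi 0) (hd : Q.hi 0 + P.lo t ≤ d)
    (h0 : g t = 0) (h1 : 0 < P.hi t → g (t + 1) = 1) (h2 : g (t - 1) = 0) :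
    (P.row d t).map g = Q.row d 0 := by
  rw [map_row, replicate_congr h1, h2, h0, hQ.row_zero, hhi,
    add_comm (Multiset.replicate (P.lo t) 0), add_assoc, ← Multiset.replicate_add]
  congr 2
  omega

/-- At the identified vertex both edges fold onto the edge from 0 to 1, whose index is the sum of
theirs. -/
theorem map_row_glue (hQ : Q.Valid d) (h : P.lo t + P.hi t = Q.hi 0)
    (h0 : g t = 0) (h1 : g (t + 1) = 1) (h2 : g (t - 1) = 1) :
    (P.row d t).map g = Q.row d 0 := by
  rw [map_row, h1, h2, h0, hQ.row_zero, ← Multiset.replicate_add, h, Nat.sub_sub, h]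

theorem Valid.rev (h : P.Valid d) : P.rev.Valid d where
  lo_zero := by simp [Segment.rev, h.hi_last]
  hi_last := by simp [Segment.rev, h.lo_zero]
  lo_pos t h0 h1 := by
    simp only [Segment.rev] at h1 ⊢
    exact h.hi_pos _ (by omega)
  hi_pos t h1 := by
    simp only [Segment.rev] at h1 ⊢
    exact h.lo_pos _ (by omega) (by omega)
  le t ht := by
    simp only [Segment.rev] at ht ⊢
    have := h.le (P.L - t) (by omega)
    omega

theorem Valid.join (hP : P.Valid d) (hQ : Q.Valid d) {e f : ℕ} (he : 0 < e) (hf : 0 < f)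
    (hed : P.hi 0 + e ≤ d) (hfd : Q.hi 0 + f ≤ d) : (P.join Q e f).Valid d where
  lo_zero := by simp [Segment.join, hP.hi_last]
  hi_last := by
    simp only [Segment.join]
    rw [if_neg (by omega), if_neg (by omega), show P.L + Q.L + 1 - P.L - 1 = Q.L by omega,
      hQ.hi_last]
  lo_pos t h0 h1 := by
    simp only [Segment.join] at h1 ⊢
    split_ifs with h2 h3
    · exact hP.hi_pos _ (by omega)
    · exact hf
    · exact hQ.lo_pos _ (by omega) (by omega)
  hi_pos t h1 := by
    simp only [Segment.join] at h1 ⊢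
    split_ifs with h2 h3
    · exact hP.lo_pos _ (by omega) (by omega)
    · exact he
    · exact hQ.hi_pos _ (by omega)
  le t ht := by
    simp only [Segment.join] at ht ⊢
    rcases lt_trichotomy t P.L with h | h | h
    · rw [if_pos h.le, if_pos h]
      have := hP.le (P.L - t) (by omega)
      omega
    · subst h
      simpa using hed
    · rcases eq_or_ne t (P.L + 1) with rfl | h2
      · simpa [add_comm] using hfd
      · rw [if_neg (by omega : ¬ t ≤ P.L), if_neg h2, if_neg (by omega : ¬ t < P.L),
          if_neg (by omega : ¬ t = P.L)]
        exact hQ.le _ (by omega)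

theorem Valid.glue (hP : P.Valid d) (hQ : Q.Valid d) {e f : ℕ} (he : 0 < e) (hf : 0 < f)
    (hPL : 0 < P.L) (hQL : 0 < Q.L) (hP0 : e + f = P.hi 0) : (P.glue Q e f).Valid d where
  lo_zero := by simp [Segment.glue, hP.hi_last, hPL]
  hi_last := by
    simp only [Segment.glue]
    rw [if_neg (by omega), if_neg (by omega), show P.L + Q.L - P.L = Q.L by omega,
      hQ.hi_last]
  lo_pos t h0 h1 := by
    simp only [Segment.glue] at h1 ⊢
    split_ifs with h2 h3
    · exact hP.hi_pos _ (by omega)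
    · exact hf
    · exact hQ.lo_pos _ (by omega) (by omega)
  hi_pos t h1 := by
    simp only [Segment.glue] at h1 ⊢
    split_ifs with h2 h3
    · exact hP.lo_pos _ (by omega) (by omega)
    · exact he
    · exact hQ.hi_pos _ (by omega)
  le t ht := by
    simp only [Segment.glue] at ht ⊢
    rcases lt_trichotomy t P.L with h | h | h
    · rw [if_pos h, if_pos h]
      have := hP.le (P.L - t) (by omega)
      omega
    · subst h
      have := hP.le 0 (by omega)
      simp
      omega
    · rw [if_neg (by omega), if_neg (by omega), if_neg (by omega), if_neg (by omega)]
      exact hQ.le _ (by omega)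

end Segment

namespace Segment

variable {P Q : Segment} {e f : ℕ}

theorem rev_lo_last : P.rev.lo P.L = P.hi 0 := by
  simp [rev]

theorem join_hi_zero (h : 0 < P.L) : (P.join Q e f).hi 0 = P.lo P.L := by
  simp [join, h]

theorem join_lo_last (h : 0 < Q.L) : (P.join Q e f).lo (P.L + Q.L + 1) = Q.lo Q.L := by
  simp only [join]
  rw [if_neg (by omega), if_neg (by omega), show P.L + Q.L + 1 - P.L - 1 = Q.L by omega]

theorem glue_hi_zero (h : 0 < P.L) : (P.glue Q e f).hi 0 = P.lo P.L := by
  simp [glue, h]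

theorem glue_lo_last (h : 0 < Q.L) : (P.glue Q e f).lo (P.L + Q.L) = Q.lo Q.L := by
  simp only [glue]
  rw [if_neg (by omega), if_neg (by omega), show P.L + Q.L - P.L = Q.L by omega]

end Segment

/-- Turning the first `c` positions around and shifting the others. -/
def foldAt (c ε t : ℕ) : ℕ := if t ≤ c then c - t else t - c - ε

namespace Segment

variable {d : ℕ} {P Q R : Segment} {t : ℕ}

theorem map_foldAt_rev (hP : P.Valid d) (ε : ℕ) (ht : t ≤ P.L) :
    (P.rev.row d t).map (foldAt P.L ε) = P.row d (P.L - t) := by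
  refine map_row_flip rfl rfl (by simp [foldAt, ht]) (fun h => ?_) (fun h => ?_)
  · have : 0 < t := by
      by_contra h0
      simp [rev, show t = 0 by omega, hP.hi_last] at h
    simp only [foldAt]
    split_ifs <;> omega
  · have : t < P.L := by
      by_contra h0
      simp [rev, show t = P.L by omega, hP.lo_zero] at h
    simp only [foldAt]
    split_ifs <;> omega

theorem map_foldAt_join_left (hP : P.Valid d) {e f : ℕ} (hed : P.hi 0 + e ≤ d) (ht : t ≤ P.L) :
    ((P.join Q e f).row d t).map (foldAt P.L 1) = P.row d (P.L - t) := by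
  rcases ht.lt_or_eq with h | h
  · refine map_row_flip (by simp [join, ht]) (by simp [join, h]) (by simp [foldAt, ht])
      (fun h' => ?_) (fun h' => ?_)
    · have : 0 < t := by
        by_contra h0
        simp [join, show t = 0 by omega, hP.hi_last] at h'
      simp only [foldAt]
      split_ifs <;> omega
    · simp only [foldAt]
      split_ifs <;> omega
  · subst h
    rw [Nat.sub_self]
    refine map_row_join_left hP (by simp [join]) (by simpa [join] using hed) (by simp [foldAt])
      (fun h' => ?_) (by simp [foldAt])
    have : 0 < P.L := by
      by_contra h0
      have h1 := hP.hi_last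
      rw [show P.L = 0 by omega] at h1
      simp [join, h1] at h'
    simp only [foldAt]
    split_ifs <;> omega

theorem map_foldAt_join_right (hQ : Q.Valid d) {e f : ℕ} (hfd : Q.hi 0 + f ≤ d) (ht : P.L < t)  :
    ((P.join Q e f).row d t).map (foldAt P.L 1) = Q.row d (t - P.L - 1) := by
  rcases Nat.lt_or_eq_of_le (Nat.succ_le_of_lt ht) with h | h
  · refine map_row_shift ?_ ?_ ?_ (fun h' => ?_) (fun h' => ?_)
    · simp only [join]
      rw [if_neg (by omega), if_neg (by omega)]
    · simp only [join]
      rw [if_neg (by omega), if_neg (by omega)]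
    all_goals
      simp only [foldAt]
      split_ifs <;> omega
  · subst h
    rw [show P.L.succ - P.L - 1 = 0 by omega]
    refine map_row_join_right hQ (by simp [join]) (by simpa [join] using hfd) (by simp [foldAt])
      (fun h' => ?_) (by simp [foldAt])
    simp only [foldAt]
    split_ifs <;> omega

theorem map_foldAt_glue_left (hP : P.Valid d) {e f : ℕ} (hPL : 0 < P.L) (hP0 : e + f = P.hi 0)
    (ht : t ≤ P.L) :
    ((P.glue Q e f).row d t).map (foldAt P.L 0) = P.row d (P.L - t) := by
  rcases ht.lt_or_eq with h | h
  · refine map_row_flip (by simp [glue, h]) (by simp [glue, h]) (by simp [foldAt, ht])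
      (fun h' => ?_) (fun h' => ?_)
    · have : 0 < t := by
        by_contra h0
        simp [glue, show t = 0 by omega, hP.hi_last, hPL] at h'
      simp only [foldAt]
      split_ifs <;> omega
    · simp only [foldAt]
      split_ifs <;> omega
  · subst h
    rw [Nat.sub_self]
    refine map_row_glue hP (by simpa [glue, add_comm] using hP0) (by simp [foldAt]) ?_ ?_
    all_goals
      simp only [foldAt]
      split_ifs <;> omega

theorem map_foldAt_glue_right {e f : ℕ} (ht : P.L < t)  :
    ((P.glue Q e f).row d t).map (foldAt P.L 0) = Q.row d (t - P.L) := by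
  refine map_row_shift ?_ ?_ ?_ (fun h' => ?_) (fun h' => ?_)
  · simp only [glue]
    rw [if_neg (by omega), if_neg (by omega)]
  · simp only [glue]
    rw [if_neg (by omega), if_neg (by omega)]
  all_goals
    simp only [foldAt]
    split_ifs <;> omega

end Segment

/-- One step of the construction of the segments, from `s` to `s'`: the segment of the letter `X`
becomes the longer one, and that of the other letter is kept. -/
inductive SegmentStep (d : ℕ) (s s' : Letter → Segment) (X : Letter) : ℕ → Prop
  | join (e f : ℕ) (he : 0 < e) (hf : 0 < f) (hed : (s X.other).hi 0 + e ≤ d)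
      (hfd : (s X).hi 0 + f ≤ d) (h : s' X = (s X.other).join (s X) e f)
      (h' : s' X.other = (s X.other).rev) : SegmentStep d s s' X 1
  | glue (e f : ℕ) (he : 0 < e) (hf : 0 < f) (hL : 0 < (s X).L) (hL' : 0 < (s X.other).L)
      (hP : e + f = (s X.other).hi 0) (hQ : e + f = (s X).hi 0)
      (h : s' X = (s X.other).glue (s X) e f)
      (h' : s' X.other = (s X.other).rev) : SegmentStep d s s' X 0
  | both (e f f' : ℕ) (he : 0 < e) (hf : 0 < f) (hf' : 0 < f') (hff : f ≠ f')
      (hed : (s X.other).hi 0 + e ≤ d) (hfd : f ≤ d) (hfd' : f' ≤ d) (hL : (s X).L = 0)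
      (h : s' X = (s X.other).join (s X) e f)
      (h' : s' X.other = (s X.other).join (s X) e f') : SegmentStep d s s' X 1

/-! ### Properties of one step of the construction -/

namespace SegmentStep

variable {d : ℕ} {s s' : Letter → Segment} {X : Letter} {ε : ℕ}

theorem forall_letter {p : Letter → Prop} (X : Letter) (h : p X) (h' : p X.other) : ∀ Y, p Y := by
  intro Y
  rcases Y.eq_or_eq_other X with rfl | rfl
  · exact h
  · exact h'

theorem length (H : SegmentStep d s s' X ε) : (s' X).L = (s X.other).L + (s X).L + ε := by
  cases H with
  | join _ _ _ _ _ _ h _ => rw [h]; rfl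
  | glue _ _ _ _ _ _ _ _ h _ => rw [h]; rfl
  | both _ _ _ _ _ _ _ _ _ _ _ h _ => rw [h]; rfl

theorem length_other (H : SegmentStep d s s' X ε) : (s' X.other).L = (s X.other).L ∨
    ε = 1 ∧ (s X).L = 0 ∧ (s' X.other).L = (s X.other).L + 1 := by
  cases H with
  | join _ _ _ _ _ _ _ h => rw [h]; exact Or.inl rfl
  | glue _ _ _ _ _ _ _ _ _ h => rw [h]; exact Or.inl rfl
  | both _ _ _ _ _ _ _ _ _ _ hL _ h => rw [h]; simp [Segment.join, hL]

theorem eps_le (H : SegmentStep d s s' X ε) : ε = 1 ∨ ε = 0 ∧ 0 < (s X).L ∧ 0 < (s X.other).L := by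
  cases H with
  | join => exact Or.inl rfl
  | glue => exact Or.inr ⟨rfl, ‹_›, ‹_›⟩
  | both => exact Or.inl rfl

theorem valid (H : SegmentStep d s s' X ε) (hs : ∀ Y, (s Y).Valid d) (Y : Letter) :
    (s' Y).Valid d := by
  revert Y
  cases H with
  | join e f he hf hed hfd h h' =>
    exact forall_letter X (h ▸ (hs _).join (hs _) he hf hed hfd) (h' ▸ (hs _).rev)
  | glue e f he hf hL hL' hP hQ h h' =>
    exact forall_letter X (h ▸ (hs _).glue (hs _) he hf hL' hL hP) (h' ▸ (hs _).rev)
  | both e f f' he hf hf' hff hed hfd hfd' hL h h' =>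
    have h0 : (s X).hi 0 = 0 := by
      have := (hs X).hi_last
      rwa [hL] at this
    exact forall_letter X (h ▸ (hs _).join (hs _) he hf hed (by omega))
      (h' ▸ (hs _).join (hs _) he hf' hed (by omega))

theorem agree (H : SegmentStep d s s' X ε) {t : ℕ} (ht : t < (s' X.other).L) :
    (s' X).lo t = (s' X.other).lo t ∧ (s' X).hi t = (s' X.other).hi t := by
  cases H with
  | join e f he hf hed hfd h h' =>
    rw [h'] at ht ⊢
    have ht' : t < (s X.other).L := ht
    rw [h]
    simp [Segment.join, Segment.rev, ht', ht'.le]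
  | glue e f he hf hL hL' hP hQ h h' =>
    rw [h'] at ht ⊢
    have ht' : t < (s X.other).L := ht
    rw [h]
    simp [Segment.glue, Segment.rev, ht']
  | both e f f' he hf hf' hff hed hfd hfd' hL h h' =>
    rw [h'] at ht ⊢
    have ht' : t ≤ (s X.other).L := by
      have : t < (s X.other).L + (s X).L + 1 := ht
      omega
    rw [h]
    simp [Segment.join, ht']

/-- The segment turned around ends at this position while the longer one goes on. In the case
`both`, the positions are the last ones of both segments, and the indices `f` and `f'` tell them
apart. -/
theorem differ (H : SegmentStep d s s' X ε) (hs : ∀ Y, (s Y).Valid d) {t : ℕ}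
    (ht : t = (s' X.other).L) :
    ¬ ((s' X).lo t = (s' X.other).lo t ∧ (s' X).hi t = (s' X.other).hi t) := by
  cases H with
  | join e f he hf hed hfd h h' =>
    rintro ⟨-, h2⟩
    rw [h'] at ht h2
    have ht' : t = (s X.other).L := ht
    rw [h] at h2
    simp [Segment.join, Segment.rev, ht', (hs _).lo_zero] at h2
    omega
  | glue e f he hf hL hL' hP hQ h h' =>
    rintro ⟨-, h2⟩
    rw [h'] at ht h2
    have ht' : t = (s X.other).L := ht
    rw [h] at h2
    simp [Segment.glue, Segment.rev, ht', (hs _).lo_zero] at h2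
    omega
  | both e f f' he hf hf' hff hed hfd hfd' hL h h' =>
    rintro ⟨h1, -⟩
    rw [h'] at ht h1
    have ht' : t = (s X.other).L + 1 := by
      have : t = (s X.other).L + (s X).L + 1 := ht
      omega
    rw [h] at h1
    simp [Segment.join, ht'] at h1
    omega

theorem lo_cut (H : SegmentStep d s s' X ε) (hε : ε = 1) :
    (s' X).lo (s X.other).L = (s' X.other).lo (s X.other).L := by
  cases H with
  | join e f he hf hed hfd h h' => simp [h, h', Segment.join, Segment.rev]
  | glue => omega
  | both e f f' he hf hf' hff hed hfd hfd' hL h h' => simp [h, h', Segment.join]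

theorem fold_left (H : SegmentStep d s s' X ε) (hs : ∀ Y, (s Y).Valid d) (Y : Letter) {t : ℕ}
    (ht : t ≤ (s X.other).L) :
    ((s' Y).row d t).map (foldAt (s X.other).L ε) =
      (s X.other).row d (foldAt (s X.other).L ε t) := by
  have h0 : foldAt (s X.other).L ε t = (s X.other).L - t := by simp [foldAt, ht]
  rw [h0]
  revert Y
  cases H with
  | join e f he hf hed hfd h h' =>
    exact forall_letter X (by rw [h]; exact Segment.map_foldAt_join_left (hs _) hed ht)
      (by rw [h']; exact Segment.map_foldAt_rev (hs _) _ ht)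
  | glue e f he hf hL hL' hP hQ h h' =>
    exact forall_letter X (by rw [h]; exact Segment.map_foldAt_glue_left (hs _) hL' hP ht)
      (by rw [h']; exact Segment.map_foldAt_rev (hs _) _ ht)
  | both e f f' he hf hf' hff hed hfd hfd' hL h h' =>
    exact forall_letter X (by rw [h]; exact Segment.map_foldAt_join_left (hs _) hed ht)
      (by rw [h']; exact Segment.map_foldAt_join_left (hs _) hed ht)

theorem fold_right (H : SegmentStep d s s' X ε) (hs : ∀ Y, (s Y).Valid d) (Y : Letter) {t : ℕ}
    (ht : t ≤ (s' Y).L) (ht' : (s X.other).L < t) :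
    foldAt (s X.other).L ε t ≤ (s X).L ∧
    ((s' Y).row d t).map (foldAt (s X.other).L ε) = (s X).row d (foldAt (s X.other).L ε t) := by
  have h0 : foldAt (s X.other).L ε t = t - (s X.other).L - ε := by
    simp [foldAt, ht']
  rw [h0]
  revert Y
  cases H with
  | join e f he hf hed hfd h h' =>
    refine forall_letter X (fun ht => ⟨?_, ?_⟩) (fun ht => ?_)
    · rw [h] at ht
      have : t ≤ (s X.other).L + (s X).L + 1 := ht
      omega
    · rw [h]
      exact Segment.map_foldAt_join_right (hs _) hfd ht'
    · rw [h'] at ht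
      have : t ≤ (s X.other).L := ht
      omega
  | glue e f he hf hL hL' hP hQ h h' =>
    refine forall_letter X (fun ht => ⟨?_, ?_⟩) (fun ht => ?_)
    · rw [h] at ht
      have : t ≤ (s X.other).L + (s X).L := ht
      omega
    · rw [h]
      exact Segment.map_foldAt_glue_right ht'
    · rw [h'] at ht
      have : t ≤ (s X.other).L := ht
      omega
  | both e f f' he hf hf' hff hed hfd hfd' hL h h' =>
    have hz : (s X).hi 0 = 0 := by
      have := (hs X).hi_last
      rwa [hL] at this
    refine forall_letter X (fun ht => ⟨?_, ?_⟩) (fun ht => ⟨?_, ?_⟩)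
    · rw [h] at ht
      have : t ≤ (s X.other).L + (s X).L + 1 := ht
      omega
    · rw [h]
      exact Segment.map_foldAt_join_right (hs _) (by omega) ht'
    · rw [h'] at ht
      have : t ≤ (s X.other).L + (s X).L + 1 := ht
      omega
    · rw [h']
      exact Segment.map_foldAt_join_right (hs _) (by omega) ht'

end SegmentStep

/-- A sequence of segments that starts with two points and proceeds by the above steps. -/
theorem segmentSystem_of_step {d : ℕ} {s : ℕ → Letter → Segment} {α : ℕ → Letter} {ε : ℕ → ℕ}
    (h0 : ∀ X, (s 0 X).L = 0) (hv : ∀ X, (s 0 X).Valid d)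
    (H : ∀ k, SegmentStep d (s k) (s (k + 1)) (α k) (ε k)) :
    SegmentSystem d (fun k => s (k + 1)) α (fun k => ε (k + 1)) := by
  have valid : ∀ k X, (s k X).Valid d := by
    intro k
    induction k with
    | zero => exact hv
    | succ k ih => exact (H k).valid ih
  have hlong : ∀ k X Y, (s k X).L + (s k X.other).L = (s k Y).L + (s k Y.other).L := by
    intro k X Y
    rcases X.eq_or_eq_other Y with rfl | rfl
    · rfl
    · rw [show Y.other.other = Y by cases Y <;> rfl, add_comm]
  refine ⟨fun k => valid (k + 1), fun k => ?_, ?_, fun k => ?_, fun k t X Y ht => ?_,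
    fun k t ht => (H k).differ (valid k) ht, fun k => ?_,
    fun k X t _ ht => (H (k + 1)).fold_left (valid (k + 1)) X ht,
    fun k X t ht ht' => (H (k + 1)).fold_right (valid (k + 1)) X ht ht'⟩
  · have h1 := (H k).length
    have h2 := (H k).length_other
    omega
  · have h1 := (H 0).length
    have h2 := (H 0).eps_le
    rw [h0, h0] at h1 h2
    omega
  · have h1 := (H (k + 1)).length
    have h2 := hlong (k + 1) (α (k + 1)) (α k)
    omega
  · have h1 := (H k).agree ht
    revert Y
    revert X
    exact SegmentStep.forall_letter (α k) (SegmentStep.forall_letter (α k) ⟨rfl, rfl⟩ h1)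
      (SegmentStep.forall_letter (α k) ⟨h1.1.symm, h1.2.symm⟩ ⟨rfl, rfl⟩)
  · have h1 := (H (k + 1)).length
    rcases (H (k + 1)).eps_le with hε | ⟨hε, hL⟩
    · rcases (H (k + 1)).length_other with h2 | h2
      · have h3 := (H (k + 1)).lo_cut hε
        refine Or.inr (Or.inl ⟨hε, h2, ?_⟩)
        exact SegmentStep.forall_letter (α (k + 1))
          (SegmentStep.forall_letter (α (k + 1)) rfl h3)
          (SegmentStep.forall_letter (α (k + 1)) h3.symm rfl)
      · refine Or.inr (Or.inr ⟨hε, h2.2.2, ?_⟩)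
        show _ = (s (k + 1) (α (k + 1)).other).L + 1
        omega
    · refine Or.inl ⟨hε, ?_, ?_⟩
      · rcases (α k).other.eq_or_eq_other (α (k + 1)) with e | e
        · rw [e]
          exact hL.1
        · rw [e]
          exact hL.2
      · rcases (H (k + 1)).length_other with h2 | h2
        · exact h2
        · omega

/-! ### The segments of admissible data -/

/-- The number of edges that a concatenation adds. -/
def IndexData.edges : IndexData → ℕ
  | .one _ => 0
  | _ => 1

/-- The segments of the next stage. -/
def nextSegment (s : Letter → Segment) : Letter → IndexData → Letter → Segment
  | .A, .three i _ j, .A => (s .B).join (s .A) j i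
  | .A, .three _ i' j, .B => (s .B).join (s .A) j i'
  | .A, .one i, .A => (s .B).glue (s .A) i ((s .B).hi 0 - i)
  | .A, .one _, .B => (s .B).rev
  | .A, .two i j, .A => (s .B).join (s .A) j i
  | .A, .two _ _, .B => (s .B).rev
  | .B, .three i _ j, .B => (s .A).join (s .B) i j
  | .B, .one i, .B => (s .A).glue (s .B) ((s .B).hi 0 - i) i
  | .B, .two i j, .B => (s .A).join (s .B) i j
  | .B, _, .A => (s .A).rev

/-- The segments `F^X_{k-1}`. -/
def segments (α : ℕ → Letter) (ι : ℕ → IndexData) : ℕ → Letter → Segment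
  | 0 => fun _ => ⟨0, fun _ => 0, fun _ => 0⟩
  | k + 1 => nextSegment (segments α ι k) (α k) (ι k)

section Admissible

variable {d : ℕ} {α : ℕ → Letter} {ι : ℕ → IndexData}

theorem eq_B_of_lt_firstA {k : ℕ} (h : (k : ℕ∞) < firstA α) : α k = .B := by
  cases e : α k with
  | B => rfl
  | A => exact absurd (sInf_le (show (k : ℕ∞) ∈ {n : ℕ∞ | ∃ k : ℕ, n = (k : ℕ∞) ∧ α k = Letter.A}
    from ⟨k, rfl, e⟩)) (not_le.2 h)

theorem eq_A_of_eq_firstA {k : ℕ} (h : (k : ℕ∞) = firstA α) : α k = .A := by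
  have hne : {n : ℕ∞ | ∃ k : ℕ, n = (k : ℕ∞) ∧ α k = Letter.A}.Nonempty := by
    by_contra hne
    rw [Set.not_nonempty_iff_eq_empty] at hne
    rw [firstA, hne, sInf_empty] at h
    exact ENat.natCast_ne_top k h
  obtain ⟨m, hm, hA⟩ := csInf_mem hne
  have : (k : ℕ∞) = m := h.trans hm
  rw [Nat.cast_inj] at this
  rwa [this]

/-- Up to the first letter `A`, `F^A` stays a point and each step adds one vertex to `F^B` at its
joining end, with the newest index there. The far end keeps the index of the very first edge. -/
theorem segments_before (hι : AdmissibleIndices d α ι) (k : ℕ) (hk : (k : ℕ∞) ≤ firstA α) :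
    (segments α ι k .A).L = 0 ∧ (segments α ι k .A).hi 0 = 0 ∧ (segments α ι k .A).lo 0 = 0 ∧
      (segments α ι k .B).L = k ∧
      (segments α ι k .B).hi 0 = prevFst ι k ∧
      (0 < k → (segments α ι k .B).lo k = (ι 0).last) := by
  induction k with
  | zero => simp [segments, prevFst]
  | succ k ih =>
    have hlt : (k : ℕ∞) < firstA α :=
      lt_of_lt_of_le (Nat.cast_lt.2 (Nat.lt_succ_self k)) hk
    obtain ⟨h1, h2, h0, h3, h4, h5⟩ := ih hlt.le
    obtain ⟨i, j, hij, -⟩ := hι.before k hlt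
    have e := eq_B_of_lt_firstA hlt
    simp only [segments, e, hij, nextSegment, Segment.join, Segment.rev, h1, h3, prevFst,
      IndexData.fst]
    simp only [lt_self_iff_false, if_false, if_true, zero_add, true_and]
    refine ⟨h0, h2, fun _ => ?_⟩
    rw [if_neg (by omega)]
    rcases Nat.eq_zero_or_pos k with rfl | hk0
    · simp [hij, IndexData.last]
    · rw [if_neg (by omega)]
      simpa using h5 hk0

theorem endIndices_of_eq {k : ℕ} (h : (k : ℕ∞) = firstA α) :
    endIndices α ι k = startIndices ι k := by
  cases k with
  | zero => rfl
  | succ k => rw [endIndices, if_pos h.le]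

/-- Meaning of `endIndices`: `c` is the index at both joining ends, `a` and `b` are those at the far
ends of `F^A` and `F^B`. Turning a segment around exchanges its two end indices, whence the
recursion. -/
theorem segments_after (hι : AdmissibleIndices d α ι) (k : ℕ) (hk : firstA α ≤ (k : ℕ∞)) :
    0 < (segments α ι (k + 1) .A).L ∧ 0 < (segments α ι (k + 1) .B).L ∧
      (segments α ι (k + 1) .A).hi 0 = (endIndices α ι k).c ∧
      (segments α ι (k + 1) .B).hi 0 = (endIndices α ι k).c ∧
      (segments α ι (k + 1) .A).lo (segments α ι (k + 1) .A).L = (endIndices α ι k).a ∧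
      (segments α ι (k + 1) .B).lo (segments α ι (k + 1) .B).L = (endIndices α ι k).b := by
  have start : ∀ k : ℕ, (k : ℕ∞) = firstA α → 0 < (segments α ι (k + 1) .A).L ∧
      0 < (segments α ι (k + 1) .B).L ∧
      (segments α ι (k + 1) .A).hi 0 = (endIndices α ι k).c ∧
      (segments α ι (k + 1) .B).hi 0 = (endIndices α ι k).c ∧
      (segments α ι (k + 1) .A).lo (segments α ι (k + 1) .A).L = (endIndices α ι k).a ∧
      (segments α ι (k + 1) .B).lo (segments α ι (k + 1) .B).L = (endIndices α ι k).b := by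
    intro k h
    have e := eq_A_of_eq_firstA h
    obtain ⟨h1, h2, -, h3, h4, h5⟩ := segments_before hι k h.le
    rw [endIndices_of_eq h]
    rcases hι.first k h with ⟨i, i', j, hij, -⟩ | ⟨hk0, i, j, hij, -⟩
    -- If `K = 0`, `F^B` is still a point and the index in question is that of the new edge itself;
    -- otherwise it is inherited from `F^B`.
    · have hlast : (if 0 < k then (segments α ι k .B).lo k else j) = (ι 0).last := by
        split_ifs with hk0
        · exact h5 hk0
        · rw [show k = 0 by omega] at hij
          rw [hij]
          rfl
      simp only [segments, e, hij, nextSegment, Segment.join, startIndices, h1, h3]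
      refine ⟨by omega, by omega, ?_, ?_, by simp, by simp⟩
      all_goals
        rw [← hlast]
        rcases Nat.eq_zero_or_pos k with hk0 | hk0
        · simp [hk0]
        · simp [hk0]
    · have hk1 : 0 < k := by omega
      simp only [segments, e, hij, nextSegment, Segment.join, Segment.rev, startIndices, h1, h3]
      refine ⟨by omega, hk1, ?_, ?_, by simp [IndexData.fst], ?_⟩
      · rw [if_pos hk1, Nat.sub_zero, h5 hk1]
      · rw [Nat.sub_zero, h5 hk1]
      · rw [Nat.sub_self, h4]
  induction k with
  | zero => exact start 0 (le_antisymm (by simp) hk)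
  | succ k ih =>
    rcases hk.lt_or_eq with hlt | heq
    · have hle : firstA α ≤ (k : ℕ∞) := by
        rw [Nat.cast_add, Nat.cast_one] at hlt
        exact Order.le_of_lt_add_one hlt
      obtain ⟨h1, h2, h3, h4, h5, h6⟩ := ih hle
      rw [segments, endIndices, if_neg (not_le.2 hlt)]
      rcases hι.after k hlt with ⟨i, hij, -⟩ | ⟨i, j, hij, -⟩
      all_goals
        rw [hij]
        cases e : α (k + 1)
      · exact ⟨Nat.add_pos_left h2 _, h2, (Segment.glue_hi_zero h2).trans h6, h6,
          (Segment.glue_lo_last h1).trans h5, Segment.rev_lo_last.trans h4⟩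
      · exact ⟨h1, Nat.add_pos_left h1 _, h5, (Segment.glue_hi_zero h1).trans h5,
          Segment.rev_lo_last.trans h3, (Segment.glue_lo_last h2).trans h6⟩
      · exact ⟨Nat.succ_pos _, h2, (Segment.join_hi_zero h2).trans h6, h6,
          (Segment.join_lo_last h1).trans h5, Segment.rev_lo_last.trans h4⟩
      · exact ⟨h1, Nat.succ_pos _, h5, (Segment.join_hi_zero h1).trans h5,
          Segment.rev_lo_last.trans h3, (Segment.join_lo_last h2).trans h6⟩
    · exact start (k + 1) heq.symm

/-- The admissibility bounds are what a step needs: `i < 𝔦^C` leaves both parts of a split edge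
positive, and the bounds `d - 𝔦^C` keep the loops from being overdrawn. -/
theorem segmentStep (hι : AdmissibleIndices d α ι) (k : ℕ) :
    SegmentStep d (segments α ι k) (segments α ι (k + 1)) (α k) (ι k).edges := by
  rcases lt_trichotomy (k : ℕ∞) (firstA α) with h | h | h
  · obtain ⟨i, j, hij, hi, hid, hj, hjd⟩ := hι.before k h
    have e := eq_B_of_lt_firstA h
    obtain ⟨h1, h2, -, h3, h4, h5⟩ := segments_before hι k h.le
    rw [e, hij]
    refine SegmentStep.join i j hi hj ?_ ?_ ?_ ?_
    · simp only [Letter.other]; omega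
    · omega
    · simp [segments, e, hij, nextSegment, Letter.other]
    · simp [segments, e, hij, nextSegment, Letter.other]
  · have e := eq_A_of_eq_firstA h
    obtain ⟨h1, h2, -, h3, h4, h5⟩ := segments_before hι k h.le
    rcases hι.first k h with ⟨i, i', j, hij, hi, hii, hid, hj, hjd⟩ | ⟨hk0, i, j, hij, hi, hid, hj, hjd⟩
    · rw [e, hij]
      refine SegmentStep.both j i i' hj hi (by omega) hii.ne ?_ (by omega) hid h1 ?_ ?_
      · simp only [Letter.other]; omega
      · simp [segments, e, hij, nextSegment, Letter.other]
      · simp [segments, e, hij, nextSegment, Letter.other]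
    · rw [e, hij]
      refine SegmentStep.join j i hj hi ?_ ?_ ?_ ?_
      · simp only [Letter.other]; omega
      · omega
      · simp [segments, e, hij, nextSegment, Letter.other]
      · simp [segments, e, hij, nextSegment, Letter.other]
  · obtain ⟨k, rfl⟩ : ∃ m, k = m + 1 := by
      cases k with
      | zero => simp at h
      | succ m => exact ⟨m, rfl⟩
    have hle : firstA α ≤ (k : ℕ∞) := by
      rw [Nat.cast_add, Nat.cast_one] at h
      exact Order.le_of_lt_add_one h
    obtain ⟨h1, h2, h3, h4, h5, h6⟩ := segments_after hι k hle
    rcases hι.after k h with ⟨i, hij, hi, hic⟩ | ⟨i, j, hij, hi, hid, hj, hjd⟩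
    · rw [hij]
      cases e : α (k + 1) with
      | A =>
        refine SegmentStep.glue i ((segments α ι (k + 1) .B).hi 0 - i) hi ?_ h1 h2 ?_ ?_ ?_ ?_
        · omega
        · simp only [Letter.other]; omega
        · omega
        · rw [segments, e, hij]; rfl
        · rw [segments, e, hij]; rfl
      | B =>
        refine SegmentStep.glue ((segments α ι (k + 1) .B).hi 0 - i) i ?_ hi h2 h1 ?_ ?_ ?_ ?_
        · omega
        · simp only [Letter.other]; omega
        · omega
        · rw [segments, e, hij]; rfl
        · rw [segments, e, hij]; rfl
    · rw [hij]
      cases e : α (k + 1) with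
      | A =>
        refine SegmentStep.join j i hj hi ?_ ?_ ?_ ?_
        · simp only [Letter.other]; omega
        · omega
        · rw [segments, e, hij]; rfl
        · rw [segments, e, hij]; rfl
      | B =>
        refine SegmentStep.join i j hi hj ?_ ?_ ?_ ?_
        · simp only [Letter.other]; omega
        · omega
        · rw [segments, e, hij]; rfl
        · rw [segments, e, hij]; rfl

end Admissible

end SturmianTree

/-! ### The graphs of the construction as segments -/

namespace SturmianTree

namespace Segment

/-- The index from the position `t` to the position `u`. -/
def idx (d : ℕ) (P : Segment) (t u : ℕ) : ℕ :=
  if u + 1 = t then P.lo t else if u = t + 1 then P.hi t else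
    if u = t then d - P.lo t - P.hi t else 0

variable {d : ℕ} {P Q : Segment} {t u e f m : ℕ}

theorem idx_sub_sub {c : ℕ} (ht : t ≤ c) (hu : u ≤ c) : P.idx d (c - t) (c - u) =
    if u + 1 = t then P.hi (c - t) else if u = t + 1 then P.lo (c - t) else
      if u = t then d - P.lo (c - t) - P.hi (c - t) else 0 := by
  simp only [idx, show c - u + 1 = c - t ↔ u = t + 1 by omega,
    show c - u = c - t + 1 ↔ u + 1 = t by omega, show c - u = c - t ↔ u = t by omega]
  split_ifs <;> first | rfl | omega

theorem idx_add_add {c : ℕ} : P.idx d (c + t) (c + u) =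
    if u + 1 = t then P.lo (c + t) else if u = t + 1 then P.hi (c + t) else
      if u = t then d - P.lo (c + t) - P.hi (c + t) else 0 := by
  simp only [idx, show c + u + 1 = c + t ↔ u + 1 = t by omega,
    show c + u = c + t + 1 ↔ u = t + 1 by omega, show c + u = c + t ↔ u = t by omega]

theorem idx_rev (ht : t ≤ P.L) (hu : u ≤ P.L) : P.rev.idx d (P.L - t) (P.L - u) = P.idx d t u := by
  rw [idx_sub_sub ht hu]
  simp only [idx, rev, Nat.sub_sub_self ht, Nat.sub_right_comm]

theorem join_lo_sub (ht : t ≤ P.L) : (P.join Q e f).lo (P.L - t) = P.hi t := by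
  simp [join, Nat.sub_sub_self ht]

theorem join_hi_sub (ht : t ≤ P.L) :
    (P.join Q e f).hi (P.L - t) = if t = 0 then e else P.lo t := by
  simp only [join, Nat.sub_sub_self ht, show P.L - t < P.L ↔ ¬ t = 0 by omega,
    show P.L - t = P.L ↔ t = 0 by omega]
  split_ifs <;> rfl

theorem join_lo_add : (P.join Q e f).lo (P.L + 1 + t) = if t = 0 then f else Q.lo t := by
  simp only [join, show ¬ P.L + 1 + t ≤ P.L by omega, show P.L + 1 + t - P.L - 1 = t by omega,
    if_false, show P.L + 1 + t = P.L + 1 ↔ t = 0 by omega]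

theorem join_hi_add : (P.join Q e f).hi (P.L + 1 + t) = Q.hi t := by
  simp only [join, show ¬ P.L + 1 + t < P.L by omega, show P.L + 1 + t - P.L - 1 = t by omega,
    if_false, show ¬ P.L + 1 + t = P.L by omega]

theorem glue_lo_sub (ht : t ≤ P.L) :
    (P.glue Q e f).lo (P.L - t) = if t = 0 then f else P.hi t := by
  simp only [glue, Nat.sub_sub_self ht, show P.L - t < P.L ↔ ¬ t = 0 by omega,
    show P.L - t = P.L ↔ t = 0 by omega]
  split_ifs <;> rfl

theorem glue_hi_sub (ht : t ≤ P.L) :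
    (P.glue Q e f).hi (P.L - t) = if t = 0 then e else P.lo t := by
  simp only [glue, Nat.sub_sub_self ht, show P.L - t < P.L ↔ ¬ t = 0 by omega,
    show P.L - t = P.L ↔ t = 0 by omega]
  split_ifs <;> rfl

theorem glue_lo_add : (P.glue Q e f).lo (P.L + t) = if t = 0 then f else Q.lo t := by
  simp only [glue, show ¬ P.L + t < P.L by omega, show P.L + t - P.L = t by omega,
    if_false, show P.L + t = P.L ↔ t = 0 by omega]

theorem glue_hi_add : (P.glue Q e f).hi (P.L + t) = if t = 0 then e else Q.hi t := by
  simp only [glue, show ¬ P.L + t < P.L by omega, show P.L + t - P.L = t by omega,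
    if_false, show P.L + t = P.L ↔ t = 0 by omega]

/-- The four formulas for `join` mirror the four cases of `concatTwo`, in old positions: `P.L - t`
on the reversed part and `P.L + 1 + t` on the other. -/
theorem idx_join_left_left (hP : P.lo 0 = 0) (ht : t ≤ P.L) (hu : u ≤ P.L) :
    (P.join Q e f).idx d (P.L - t) (P.L - u) =
      if t = 0 ∧ u = 0 then P.idx d 0 0 - e else P.idx d t u := by
  rw [idx_sub_sub ht hu, join_lo_sub ht, join_hi_sub ht]
  simp only [idx]
  rcases Nat.eq_zero_or_pos t with rfl | h
  · rw [hP]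
    grind
  · simp only [h.ne', if_false, false_and, Nat.sub_right_comm]

theorem idx_join_left_right (ht : t ≤ P.L) :
    (P.join Q e f).idx d (P.L - t) (P.L + 1 + u) = if t = 0 ∧ u = 0 then e else 0 := by
  rw [idx, join_hi_sub ht]
  grind

theorem idx_join_right_left (hu : u ≤ P.L) :
    (P.join Q e f).idx d (P.L + 1 + t) (P.L - u) = if t = 0 ∧ u = 0 then f else 0 := by
  rw [idx, join_lo_add]
  split_ifs <;> omega

theorem idx_join_right_right (hQ : Q.lo 0 = 0) :
    (P.join Q e f).idx d (P.L + 1 + t) (P.L + 1 + u) =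
      if t = 0 ∧ u = 0 then Q.idx d 0 0 - f else Q.idx d t u := by
  rw [idx_add_add, join_lo_add, join_hi_add]
  simp only [idx]
  rcases Nat.eq_zero_or_pos t with rfl | h
  · rw [hQ]
    grind
  · simp only [h.ne', if_false, false_and]

theorem idx_zero_ne_zero_iff (h : 0 < P.hi 0) : (u ≠ 0 ∧ P.idx d 0 u ≠ 0) ↔ u = 1 := by
  simp only [idx]
  grind

theorem idx_zero_sub (h : e + f = P.hi 0) (hu : 0 < u) :
    P.idx d 0 u - f = if u = 1 then e else 0 := by
  simp only [idx]
  grind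

theorem idx_zero_right : P.idx d t 0 = if t = 1 then P.lo 1 else if t = 0 then P.idx d 0 0 else 0 := by
  simp only [idx]
  grind

/-- In the unprimed formulas the identified vertex is counted with the reversed segment `P`, in the
primed ones with `Q`. Both are needed since `concatOne` always keeps it in its first graph, which
may be the one reversed or not. -/
theorem idx_glue_left_left (hP : P.lo 0 = 0) (hP0 : e + f = P.hi 0) (hf : 0 < f)
    (ht : t ≤ P.L) (hu : u ≤ P.L) :
    (P.glue Q e f).idx d (P.L - t) (P.L - u) =
      if t = 0 ∧ u ≠ 0 ∧ P.idx d 0 u ≠ 0 then f else P.idx d t u := by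
  rw [idx_sub_sub ht hu, glue_lo_sub ht, glue_hi_sub ht]
  simp only [idx_zero_ne_zero_iff (show 0 < P.hi 0 by omega)]
  simp only [idx]
  rcases Nat.eq_zero_or_pos t with rfl | h
  · rw [hP]
    grind
  · simp only [h.ne', if_false, false_and, Nat.sub_right_comm]

theorem idx_glue_left_right (hQ0 : e + f = Q.hi 0) (ht : t ≤ P.L) (hu : 0 < u) :
    (P.glue Q e f).idx d (P.L - t) (P.L + u) = if t = 0 then Q.idx d 0 u - f else 0 := by
  rw [idx, glue_hi_sub ht, idx_zero_sub hQ0 hu]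
  split_ifs <;> omega

theorem idx_glue_right_left (ht : 0 < t) (hu : u ≤ P.L) :
    (P.glue Q e f).idx d (P.L + t) (P.L - u) = if u = 0 then Q.idx d t 0 else 0 := by
  rw [idx, glue_lo_add, idx_zero_right]
  grind

theorem idx_glue_right_right (ht : 0 < t) :
    (P.glue Q e f).idx d (P.L + t) (P.L + u) = Q.idx d t u := by
  rw [idx_add_add, glue_lo_add, glue_hi_add]
  simp only [idx, ht.ne', if_false]

theorem idx_glue_right_right' (hQ : Q.lo 0 = 0) (hQ0 : e + f = Q.hi 0) (he : 0 < e) :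
    (P.glue Q e f).idx d (P.L + t) (P.L + u) =
      if t = 0 ∧ u ≠ 0 ∧ Q.idx d 0 u ≠ 0 then e else Q.idx d t u := by
  rw [idx_add_add, glue_lo_add, glue_hi_add]
  simp only [idx_zero_ne_zero_iff (show 0 < Q.hi 0 by omega)]
  simp only [idx]
  rcases Nat.eq_zero_or_pos t with rfl | h
  · rw [hQ]
    grind
  · simp only [h.ne', if_false, false_and]

theorem idx_glue_right_left' (hP0 : e + f = P.hi 0) (hu : u ≤ P.L) (hu0 : 0 < u) :
    (P.glue Q e f).idx d (P.L + t) (P.L - u) = if t = 0 then P.idx d 0 u - e else 0 := by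
  rw [idx, glue_lo_add, idx_zero_sub (add_comm e f ▸ hP0) hu0]
  split_ifs <;> omega

theorem idx_glue_left_right' (ht : 0 < t) (htL : t ≤ P.L) :
    (P.glue Q e f).idx d (P.L - t) (P.L + u) = if u = 0 then P.idx d t 0 else 0 := by
  rw [idx, glue_hi_sub htL, idx_zero_right]
  grind

theorem idx_glue_left_left' (ht : 0 < t) (htL : t ≤ P.L) (hu : u ≤ P.L) :
    (P.glue Q e f).idx d (P.L - t) (P.L - u) = P.idx d t u := by
  rw [idx_sub_sub htL hu, glue_lo_sub htL, glue_hi_sub htL]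
  simp only [idx, ht.ne', if_false, Nat.sub_right_comm]

theorem Valid.count_row (hP : P.Valid d) : (P.row d t).count u = P.idx d t u := by
  have h0 : t = 0 → P.lo t = 0 := by rintro rfl; exact hP.lo_zero
  simp only [row, idx, Multiset.count_add, Multiset.count_replicate]
  split_ifs <;> omega

end Segment

/-- The graph `G` with end vertices `j`, `f` is the segment `P`, by the positions `pos` of its
vertices. -/
structure Describes (d : ℕ) (G : ColoredGraph) (j f : G.V) (P : Segment) (pos : G.V → ℕ) :
    Prop where
  inj : Function.Injective pos
  le : ∀ v, pos v ≤ P.L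
  surj : ∀ t, t ≤ P.L → ∃ v, pos v = t
  pos_join : pos j = 0
  pos_far : pos f = P.L
  idx : ∀ v w, G.idx v w = P.idx d (pos v) (pos w)

namespace Describes

variable {d : ℕ} {G H : ColoredGraph} {j f : G.V} {j' f' : H.V} {P Q : Segment} {p : G.V → ℕ}
  {q : H.V → ℕ}

theorem eq_join_iff (D : Describes d G j f P p) (v : G.V) : v = j ↔ p v = 0 := by
  rw [← D.pos_join, D.inj.eq_iff]

theorem rev (D : Describes d G j f P p) : Describes d G f j P.rev (fun v => P.L - p v) where
  inj v w h := D.inj (by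
    have := D.le v
    have := D.le w
    simp only at h
    omega)
  le v := Nat.sub_le _ _
  surj t ht := by
    obtain ⟨v, hv⟩ := D.surj (P.L - t) (Nat.sub_le _ _)
    have : t ≤ P.L := ht
    exact ⟨v, by omega⟩
  pos_join := by simp [D.pos_far]
  pos_far := by simp [D.pos_join, Segment.rev]
  idx v w := by rw [Segment.idx_rev (D.le v) (D.le w), D.idx]

/-- Here the new joining end is the far end of the first graph, as when `F^B` grows; in `join_right`
it is that of the second, as when `F^A` grows. -/
theorem join_left (D : Describes d G j f P p) (E : Describes d H j' f' Q q) (hP : P.Valid d)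
    (hQ : Q.Valid d) (a b : ℕ) :
    Describes d (concatTwo G H j j' a b) (.inl f) (.inr f') (P.join Q a b)
      (Sum.elim (fun v => P.L - p v) (fun w => P.L + 1 + q w)) where
  inj := by
    rintro (v | v) (w | w) h <;> simp only [Sum.elim_inl, Sum.elim_inr] at h
    · rw [D.inj (show p v = p w by have := D.le v; have := D.le w; omega)]
    · omega
    · omega
    · rw [E.inj (show q v = q w by omega)]
  le := by
    rintro (v | v) <;> simp only [Sum.elim_inl, Sum.elim_inr, Segment.join]
    · omega
    · have := E.le v
      omega
  surj t ht := by
    have ht' : t ≤ P.L + Q.L + 1 := ht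
    rcases le_or_gt t P.L with h | h
    · obtain ⟨v, hv⟩ := D.surj (P.L - t) (Nat.sub_le _ _)
      exact ⟨.inl v, by simp only [Sum.elim_inl]; omega⟩
    · obtain ⟨v, hv⟩ := E.surj (t - P.L - 1) (by omega)
      exact ⟨.inr v, by simp only [Sum.elim_inr]; omega⟩
  pos_join := by simp [D.pos_far]
  pos_far := by simp only [Sum.elim_inr, E.pos_far, Segment.join]; omega
  idx := by
    rintro (v | v) (w | w) <;> simp only [Sum.elim_inl, Sum.elim_inr, concatTwo, D.eq_join_iff,
      E.eq_join_iff]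
    · rw [Segment.idx_join_left_left hP.lo_zero (D.le v) (D.le w), D.idx, D.idx, D.pos_join]
    · rw [Segment.idx_join_left_right (D.le v)]
    · rw [Segment.idx_join_right_left (D.le w)]
    · rw [Segment.idx_join_right_right hQ.lo_zero, E.idx, E.idx, E.pos_join]

theorem join_right (D : Describes d G j f P p) (E : Describes d H j' f' Q q) (hP : P.Valid d)
    (hQ : Q.Valid d) (a b : ℕ) :
    Describes d (concatTwo G H j j' a b) (.inr f') (.inl f) (Q.join P b a)
      (Sum.elim (fun v => Q.L + 1 + p v) (fun w => Q.L - q w)) where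
  inj := by
    rintro (v | v) (w | w) h <;> simp only [Sum.elim_inl, Sum.elim_inr] at h
    · rw [D.inj (show p v = p w by omega)]
    · omega
    · omega
    · rw [E.inj (show q v = q w by have := E.le v; have := E.le w; omega)]
  le := by
    rintro (v | v) <;> simp only [Sum.elim_inl, Sum.elim_inr, Segment.join]
    · have := D.le v
      omega
    · omega
  surj t ht := by
    have ht' : t ≤ Q.L + P.L + 1 := ht
    rcases le_or_gt t Q.L with h | h
    · obtain ⟨v, hv⟩ := E.surj (Q.L - t) (Nat.sub_le _ _)
      exact ⟨.inr v, by simp only [Sum.elim_inr]; omega⟩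
    · obtain ⟨v, hv⟩ := D.surj (t - Q.L - 1) (by omega)
      exact ⟨.inl v, by simp only [Sum.elim_inl]; omega⟩
  pos_join := by simp [E.pos_far]
  pos_far := by simp only [Sum.elim_inl, D.pos_far, Segment.join]; omega
  idx := by
    rintro (v | v) (w | w) <;> simp only [Sum.elim_inl, Sum.elim_inr, concatTwo, D.eq_join_iff,
      E.eq_join_iff]
    · rw [Segment.idx_join_right_right hP.lo_zero, D.idx, D.idx, D.pos_join]
    · rw [Segment.idx_join_right_left (E.le w)]
    · rw [Segment.idx_join_left_right (E.le v)]
    · rw [Segment.idx_join_left_left hQ.lo_zero (E.le v) (E.le w), E.idx, E.idx, E.pos_join]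

theorem glue_left (D : Describes d G j f P p) (E : Describes d H j' f' Q q) (hP : P.Valid d)
    {a b : ℕ} (ha : 0 < a) (hab : b + a = P.hi 0) (hab' : b + a = Q.hi 0) (hQL : 0 < Q.L)
    (h' : f' ≠ j') :
    Describes d (concatOne G H j j' a) (.inl f) (.inr ⟨f', h'⟩) (P.glue Q b a)
      (Sum.elim (fun v => P.L - p v) (fun w => P.L + q w.1)) where
  inj := by
    rintro (v | ⟨v, hv⟩) (w | ⟨w, hw⟩) h <;> simp only [Sum.elim_inl, Sum.elim_inr] at h
    · rw [D.inj (show p v = p w by have := D.le v; have := D.le w; omega)]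
    · exact (hw ((E.eq_join_iff w).2 (by omega))).elim
    · exact (hv ((E.eq_join_iff v).2 (by omega))).elim
    · obtain rfl := E.inj (show q v = q w by omega)
      rfl
  le := by
    rintro (v | ⟨v, hv⟩) <;> simp only [Sum.elim_inl, Sum.elim_inr, Segment.glue]
    · omega
    · have := E.le v
      omega
  surj t ht := by
    have ht' : t ≤ P.L + Q.L := ht
    rcases le_or_gt t P.L with h | h
    · obtain ⟨v, hv⟩ := D.surj (P.L - t) (Nat.sub_le _ _)
      exact ⟨.inl v, by simp only [Sum.elim_inl]; omega⟩
    · obtain ⟨v, hv⟩ := E.surj (t - P.L) (by omega)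
      refine ⟨.inr ⟨v, fun e => ?_⟩, by simp only [Sum.elim_inr]; omega⟩
      rw [E.eq_join_iff] at e
      omega
  pos_join := by simp [D.pos_far]
  pos_far := by simp [E.pos_far, Segment.glue]
  idx := by
    have hq : ∀ w, w ≠ j' → 0 < q w := fun w hw => by
      rw [Ne, E.eq_join_iff] at hw
      omega
    rintro (v | ⟨v, hv⟩) (w | ⟨w, hw⟩) <;> simp only [Sum.elim_inl, Sum.elim_inr, concatOne, Ne,
      D.eq_join_iff]
    · rw [Segment.idx_glue_left_left hP.lo_zero hab ha (D.le v) (D.le w), D.idx, D.idx, D.pos_join]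
    · rw [Segment.idx_glue_left_right hab' (D.le v) (hq w hw), E.idx, E.pos_join]
    · rw [Segment.idx_glue_right_left (hq v hv) (D.le w), E.idx, E.pos_join]
    · rw [Segment.idx_glue_right_right (hq v hv), E.idx]

theorem glue_right (D : Describes d G j f P p) (E : Describes d H j' f' Q q) (hP : P.Valid d)
    {a b : ℕ} (ha : 0 < a) (hab : a + b = P.hi 0) (hab' : a + b = Q.hi 0) (hQL : 0 < Q.L)
    (h' : f' ≠ j') :
    Describes d (concatOne G H j j' a) (.inr ⟨f', h'⟩) (.inl f) (Q.glue P a b)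
      (Sum.elim (fun v => Q.L + p v) (fun w => Q.L - q w.1)) where
  inj := by
    rintro (v | ⟨v, hv⟩) (w | ⟨w, hw⟩) h <;> simp only [Sum.elim_inl, Sum.elim_inr] at h
    · rw [D.inj (show p v = p w by omega)]
    · exact (hw ((E.eq_join_iff w).2 (by omega))).elim
    · exact (hv ((E.eq_join_iff v).2 (by omega))).elim
    · obtain rfl := E.inj (show q v = q w by have := E.le v; have := E.le w; omega)
      rfl
  le := by
    rintro (v | ⟨v, hv⟩) <;> simp only [Sum.elim_inl, Sum.elim_inr, Segment.glue]
    · have := D.le v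
      omega
    · omega
  surj t ht := by
    have ht' : t ≤ Q.L + P.L := ht
    rcases lt_or_ge t Q.L with h | h
    · obtain ⟨v, hv⟩ := E.surj (Q.L - t) (Nat.sub_le _ _)
      refine ⟨.inr ⟨v, fun e => ?_⟩, by simp only [Sum.elim_inr]; omega⟩
      rw [E.eq_join_iff] at e
      omega
    · obtain ⟨v, hv⟩ := D.surj (t - Q.L) (by omega)
      exact ⟨.inl v, by simp only [Sum.elim_inl]; omega⟩
  pos_join := by simp [E.pos_far]
  pos_far := by simp [D.pos_far, Segment.glue]
  idx := by
    have hq : ∀ w, w ≠ j' → 0 < q w := fun w hw => by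
      rw [Ne, E.eq_join_iff] at hw
      omega
    rintro (v | ⟨v, hv⟩) (w | ⟨w, hw⟩) <;> simp only [Sum.elim_inl, Sum.elim_inr, concatOne, Ne,
      D.eq_join_iff]
    · rw [Segment.idx_glue_right_right' hP.lo_zero hab ha, D.idx, D.idx, D.pos_join]
    · rw [Segment.idx_glue_right_left' hab' (E.le w) (hq w hw), E.idx, E.pos_join]
    · rw [Segment.idx_glue_left_right' (hq v hv) (E.le v), E.idx, E.pos_join]
    · rw [Segment.idx_glue_left_left' (hq v hv) (E.le v) (E.le w), E.idx]

end Describes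

/-- The end vertex at which the next concatenation takes place. -/
def Stage.join (S : Stage) : ∀ X, (S.F X).V
  | .A => S.joinA
  | .B => S.joinB

/-- The other end vertex. -/
def Stage.far (S : Stage) : ∀ X, (S.F X).V
  | .A => S.farA
  | .B => S.farB

/-- The positions of the vertices of the next stage. -/
def nextPos (S : Stage) (s : Letter → Segment) (p : ∀ X, (S.F X).V → ℕ) :
    ∀ (X : Letter) (e : IndexData) (Y : Letter), ((step S X e).next.F Y).V → ℕ
  | .A, .three _ _ _, .A =>
    Sum.elim (fun x : S.FA.V => (s .B).L + 1 + p .A x) (fun w : S.FB.V => (s .B).L - p .B w)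
  | .A, .three _ _ _, .B =>
    Sum.elim (fun x : S.FA.V => (s .B).L + 1 + p .A x) (fun w : S.FB.V => (s .B).L - p .B w)
  | .A, .two _ _, .A =>
    Sum.elim (fun x : S.FA.V => (s .B).L + 1 + p .A x) (fun w : S.FB.V => (s .B).L - p .B w)
  | .A, .two _ _, .B => fun w : S.FB.V => (s .B).L - p .B w
  | .A, .one _, .A =>
    Sum.elim (fun x : S.FA.V => (s .B).L + p .A x)
      (fun w : {w : S.FB.V // w ≠ S.joinB} => (s .B).L - p .B w.1)
  | .A, .one _, .B => fun w : S.FB.V => (s .B).L - p .B w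
  | .B, .three _ _ _, .B =>
    Sum.elim (fun x : S.FA.V => (s .A).L - p .A x) (fun w : S.FB.V => (s .A).L + 1 + p .B w)
  | .B, .two _ _, .B =>
    Sum.elim (fun x : S.FA.V => (s .A).L - p .A x) (fun w : S.FB.V => (s .A).L + 1 + p .B w)
  | .B, .one _, .B =>
    Sum.elim (fun x : S.FA.V => (s .A).L - p .A x)
      (fun w : {w : S.FB.V // w ≠ S.joinB} => (s .A).L + p .B w.1)
  | .B, _, .A => fun x : S.FA.V => (s .A).L - p .A x

/-- The position of the image of a vertex of `F^Y` in the next stage, for the letter `X`. -/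
noncomputable def moveAt (s : Letter → Segment) (X Y : Letter) (ε t : ℕ) : ℕ :=
  open Classical in if Y = X then (s X.other).L + ε + t else (s Y).L - t

theorem moveAt_self (s : Letter → Segment) (X : Letter) (ε t : ℕ) :
    moveAt s X X ε t = (s X.other).L + ε + t := if_pos rfl

theorem moveAt_other (s : Letter → Segment) (X : Letter) (ε t : ℕ) :
    moveAt s X X.other ε t = (s X.other).L - t := if_neg (by cases X <;> simp [Letter.other])

theorem concatRight_one (G H : ColoredGraph) (v : G.V) (v' w : H.V) (i : ℕ) (h : w ≠ v') :
    concatRight G H v v' (.one i) w = (Sum.inr ⟨w, h⟩ : G.V ⊕ {w : H.V // w ≠ v'}) := dif_neg h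

theorem elim_concatRight {α : Type*} (G H : ColoredGraph) (v : G.V) (v' w : H.V) (i : ℕ)
    (f : G.V → α) (g : H.V → α) (h : f v = g v') :
    Sum.elim f (fun x : {x : H.V // x ≠ v'} => g x.1) (concatRight G H v v' (.one i) w) = g w := by
  by_cases hw : w = v'
  · subst hw
    rw [show concatRight G H v w (.one i) w = (Sum.inl v : G.V ⊕ {x : H.V // x ≠ w}) from
      dif_pos rfl]
    exact h
  · rw [concatRight_one _ _ _ _ _ _ hw]
    rfl

section NextStage

variable (S : Stage) (s : Letter → Segment) (p : ∀ X, (S.F X).V → ℕ)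

/-- The hypothesis `h` excludes the irrelevant constant entries of `Step.map`. In the other cases
the new position depends only on `X`, `Y` and the old position, not on the target letter. -/
theorem pos_map (hp : ∀ X, p X (S.join X) = 0) (X : Letter) (e : IndexData) (Y Z : Letter)
    (h : Z = Y ∨ Z = X) (v : (S.F Y).V) :
    nextPos S s p X e Z ((step S X e).map Y Z v) = moveAt s X Y e.edges (p Y v) := by
  have hA : p .A S.joinA = 0 := hp .A
  have hB : p .B S.joinB = 0 := hp .B
  cases X <;> cases Y
  · rw [moveAt_self]
    cases Z
    · cases e <;> rfl
    · simp at h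
  · refine Eq.trans ?_ (moveAt_other s .A e.edges (p .B v)).symm
    cases Z
    · cases e with
      | two => rfl
      | three => rfl
      | one i =>
        exact elim_concatRight S.FA S.FB S.joinA S.joinB v i (fun x => (s .B).L + p .A x)
          (fun w => (s .B).L - p .B w) (by simp only [hA, hB, Nat.add_zero, Nat.sub_zero])
    · cases e <;> rfl
  · refine Eq.trans ?_ (moveAt_other s .B e.edges (p .A v)).symm
    cases Z
    · cases e <;> rfl
    · cases e <;> rfl
  · rw [moveAt_self]
    cases Z
    · simp at h
    · cases e with
      | two => rfl
      | three => rfl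
      | one i =>
        exact elim_concatRight S.FA S.FB S.joinA S.joinB v i (fun x => (s .A).L - p .A x)
          (fun w => (s .A).L + p .B w) (by simp only [hA, hB, Nat.add_zero, Nat.sub_zero])

theorem color_map (hc : S.FA.color S.joinA = S.FB.color S.joinB) (X : Letter) (e : IndexData)
    (Y Z : Letter) (h : Z = Y ∨ Z = X) (v : (S.F Y).V) :
    ((step S X e).next.F Z).color ((step S X e).map Y Z v) = (S.F Y).color v := by
  cases X <;> cases Y
  · cases Z
    · cases e <;> rfl
    · simp at h
  · cases Z
    · cases e with
      | two => rfl
      | three => rfl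
      | one i => exact elim_concatRight S.FA S.FB S.joinA S.joinB v i S.FA.color S.FB.color hc
    · cases e <;> rfl
  · cases Z
    · cases e <;> rfl
    · cases e <;> rfl
  · cases Z
    · simp at h
    · cases e with
      | two => rfl
      | three => rfl
      | one i => exact elim_concatRight S.FA S.FB S.joinA S.joinB v i S.FA.color S.FB.color hc

variable {S s p} {d : ℕ}

theorem describes_next (D : ∀ X, Describes d (S.F X) (S.join X) (S.far X) (s X) (p X))
    (hv : ∀ X, (s X).Valid d) (X : Letter) (e : IndexData)
    (he : ∀ i, e = .one i → 0 < i ∧ i < (s .B).hi 0 ∧ (s .A).hi 0 = (s .B).hi 0 ∧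
      0 < (s .A).L ∧ 0 < (s .B).L) (Y : Letter) :
    Describes d ((step S X e).next.F Y) ((step S X e).next.join Y) ((step S X e).next.far Y)
      (nextSegment s X e Y) (nextPos S s p X e Y) := by
  classical
  have DA : Describes d S.FA S.joinA S.farA (s .A) (p .A) := D .A
  have DB : Describes d S.FB S.joinB S.farB (s .B) (p .B) := D .B
  have hne : 0 < (s .B).L → S.farB ≠ S.joinB := by
    intro h e
    have := DB.pos_far
    rw [e, DB.pos_join] at this
    omega
  cases X
  · cases Y
    · cases e with
      | two i j => exact DA.join_right DB (hv _) (hv _) i j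
      | three i i' j => exact DA.join_right DB (hv _) (hv _) i j
      | one i =>
        obtain ⟨h1, h2, h3, h4, h5⟩ := he i rfl
        have := DA.glue_right DB (hv _) (b := (s .B).hi 0 - i) h1 (by omega) (by omega) h5 (hne h5)
        rw [← concatRight_one S.FA S.FB S.joinA S.joinB S.farB i (hne h5)] at this
        exact this
    · cases e with
      | two i j => exact DB.rev
      | three i i' j => exact DA.join_right DB (hv _) (hv _) i' j
      | one i => exact DB.rev
  · cases Y
    · cases e <;> exact DA.rev
    · cases e with
      | two i j => exact DA.join_left DB (hv _) (hv _) i j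
      | three i i' j => exact DA.join_left DB (hv _) (hv _) i j
      | one i =>
        obtain ⟨h1, h2, h3, h4, h5⟩ := he i rfl
        have := DA.glue_left DB (hv _) (b := (s .B).hi 0 - i) h1 (by omega) (by omega) h5 (hne h5)
        rw [← concatRight_one S.FA S.FB S.joinA S.joinB S.farB i (hne h5)] at this
        exact this

theorem foldAt_sub {c t : ℕ} (ε : ℕ) (h : t ≤ c) : foldAt c ε (c - t) = t := by
  simp only [foldAt]
  split_ifs <;> omega

theorem foldAt_add_one (c t : ℕ) : foldAt c 1 (c + 1 + t) = t := by
  simp only [foldAt]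
  split_ifs <;> omega

theorem foldAt_add_zero (c t : ℕ) : foldAt c 0 (c + t) = t := by
  simp only [foldAt]
  split_ifs <;> omega

theorem color_next {χ : ℕ → Color} (hp : ∀ X v, p X v ≤ (s X).L)
    (hχ : ∀ X v, (S.F X).color v = χ (p X v)) (X : Letter) (e : IndexData) (Y : Letter)
    (v : ((step S X e).next.F Y).V) :
    ((step S X e).next.F Y).color v =
      χ (foldAt (s X.other).L e.edges (nextPos S s p X e Y v)) := by
  have A1 : ∀ x : S.FA.V, S.FA.color x = χ (foldAt (s .B).L 1 ((s .B).L + 1 + p .A x)) := by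
    intro x
    rw [foldAt_add_one]
    exact hχ .A x
  have A0 : ∀ x : S.FA.V, S.FA.color x = χ (foldAt (s .B).L 0 ((s .B).L + p .A x)) := by
    intro x
    rw [foldAt_add_zero]
    exact hχ .A x
  have AL : ∀ (ε : ℕ) (x : S.FA.V), S.FA.color x = χ (foldAt (s .A).L ε ((s .A).L - p .A x)) := by
    intro ε x
    exact (hχ .A x).trans (congrArg χ (foldAt_sub ε (hp .A x)).symm)
  have B1 : ∀ x : S.FB.V, S.FB.color x = χ (foldAt (s .A).L 1 ((s .A).L + 1 + p .B x)) := by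
    intro x
    rw [foldAt_add_one]
    exact hχ .B x
  have B0 : ∀ x : S.FB.V, S.FB.color x = χ (foldAt (s .A).L 0 ((s .A).L + p .B x)) := by
    intro x
    rw [foldAt_add_zero]
    exact hχ .B x
  have BL : ∀ (ε : ℕ) (x : S.FB.V), S.FB.color x = χ (foldAt (s .B).L ε ((s .B).L - p .B x)) := by
    intro ε x
    exact (hχ .B x).trans (congrArg χ (foldAt_sub ε (hp .B x)).symm)
  cases X <;> cases Y <;> cases e
  · rcases v with v | v
    exacts [A0 v, BL 0 v.1]
  · rcases v with v | v
    exacts [A1 v, BL 1 v]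
  · rcases v with v | v
    exacts [A1 v, BL 1 v]
  · exact BL 0 v
  · exact BL 1 v
  · rcases v with v | v
    exacts [A1 v, BL 1 v]
  · exact AL 0 v
  · exact AL 1 v
  · exact AL 1 v
  · rcases v with v | v
    exacts [AL 0 v, B0 v.1]
  · rcases v with v | v
    exacts [AL 1 v, B1 v]
  · rcases v with v | v
    exacts [AL 1 v, B1 v]

end NextStage

/-- The positions of the vertices of the graphs of all stages. -/
noncomputable def positions (d : ℕ) (α : ℕ → Letter) (ι : ℕ → IndexData) :
    ∀ k X, ((stage d α ι k).F X).V → ℕ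
  | 0 => fun _ _ => 0
  | k + 1 => nextPos (stage d α ι k) (segments α ι k) (positions d α ι k) (α k) (ι k)

section Admissible

variable {d : ℕ} {α : ℕ → Letter} {ι : ℕ → IndexData}

theorem valid_zero (X : Letter) : (segments α ι 0 X).Valid d :=
  ⟨rfl, rfl, fun _ h h' => absurd (lt_of_lt_of_le h h') (lt_irrefl 0),
    fun _ h => absurd h (Nat.not_lt_zero _),
    fun _ _ => Nat.zero_le d⟩

theorem valid_segments (hι : AdmissibleIndices d α ι) (k : ℕ) : ∀ X, (segments α ι k X).Valid d := by
  induction k with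
  | zero => exact valid_zero
  | succ k ih => exact (segmentStep hι k).valid ih

theorem segments_one (hι : AdmissibleIndices d α ι) (k i : ℕ) (hi : ι k = .one i) :
    0 < i ∧ i < (segments α ι k .B).hi 0 ∧
      (segments α ι k .A).hi 0 = (segments α ι k .B).hi 0 ∧
      0 < (segments α ι k .A).L ∧ 0 < (segments α ι k .B).L := by
  rcases lt_trichotomy (k : ℕ∞) (firstA α) with h | h | h
  · obtain ⟨i, j, hij, -⟩ := hι.before k h
    simp [hij] at hi
  · rcases hι.first k h with ⟨i, i', j, hij, -⟩ | ⟨hk0, i, j, hij, -⟩ <;> simp [hij] at hi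
  · obtain ⟨k, rfl⟩ : ∃ m, k = m + 1 := by
      cases k with
      | zero => simp at h
      | succ m => exact ⟨m, rfl⟩
    have hle : firstA α ≤ (k : ℕ∞) := by
      rw [Nat.cast_add, Nat.cast_one] at h
      exact Order.le_of_lt_add_one h
    obtain ⟨h1, h2, h3, h4, -⟩ := segments_after hι k hle
    rcases hι.after k h with ⟨i', hij, hi', hic⟩ | ⟨i, j, hij, -⟩
    · rw [hij] at hi
      cases hi
      omega
    · simp [hij] at hi

theorem describes (hι : AdmissibleIndices d α ι) (k : ℕ) : ∀ X,
    Describes d ((stage d α ι k).F X) ((stage d α ι k).join X) ((stage d α ι k).far X)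
      (segments α ι k X) (positions d α ι k X) := by
  induction k with
  | zero =>
    have key : ∀ c, Describes d (onePoint d c) () () (segments α ι 0 .A) (fun _ => 0) := fun c =>
      { inj := fun _ _ _ => rfl
        le := fun _ => le_rfl
        surj := fun _ ht => ⟨(), (Nat.le_zero.1 ht).symm⟩
        pos_join := rfl
        pos_far := rfl
        idx := fun _ _ => rfl }
    intro X
    cases X
    · exact key .a
    · exact key .b
  | succ k ih => exact describes_next ih (valid_segments hι k) _ _ (segments_one hι k)

/-- The color at a position of `F^X_0`, if the letter `X` belongs to `k = 0`. -/
def initialColor : Letter → ℕ → Color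
  | .A, t => if t = 0 then .b else .a
  | .B, t => if t = 0 then .a else .b

/-- The color at a position of `F^X_k`. -/
def colorAt (α : ℕ → Letter) (ι : ℕ → IndexData) : ℕ → ℕ → Color
  | 0 => initialColor (α 0)
  | k + 1 => fun t =>
    colorAt α ι k (foldAt (segments α ι (k + 1) (α (k + 1)).other).L (ι (k + 1)).edges t)

/-- Colors are inherited, so they can be read off after folding down to level 0. The formula is the
same for both letters, so vertices that are to be identified have the same color. -/
theorem color_eq_colorAt (hι : AdmissibleIndices d α ι) (k : ℕ) (X : Letter)
    (v : (graphF d α ι X k).V) :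
    (graphF d α ι X k).color v = colorAt α ι k (positions d α ι (k + 1) X v) := by
  induction k generalizing X with
  | zero =>
    have key : ∀ (S : Stage) (s : Letter → Segment) (hs : ∀ X, (s X).L = 0)
        (p : ∀ X, (S.F X).V → ℕ) (hp : ∀ X v, p X v = 0)
        (hA : ∀ v, S.FA.color v = .a) (hB : ∀ v, S.FB.color v = .b) (Z : Letter) (e : IndexData)
        (he : (Z = .A ∧ ∃ i i' j, e = .three i i' j) ∨ (Z = .B ∧ ∃ i j, e = .two i j)) (X : Letter)
        (v : ((step S Z e).next.F X).V), ((step S Z e).next.F X).color v =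
          initialColor Z (nextPos S s p Z e X v) := by
      rintro S s hs p hp hA hB Z e (⟨rfl, i, i', j, rfl⟩ | ⟨rfl, i, j, rfl⟩) X v
      · have h1 : ∀ x : S.FA.V, S.FA.color x =
            initialColor .A ((s .B).L + 1 + p .A x) := by
          intro x
          exact (hA x).trans (if_neg (Nat.succ_add _ _ ▸ Nat.succ_ne_zero _)).symm
        have h2 : ∀ x : S.FB.V, S.FB.color x =
            initialColor .A ((s .B).L - p .B x) := by
          intro x
          exact (hB x).trans (if_pos (by rw [hs, Nat.zero_sub])).symm
        cases X
        · rcases v with v | v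
          exacts [h1 v, h2 v]
        · rcases v with v | v
          exacts [h1 v, h2 v]
      · have h1 : ∀ x : S.FB.V, S.FB.color x =
            initialColor .B ((s .A).L + 1 + p .B x) := by
          intro x
          exact (hB x).trans (if_neg (Nat.succ_add _ _ ▸ Nat.succ_ne_zero _)).symm
        have h2 : ∀ x : S.FA.V, S.FA.color x =
            initialColor .B ((s .A).L - p .A x) := by
          intro x
          exact (hA x).trans (if_pos (by rw [hs, Nat.zero_sub])).symm
        cases X
        · exact h2 v
        · rcases v with v | v
          exacts [h2 v, h1 v]
    have he : (α 0 = .A ∧ ∃ i i' j, ι 0 = .three i i' j) ∨ (α 0 = .B ∧ ∃ i j, ι 0 = .two i j) := by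
      rcases lt_trichotomy ((0 : ℕ) : ℕ∞) (firstA α) with h | h | h
      · obtain ⟨i, j, hij, -⟩ := hι.before 0 h
        exact Or.inr ⟨eq_B_of_lt_firstA h, i, j, hij⟩
      · rcases hι.first 0 h with ⟨i, i', j, hij, -⟩ | ⟨h0, -⟩
        · exact Or.inl ⟨eq_A_of_eq_firstA h, i, i', j, hij⟩
        · exact (h0 rfl).elim
      · simp at h
    exact key (stage d α ι 0) (segments α ι 0) (fun _ => rfl) (positions d α ι 0) (fun _ _ => rfl)
      (fun _ => rfl) (fun _ => rfl) (α 0) (ι 0) he X v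
  | succ k ih =>
    exact color_next (fun X v => (describes hι (k + 1) X).le v) ih _ _ X v

end Admissible

end SturmianTree

namespace SturmianTree

/-! ### One step along the sequence `β` -/

namespace Segment

variable {d : ℕ} {P Q : Segment} {e f t : ℕ}

theorem row_rev_sub (hP : P.Valid d) (ht : t ≤ P.L) :
    (P.row d t).map (fun u => P.L - u) = P.rev.row d (P.L - t) := by
  refine map_row_flip (by simp [rev, Nat.sub_sub_self ht]) (by simp [rev, Nat.sub_sub_self ht]) rfl
    (fun h => ?_) (fun _ => by omega)
  have : 0 < t := by
    by_contra h0
    rw [show t = 0 by omega, hP.lo_zero] at h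
    omega
  omega

/-- The new edge is attached at position 0 and alters no other row. -/
theorem row_join_sub (ht : t ≤ P.L) (h0 : 0 < t) :
    (P.row d t).map (fun u => P.L - u) = (P.join Q e f).row d (P.L - t) := by
  refine map_row_flip ?_ ?_ rfl (fun h => by omega) (fun _ => by omega)
  · rw [join_hi_sub ht, if_neg h0.ne']
  · rw [join_lo_sub ht]

theorem row_join_add (h0 : 0 < t) :
    (Q.row d t).map (fun u => P.L + 1 + u) = (P.join Q e f).row d (P.L + 1 + t) := by
  refine map_row_shift ?_ ?_ rfl (fun h => by omega) (fun _ => by omega)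
  · rw [join_lo_add, if_neg h0.ne']
  · rw [join_hi_add]

theorem row_glue_sub (ht : t ≤ P.L) (h0 : 0 < t) :
    (P.row d t).map (fun u => P.L - u) = (P.glue Q e f).row d (P.L - t) := by
  refine map_row_flip ?_ ?_ rfl (fun h => by omega) (fun _ => by omega)
  · rw [glue_hi_sub ht, if_neg h0.ne']
  · rw [glue_lo_sub ht, if_neg h0.ne']

theorem row_glue_add (h0 : 0 < t) :
    (Q.row d t).map (fun u => P.L + 0 + u) = (P.glue Q e f).row d (P.L + 0 + t) := by
  refine map_row_shift ?_ ?_ rfl (fun h => by omega) (fun _ => by omega)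
  · rw [Nat.add_zero, glue_lo_add, if_neg h0.ne']
  · rw [Nat.add_zero, glue_hi_add, if_neg h0.ne']

theorem Valid.card_row (hP : P.Valid d) (ht : t ≤ P.L) : (P.row d t).card = d := by
  have := hP.le t ht
  simp only [row, Multiset.card_add, Multiset.card_replicate]
  omega

theorem Valid.le_of_mem_row (hP : P.Valid d) (ht : t ≤ P.L) {u : ℕ} (hu : u ∈ P.row d t) :
    u ≤ P.L := by
  simp only [row, Multiset.mem_add, Multiset.mem_replicate] at hu
  have h1 := hP.hi_last
  rcases ht.lt_or_eq with h | rfl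
  · omega
  · omega

theorem Valid.idx_symm (hP : P.Valid d) {t u : ℕ} (ht : t ≤ P.L) (hu : u ≤ P.L)
    (h : P.idx d t u ≠ 0) : P.idx d u t ≠ 0 := by
  by_cases e : t = u
  · rw [e] at h ⊢
    exact h
  · by_cases h1 : u + 1 = t
    · have := hP.hi_pos u (by omega)
      simp only [idx]
      rw [if_neg (by omega), if_pos h1.symm]
      omega
    · by_cases h2 : u = t + 1
      · have := hP.lo_pos u (by omega) hu
        simp only [idx]
        rw [if_pos h2.symm]
        omega
      · simp only [idx] at h
        rw [if_neg h1, if_neg h2, if_neg (Ne.symm e)] at h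
        exact (h rfl).elim

theorem Valid.idx_ne_zero (hP : P.Valid d) {t u : ℕ} (ht : t ≤ P.L) (hu : u ≤ P.L)
    (h : u + 1 = t ∨ u = t + 1) : P.idx d t u ≠ 0 := by
  simp only [idx]
  rcases h with h | h
  · rw [if_pos h]
    exact (hP.lo_pos t (by omega) ht).ne'
  · rw [if_neg (by omega), if_pos h]
    exact (hP.hi_pos t (by omega)).ne'

end Segment

theorem foldAt_moveAt {s : Letter → Segment} {X Y : Letter} {ε t : ℕ} (hε : ε = 0 ∨ ε = 1)
    (ht : t ≤ (s Y).L) : foldAt (s X.other).L ε (moveAt s X Y ε t) = t := by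
  rcases Y.eq_or_eq_other X with rfl | rfl
  · rw [moveAt_self]
    rcases hε with rfl | rfl
    · exact foldAt_add_zero _ _
    · exact foldAt_add_one _ _
  · rw [moveAt_other]
    exact foldAt_sub ε ht

namespace SegmentStep

variable {d : ℕ} {s s' : Letter → Segment} {X Y Z : Letter} {ε : ℕ}

theorem length_le (H : SegmentStep d s s' X ε) (hYZ : Z = Y ∨ Z = X) : (s Y).L ≤ (s' Z).L := by
  have h1 := H.length
  have h2 := H.length_other
  rcases Y.eq_or_eq_other X with rfl | rfl
  · rw [show Z = Y by simpa using hYZ]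
    omega
  · rcases hYZ with rfl | rfl <;> omega

theorem move_interior (H : SegmentStep d s s' X ε) (hYZ : Z = Y ∨ Z = X) {t : ℕ}
    (ht : t < (s Y).L) (h0 : 0 < t ∨ (s Y).L < (s' Z).L) :
    0 < moveAt s X Y ε t ∧ moveAt s X Y ε t < (s' Z).L := by
  have h1 := H.length
  have h2 := H.length_other
  have h3 := H.eps_le
  rcases Y.eq_or_eq_other X with rfl | rfl
  · rw [moveAt_self, show Z = Y by simpa using hYZ]
    omega
  · rw [moveAt_other]
    rcases hYZ with rfl | rfl <;> omega

/-- Only the joining end 0 can get new neighbours, and only when the segment becomes longer; if the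
length is unchanged the step is a mere reversal. -/
theorem row_move (H : SegmentStep d s s' X ε) (hv : ∀ W, (s W).Valid d) (hYZ : Z = Y ∨ Z = X)
    {t : ℕ} (ht : t ≤ (s Y).L) (h0 : 0 < t ∨ (s Y).L = (s' Z).L) :
    ((s Y).row d t).map (moveAt s X Y ε) = (s' Z).row d (moveAt s X Y ε t) := by
  have h1 := H.length
  have h3 := H.eps_le
  rcases Y.eq_or_eq_other X with rfl | rfl
  · obtain rfl : Z = Y := by simpa using hYZ
    have h0' : 0 < t := by omega
    rw [show moveAt s Z Z ε = fun u => (s Z.other).L + ε + u from funext (moveAt_self s Z ε)]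
    cases H with
    | join e f he hf hed hfd h h' => rw [h]; exact Segment.row_join_add h0'
    | glue e f he hf hL hL' hP hQ h h' => rw [h]; exact Segment.row_glue_add h0'
    | both e f f' he hf hf' hff hed hfd hfd' hL h h' => rw [h]; exact Segment.row_join_add h0'
  · rw [show moveAt s X X.other ε = fun u => (s X.other).L - u from funext (moveAt_other s X ε)]
    rcases hYZ with rfl | rfl
    · cases H with
      | join e f he hf hed hfd h h' => rw [h']; exact Segment.row_rev_sub (hv _) ht
      | glue e f he hf hL hL' hP hQ h h' => rw [h']; exact Segment.row_rev_sub (hv _) ht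
      | both e f f' he hf hf' hff hed hfd hfd' hL h h' =>
        have h4 : (s' X.other).L = (s X.other).L + (s X).L + 1 := by rw [h']; rfl
        rw [h']
        exact Segment.row_join_sub ht (by omega)
    · have h0' : 0 < t := by omega
      cases H with
      | join e f he hf hed hfd h h' => rw [h]; exact Segment.row_join_sub ht h0'
      | glue e f he hf hL hL' hP hQ h h' => rw [h]; exact Segment.row_glue_sub ht h0'
      | both e f f' he hf hf' hff hed hfd hfd' hL h h' =>
        rw [h]; exact Segment.row_join_sub ht h0'

end SegmentStep

theorem Describes.exists_row {d : ℕ} {G : ColoredGraph} {j f : G.V} {P : Segment} {p : G.V → ℕ}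
    (D : Describes d G j f P p) (hP : P.Valid d) (v : G.V) :
    ∃ M : Multiset G.V, M.map p = P.row d (p v) := by
  have : ∀ t, ∃ w, t ≤ P.L → p w = t := by
    intro t
    by_cases h : t ≤ P.L
    · obtain ⟨w, hw⟩ := D.surj t h
      exact ⟨w, fun _ => hw⟩
    · exact ⟨v, fun h' => (h h').elim⟩
  choose w hw using this
  refine ⟨(P.row d (p v)).map w, ?_⟩
  rw [Multiset.map_map]
  conv_rhs => rw [← Multiset.map_id (P.row d (p v))]
  exact Multiset.map_congr rfl fun t ht => hw t (hP.le_of_mem_row (D.le v) ht)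

/-! ### Positions and integer coordinates in the direct limit -/

section Limit

variable {d : ℕ} {α : ℕ → Letter} {ι : ℕ → IndexData} {β : ℕ → Letter}

/-- The position of a vertex of `F^{β_k}_k`. -/
noncomputable def pos (d : ℕ) (α : ℕ → Letter) (ι : ℕ → IndexData) (β : ℕ → Letter) (k : ℕ)
    (x : (graphF d α ι (β k) k).V) : ℕ :=
  positions d α ι (k + 1) (β k) x

/-- The segments `F^X_k`. -/
def seg (α : ℕ → Letter) (ι : ℕ → IndexData) (k : ℕ) : Letter → Segment := segments α ι (k + 1)

/-- The position after one step. -/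
noncomputable def move (α : ℕ → Letter) (ι : ℕ → IndexData) (β : ℕ → Letter) (k : ℕ) : ℕ → ℕ :=
  moveAt (seg α ι k) (α (k + 1)) (β k) (ι (k + 1)).edges

/-- The map `F^{β_k}_k → F^{β_{k+1}}_{k+1}`. -/
noncomputable def next (d : ℕ) (α : ℕ → Letter) (ι : ℕ → IndexData) (β : ℕ → Letter) (k : ℕ)
    (x : (graphF d α ι (β k) k).V) : (graphF d α ι (β (k + 1)) (k + 1)).V :=
  incl d α ι k (β k) (β (k + 1)) x

theorem step_seg (hι : AdmissibleIndices d α ι) (k : ℕ) :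
    SegmentStep d (seg α ι k) (seg α ι (k + 1)) (α (k + 1)) (ι (k + 1)).edges :=
  segmentStep hι (k + 1)

theorem valid_seg (hι : AdmissibleIndices d α ι) (k : ℕ) (X : Letter) : (seg α ι k X).Valid d :=
  valid_segments hι (k + 1) X

theorem describes_pos (hι : AdmissibleIndices d α ι) (k : ℕ) :
    Describes d (graphF d α ι (β k) k) ((stage d α ι (k + 1)).join (β k))
      ((stage d α ι (k + 1)).far (β k)) (seg α ι k (β k)) (pos d α ι β k) :=
  describes hι (k + 1) (β k)

theorem AdmissibleLetters.or (hβ : AdmissibleLetters α β) (k : ℕ) :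
    β (k + 1) = β k ∨ β (k + 1) = α (k + 1) :=
  (hβ k).symm

theorem pos_next (hι : AdmissibleIndices d α ι) (hβ : AdmissibleLetters α β) (k : ℕ)
    (x : (graphF d α ι (β k) k).V) :
    pos d α ι β (k + 1) (next d α ι β k x) = move α ι β k (pos d α ι β k x) :=
  pos_map _ _ _ (fun X => (describes hι (k + 1) X).pos_join) _ _ _ _ (hβ.or k) x

theorem color_map_next (hι : AdmissibleIndices d α ι) (hβ : AdmissibleLetters α β) (k : ℕ)
    (x : (graphF d α ι (β k) k).V) :
    (graphF d α ι (β (k + 1)) (k + 1)).color (next d α ι β k x) =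
      (graphF d α ι (β k) k).color x := by
  refine color_map _ ?_ _ _ _ _ (hβ.or k) x
  have hA := color_eq_colorAt hι k .A (stage d α ι (k + 1)).joinA
  have hB := color_eq_colorAt hι k .B (stage d α ι (k + 1)).joinB
  have hA' := (describes hι (k + 1) .A).pos_join
  have hB' := (describes hι (k + 1) .B).pos_join
  exact hA.trans ((congrArg _ (hA'.trans hB'.symm)).trans hB.symm)

/-- The integer coordinate `(coordinate k).1 + (coordinate k).2 * t` of the position `t` of
`F^{β_k}_k`. -/
noncomputable def coordinate (α : ℕ → Letter) (ι : ℕ → IndexData) (β : ℕ → Letter) : ℕ → ℤ × ℤ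
  | 0 => (0, 1)
  | k + 1 =>
    open Classical in
    if β k = α (k + 1) then
      ((coordinate α ι β k).1 - (coordinate α ι β k).2 *
        ((seg α ι k (α (k + 1)).other).L + (ι (k + 1)).edges), (coordinate α ι β k).2)
    else
      ((coordinate α ι β k).1 + (coordinate α ι β k).2 * (seg α ι k (β k)).L,
        -(coordinate α ι β k).2)

theorem coordinate_sq (k : ℕ) : (coordinate α ι β k).2 = 1 ∨ (coordinate α ι β k).2 = -1 := by
  induction k with
  | zero => exact Or.inl rfl
  | succ k ih =>
    rw [coordinate]
    split_ifs
    · exact ih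
    · rcases ih with h | h <;> simp [h]

/-- A step shifts or reverses positions; the offset and the sign compensate this, so the coordinate
is constant along the natural maps and descends to the limit. -/
theorem coordinate_move (k t : ℕ) (ht : t ≤ (seg α ι k (β k)).L) :
    (coordinate α ι β (k + 1)).1 + (coordinate α ι β (k + 1)).2 * (move α ι β k t : ℕ) =
      (coordinate α ι β k).1 + (coordinate α ι β k).2 * t := by
  rw [coordinate, move, moveAt]
  split_ifs with h
  · push_cast
    ring
  · push_cast [Nat.cast_sub ht]
    ring

variable (d α ι β) in
/-- The integer coordinate of a vertex of the direct limit. -/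
noncomputable def limitCoordinate (hι : AdmissibleIndices d α ι) (hβ : AdmissibleLetters α β) :
    (limitGraph d α ι β).V → ℤ :=
  Quot.lift (fun v => (coordinate α ι β v.1).1 +
    (coordinate α ι β v.1).2 * (pos d α ι β v.1 v.2 : ℕ)) (by
    rintro _ _ ⟨k, x⟩
    have h := coordinate_move (α := α) (ι := ι) (β := β) k (pos d α ι β k x)
      ((describes_pos hι k).le x)
    rw [← pos_next hι hβ] at h
    exact h.symm)

theorem limitCoordinate_toLimit (hι : AdmissibleIndices d α ι) (hβ : AdmissibleLetters α β) (k : ℕ)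
    (x : (graphF d α ι (β k) k).V) : limitCoordinate d α ι β hι hβ (toLimit d α ι β k x) =
      (coordinate α ι β k).1 + (coordinate α ι β k).2 * (pos d α ι β k x : ℕ) := rfl

/-- The limit is a quotient by a generated equivalence. The coordinate is an invariant of it that
still separates the vertices of one level. -/
theorem toLimit_injective (hι : AdmissibleIndices d α ι) (hβ : AdmissibleLetters α β) (k : ℕ) :
    Function.Injective (toLimit d α ι β k) := by
  intro x y h
  have h' := congrArg (limitCoordinate d α ι β hι hβ) h
  rw [limitCoordinate_toLimit, limitCoordinate_toLimit] at h'
  refine (describes_pos hι k).inj ?_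
  rcases coordinate_sq (α := α) (ι := ι) (β := β) k with e | e <;> rw [e] at h' <;> omega

theorem toLimit_next (k : ℕ) (x : (graphF d α ι (β k) k).V) :
    toLimit d α ι β (k + 1) (next d α ι β k x) = toLimit d α ι β k x :=
  (Quot.sound (LimitRel.step k x)).symm

theorem exists_rep_of_le {y : (limitGraph d α ι β).V} {k j : ℕ} (hkj : k ≤ j)
    (h : ∃ x, toLimit d α ι β k x = y) : ∃ x, toLimit d α ι β j x = y := by
  induction j, hkj using Nat.le_induction with
  | base => exact h
  | succ j _ ih =>
    obtain ⟨x, hx⟩ := ih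
    exact ⟨next d α ι β j x, (toLimit_next j x).trans hx⟩

theorem exists_rep (y : (limitGraph d α ι β).V) : ∃ k, ∃ x, toLimit d α ι β k x = y := by
  obtain ⟨⟨k, x⟩, h⟩ := Quot.exists_rep y
  exact ⟨k, x, h⟩

theorem toLimit_inclIter (k m : ℕ) (x : (graphF d α ι (β k) k).V) :
    toLimit d α ι β (k + m) (inclIter d α ι β k m x) = toLimit d α ι β k x := by
  induction m with
  | zero => rfl
  | succ m ih => exact (toLimit_next (k + m) _).trans ih

theorem limit_color (hι : AdmissibleIndices d α ι) (hβ : AdmissibleLetters α β) (k : ℕ)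
    (x : (graphF d α ι (β k) k).V) :
    (limitGraph d α ι β).color (toLimit d α ι β k x) = (graphF d α ι (β k) k).color x := by
  classical
  let c : (limitGraph d α ι β).V → Color :=
    Quot.lift (fun v => (graphF d α ι (β v.1) v.1).color v.2) (by
      rintro _ _ ⟨k, x⟩
      exact (color_map_next hι hβ k x).symm)
  have hc : ∀ k (x : (graphF d α ι (β k) k).V),
      c (toLimit d α ι β k x) = (graphF d α ι (β k) k).color x := fun _ _ => rfl
  show (if ∃ (l : ℕ) (z : (graphF d α ι (β l) l).V),
          toLimit d α ι β l z = toLimit d α ι β k x ∧ (graphF d α ι (β l) l).color z = Color.a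
      then Color.a else Color.b) = _
  split_ifs with h
  · obtain ⟨l, z, hz, hza⟩ := h
    rw [← hc k x, ← hz, hc, hza]
  · cases e : (graphF d α ι (β k) k).color x with
    | a => exact (h ⟨k, x, rfl, e⟩).elim
    | b => rfl

section Rows

variable (hι : AdmissibleIndices d α ι)

/-- The neighbours of a lift of `x`, as a multiset of vertices. -/
noncomputable def vertexRow (k : ℕ) (x : (graphF d α ι (β k) k).V) :
    Multiset (graphF d α ι (β k) k).V :=
  ((describes_pos hι k).exists_row (valid_seg hι k (β k)) x).choose

theorem map_pos_vertexRow (k : ℕ) (x : (graphF d α ι (β k) k).V) :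
    (vertexRow hι k x).map (pos d α ι β k) = (seg α ι k (β k)).row d (pos d α ι β k x) :=
  ((describes_pos hι k).exists_row (valid_seg hι k (β k)) x).choose_spec

theorem count_vertexRow (k : ℕ) [DecidableEq (graphF d α ι (β k) k).V]
    (x w : (graphF d α ι (β k) k).V) :
    (vertexRow hι k x).count w = (graphF d α ι (β k) k).idx x w := by
  classical
  have D := describes_pos (β := β) hι k
  rw [D.idx, ← (valid_seg hι k (β k)).count_row, ← map_pos_vertexRow hι k x,
    Multiset.count_map_eq_count' _ _ D.inj]

theorem vertexRow_next (hβ : AdmissibleLetters α β) (k : ℕ) (x : (graphF d α ι (β k) k).V)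
    (h : 0 < pos d α ι β k x ∨ (seg α ι k (β k)).L = (seg α ι (k + 1) (β (k + 1))).L) :
    vertexRow hι (k + 1) (next d α ι β k x) = (vertexRow hι k x).map (next d α ι β k) := by
  refine Multiset.map_injective (describes_pos (β := β) hι (k + 1)).inj ?_
  rw [map_pos_vertexRow hι, Multiset.map_map, pos_next hι hβ, move]
  refine ((step_seg hι k).row_move (valid_seg hι k) (hβ.or k) ((describes_pos hι k).le x)
    h).symm.trans ?_
  rw [← map_pos_vertexRow hι, Multiset.map_map]
  exact Multiset.map_congr rfl fun z _ => (pos_next hι hβ k z).symm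

end Rows

end Limit

end SturmianTree

/-! ### Stabilization of the indices and connectedness of the limit -/

namespace SturmianTree

section Limit

variable {d : ℕ} {α : ℕ → Letter} {ι : ℕ → IndexData} {β : ℕ → Letter}

theorem segmentSystem (hι : AdmissibleIndices d α ι) :
    SegmentSystem d (seg α ι) α (fun k => (ι (k + 1)).edges) :=
  segmentSystem_of_step (fun _ => rfl) valid_zero (segmentStep hι)

section Stable

variable (hι : AdmissibleIndices d α ι) (hβ : AdmissibleLetters α β)
include hι hβ

theorem length_mono {k j : ℕ} (hkj : k ≤ j) : (seg α ι k (β k)).L ≤ (seg α ι j (β j)).L := by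
  induction j, hkj using Nat.le_induction with
  | base => exact le_rfl
  | succ j _ ih => exact ih.trans ((step_seg hι j).length_le (hβ.or j))

theorem exists_eq_next {y : (limitGraph d α ι β).V} {j : ℕ} (h : ∃ x, toLimit d α ι β j x = y)
    {x' : (graphF d α ι (β (j + 1)) (j + 1)).V} (hx' : toLimit d α ι β (j + 1) x' = y) :
    ∃ x, toLimit d α ι β j x = y ∧ x' = next d α ι β j x := by
  obtain ⟨x, hx⟩ := h
  exact ⟨x, hx, toLimit_injective hι hβ _ (by rw [toLimit_next, hx, hx'])⟩

theorem interior_of_le {y : (limitGraph d α ι β).V} {k j : ℕ} (hkj : k ≤ j)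
    (h : ∃ x, toLimit d α ι β k x = y ∧ 0 < pos d α ι β k x ∧ pos d α ι β k x < (seg α ι k (β k)).L)
    (x : (graphF d α ι (β j) j).V) (hx : toLimit d α ι β j x = y) :
    0 < pos d α ι β j x ∧ pos d α ι β j x < (seg α ι j (β j)).L := by
  induction j, hkj using Nat.le_induction with
  | base =>
    obtain ⟨x', h1, h2⟩ := h
    rwa [toLimit_injective hι hβ k (hx.trans h1.symm)]
  | succ j hj ih =>
    obtain ⟨x', h1, rfl⟩ := exists_eq_next hι hβ
      (exists_rep_of_le hj (h.imp fun _ h => h.1)) hx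
    have := ih x' h1
    rw [pos_next hι hβ]
    exact (step_seg hι j).move_interior (hβ.or j) this.2 (Or.inl this.1)

theorem exists_level_pos (hinf : {k : ℕ | β k = α k}.Infinite) :
    ∃ k, ∀ j, k ≤ j → 0 < (seg α ι j (β j)).L := by
  obtain ⟨k, hk, -⟩ := hinf.exists_gt 0
  refine ⟨k, fun j hj => lt_of_lt_of_le ?_ (length_mono hι hβ hj)⟩
  rw [show β k = α k from hk]
  exact lt_of_le_of_lt (Nat.zero_le k) ((segmentSystem hι).lt_length k)

/-- A vertex other than the far end becomes interior when the segment grows, and interior vertices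
stay interior. If this never happens to the representatives of `y` once the lengths are positive,
none of them is the joining end of a growing segment. -/
theorem exists_level_stable (hinf : {k : ℕ | β k = α k}.Infinite) (y : (limitGraph d α ι β).V) :
    ∃ K, (∃ x, toLimit d α ι β K x = y) ∧ ∀ j, K ≤ j → ∀ x, toLimit d α ι β j x = y →
      0 < pos d α ι β j x ∨ (seg α ι j (β j)).L = (seg α ι (j + 1) (β (j + 1))).L := by
  obtain ⟨k₁, hk₁⟩ := exists_level_pos hι hβ hinf
  obtain ⟨k₂, hk₂⟩ := exists_rep y
  by_cases h : ∃ j, max k₁ k₂ ≤ j ∧ ∃ x, toLimit d α ι β j x = y ∧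
      pos d α ι β j x < (seg α ι j (β j)).L ∧
      (seg α ι j (β j)).L < (seg α ι (j + 1) (β (j + 1))).L
  · obtain ⟨j, -, x, hx, h1, h2⟩ := h
    have key : toLimit d α ι β (j + 1) (next d α ι β j x) = y := (toLimit_next j x).trans hx
    refine ⟨j + 1, ⟨_, key⟩, fun m hm z hz => Or.inl (interior_of_le hι hβ hm
      ⟨_, key, ?_⟩ z hz).1⟩
    rw [pos_next hι hβ]
    exact (step_seg hι j).move_interior (hβ.or j) h1 (Or.inr h2)
  · refine ⟨max k₁ k₂, exists_rep_of_le (le_max_right _ _) hk₂, fun j hj x hx => ?_⟩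
    by_contra! hc
    refine h ⟨j, hj, x, hx, ?_, ?_⟩
    · have := hk₁ j ((le_max_left _ _).trans hj)
      omega
    · exact lt_of_le_of_ne (length_mono hι hβ (Nat.le_succ j)) hc.2

theorem exists_limitRow (hinf : {k : ℕ | β k = α k}.Infinite) (y : (limitGraph d α ι β).V) :
    ∃ R : Multiset (limitGraph d α ι β).V, ∃ K, ∀ j, K ≤ j →
      (∃ x, toLimit d α ι β j x = y) ∧ ∀ x, toLimit d α ι β j x = y →
        (vertexRow hι j x).map (toLimit d α ι β j) = R := by
  obtain ⟨K, ⟨x₀, hx₀⟩, hK⟩ := exists_level_stable hι hβ hinf y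
  refine ⟨(vertexRow hι K x₀).map (toLimit d α ι β K), K, fun j hj =>
    ⟨exists_rep_of_le hj ⟨x₀, hx₀⟩, ?_⟩⟩
  induction j, hj using Nat.le_induction with
  | base =>
    intro x hx
    rw [toLimit_injective hι hβ K (hx.trans hx₀.symm)]
  | succ j hj ih =>
    intro x hx
    obtain ⟨x', h1, rfl⟩ := exists_eq_next hι hβ (exists_rep_of_le hj ⟨x₀, hx₀⟩) hx
    rw [vertexRow_next hι hβ j x' (hK j hj x' h1), Multiset.map_map, ← ih x' h1]
    exact Multiset.map_congr rfl fun z _ => toLimit_next j z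

end Stable

/-- The infimum in `limitGraph` is over one value only: any other stable value, from level `k` on,
is compared with `n` at the common level `k + K`. -/
theorem limit_idx_eq {p q : (limitGraph d α ι β).V} {n K : ℕ}
    (hp : ∃ x, toLimit d α ι β K x = p) (hq : ∃ x, toLimit d α ι β K x = q)
    (h : ∀ j, K ≤ j → ∀ x y, toLimit d α ι β j x = p → toLimit d α ι β j y = q →
      (graphF d α ι (β j) j).idx x y = n) : (limitGraph d α ι β).idx p q = n := by
  obtain ⟨x, hx⟩ := hp
  obtain ⟨y, hy⟩ := hq
  have key : ∃ (k : ℕ) (x y : (graphF d α ι (β k) k).V),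
      Quot.mk (LimitRel d α ι β) ⟨k, x⟩ = p ∧ Quot.mk (LimitRel d α ι β) ⟨k, y⟩ = q ∧
        ∀ m : ℕ, (graphF d α ι (β (k + m)) (k + m)).idx
          (inclIter d α ι β k m x) (inclIter d α ι β k m y) = n :=
    ⟨K, x, y, hx, hy, fun m => h _ (Nat.le_add_right K m) _ _
      ((toLimit_inclIter K m x).trans hx) ((toLimit_inclIter K m y).trans hy)⟩
  refine le_antisymm (Nat.sInf_le key) (le_csInf ⟨n, key⟩ ?_)
  rintro n' ⟨k, x', y', hx', hy', hn'⟩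
  rw [← hn' K, h (k + K) (Nat.le_add_left K k) _ _ ((toLimit_inclIter k K x').trans hx')
    ((toLimit_inclIter k K y').trans hy')]

section Cover

variable (hι : AdmissibleIndices d α ι) (hβ : AdmissibleLetters α β)
  (hinf : {k : ℕ | β k = α k}.Infinite)

/-- The neighbours of a lift of a vertex of the direct limit, as a multiset of vertices. -/
noncomputable def limitRow (y : (limitGraph d α ι β).V) : Multiset (limitGraph d α ι β).V :=
  (exists_limitRow hι hβ hinf y).choose

theorem limitRow_spec (y : (limitGraph d α ι β).V) : ∃ K, ∀ j, K ≤ j →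
    (∃ x, toLimit d α ι β j x = y) ∧ ∀ x, toLimit d α ι β j x = y →
      (vertexRow hι j x).map (toLimit d α ι β j) = limitRow hι hβ hinf y :=
  (exists_limitRow hι hβ hinf y).choose_spec

include hι hβ in
theorem count_map_vertexRow [DecidableEq (limitGraph d α ι β).V] (j : ℕ)
    (x w : (graphF d α ι (β j) j).V) :
    ((vertexRow hι j x).map (toLimit d α ι β j)).count (toLimit d α ι β j w) =
      (graphF d α ι (β j) j).idx x w := by
  classical
  rw [Multiset.count_map_eq_count' _ _ (toLimit_injective hι hβ j), count_vertexRow]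

theorem count_limitRow [DecidableEq (limitGraph d α ι β).V] (y z : (limitGraph d α ι β).V) :
    (limitRow hι hβ hinf y).count z = (limitGraph d α ι β).idx y z := by
  obtain ⟨K, hK⟩ := limitRow_spec hι hβ hinf y
  obtain ⟨k, hk⟩ := exists_rep z
  refine (limit_idx_eq (hK (max K k) (le_max_left _ _)).1
    (exists_rep_of_le (le_max_right _ _) hk) fun j hj x w hx hw => ?_).symm
  rw [← (hK j ((le_max_left _ _).trans hj)).2 x hx, ← hw, count_map_vertexRow hι hβ]

include hinf in
theorem eventually_idx_eq (hι : AdmissibleIndices d α ι) (hβ : AdmissibleLetters α β)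
    (y z : (limitGraph d α ι β).V) : ∃ K, ∀ j, K ≤ j →
      ∃ x w, toLimit d α ι β j x = y ∧ toLimit d α ι β j w = z ∧
        (graphF d α ι (β j) j).idx x w = (limitGraph d α ι β).idx y z := by
  classical
  obtain ⟨K, hK⟩ := limitRow_spec hι hβ hinf y
  obtain ⟨k, hk⟩ := exists_rep z
  refine ⟨max K k, fun j hj => ?_⟩
  obtain ⟨⟨x, hx⟩, h⟩ := hK j ((le_max_left _ _).trans hj)
  obtain ⟨w, hw⟩ := exists_rep_of_le ((le_max_right _ _).trans hj) hk
  exact ⟨x, w, hx, hw, by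
    rw [← count_limitRow hι hβ hinf, ← h x hx, ← hw, count_map_vertexRow hι hβ]⟩

include hinf in
theorem limitWellDefined (hι : AdmissibleIndices d α ι) (hβ : AdmissibleLetters α β) :
    LimitWellDefined d α ι β where
  injective := toLimit_injective hι hβ
  color := limit_color hι hβ
  index k x y := by
    obtain ⟨K, hK⟩ := eventually_idx_eq hinf hι hβ (toLimit d α ι β k x) (toLimit d α ι β k y)
    refine ⟨K, fun m hm => ?_⟩
    obtain ⟨x', y', hx, hy, h⟩ := hK (k + m) (hm.trans (Nat.le_add_left m k))
    rw [← h, toLimit_injective hι hβ _ (hx.trans (toLimit_inclIter k m x).symm),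
      toLimit_injective hι hβ _ (hy.trans (toLimit_inclIter k m y).symm)]

theorem card_limitRow (y : (limitGraph d α ι β).V) : (limitRow hι hβ hinf y).card = d := by
  obtain ⟨K, hK⟩ := limitRow_spec hι hβ hinf y
  obtain ⟨⟨x, hx⟩, h⟩ := hK K le_rfl
  rw [← h x hx, Multiset.card_map, ← Multiset.card_map (pos d α ι β K), map_pos_vertexRow hι]
  exact (valid_seg hι K (β K)).card_row ((describes_pos hι K).le x)

theorem mem_limitRow (y z : (limitGraph d α ι β).V) :
    z ∈ limitRow hι hβ hinf y ↔ (limitGraph d α ι β).idx y z ≠ 0 := by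
  classical
  rw [← count_limitRow hι hβ hinf, Multiset.count_ne_zero]

theorem limitRow_symm (y z : (limitGraph d α ι β).V) (h : z ∈ limitRow hι hβ hinf y) :
    y ∈ limitRow hι hβ hinf z := by
  rw [mem_limitRow] at h ⊢
  obtain ⟨K, hK⟩ := eventually_idx_eq hinf hι hβ y z
  obtain ⟨K', hK'⟩ := eventually_idx_eq hinf hι hβ z y
  obtain ⟨x, w, hx, hw, e⟩ := hK (max K K') (le_max_left _ _)
  obtain ⟨w', x', hw', hx', e'⟩ := hK' (max K K') (le_max_right _ _)
  obtain rfl := toLimit_injective hι hβ _ (hx.trans hx'.symm)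
  obtain rfl := toLimit_injective hι hβ _ (hw.trans hw'.symm)
  have D := describes_pos (β := β) hι (max K K')
  rw [← e, D.idx] at h
  rw [← e', D.idx]
  exact (valid_seg hι _ _).idx_symm (D.le x) (D.le w) h

/-- The limit index is evaluated at a later level, where the positions are different. As the
coordinates differ by 1, the positions are adjacent there too. -/
theorem mem_limitRow_of_pos {j : ℕ} {x w : (graphF d α ι (β j) j).V}
    (h : pos d α ι β j w = pos d α ι β j x + 1) :
    toLimit d α ι β j w ∈ limitRow hι hβ hinf (toLimit d α ι β j x) := by
  rw [mem_limitRow]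
  obtain ⟨K, hK⟩ := eventually_idx_eq hinf hι hβ (toLimit d α ι β j x) (toLimit d α ι β j w)
  obtain ⟨x', w', hx, hw, e⟩ := hK K le_rfl
  have D := describes_pos (β := β) hι K
  rw [← e, D.idx]
  refine (valid_seg hι _ _).idx_ne_zero (D.le x') (D.le w') ?_
  have hx' := congrArg (limitCoordinate d α ι β hι hβ) hx
  have hw' := congrArg (limitCoordinate d α ι β hι hβ) hw
  rw [limitCoordinate_toLimit, limitCoordinate_toLimit] at hx' hw'
  rw [h] at hw'
  push_cast at hw'
  rcases coordinate_sq (α := α) (ι := ι) (β := β) j with c | c <;>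
  rcases coordinate_sq (α := α) (ι := ι) (β := β) K with c' | c' <;>
  rw [c, c'] at hx' hw' <;> omega

theorem limitRow_connected (y z : (limitGraph d α ι β).V) :
    Relation.ReflTransGen (fun v w => w ∈ limitRow hι hβ hinf v) y z := by
  have : Std.Symm (fun v w => w ∈ limitRow hι hβ hinf v) := ⟨limitRow_symm hι hβ hinf⟩
  obtain ⟨k, hk⟩ := exists_rep y
  obtain ⟨k', hk'⟩ := exists_rep z
  obtain ⟨x, rfl⟩ := exists_rep_of_le (le_max_left k k') hk
  obtain ⟨w, rfl⟩ := exists_rep_of_le (le_max_right k k') hk'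
  generalize max k k' = j at x w
  have D := describes_pos (β := β) hι j
  obtain ⟨o, ho⟩ := D.surj 0 (Nat.zero_le _)
  have key : ∀ t x, pos d α ι β j x = t → Relation.ReflTransGen
      (fun v w => w ∈ limitRow hι hβ hinf v) (toLimit d α ι β j o) (toLimit d α ι β j x) := by
    intro t
    induction t with
    | zero =>
      intro x hx
      rw [D.inj (hx.trans ho.symm)]
    | succ t ih =>
      intro x hx
      obtain ⟨x', hx'⟩ := D.surj t (by have := D.le x; omega)
      exact (ih x' hx').tail (mem_limitRow_of_pos hι hβ hinf (by rw [hx, hx']))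
  exact (Std.Symm.symm _ _ (key _ x rfl)).trans (key _ w rfl)

end Cover

end Limit

end SturmianTree

/-! ### Labels on the limit and on the tree -/

namespace SturmianTree

section Limit

variable {d : ℕ} {α : ℕ → Letter} {ι : ℕ → IndexData} {β : ℕ → Letter}

/-- The position of level `k` below a position of level `j`, for `k ≤ j`. -/
def down (α : ℕ → Letter) (ι : ℕ → IndexData) (k : ℕ) : ℕ → ℕ → ℕ
  | 0, t => t
  | j + 1, t => if k ≤ j then
      down α ι k j (fold (seg α ι) α (fun k => (ι (k + 1)).edges) j t) else t

theorem down_self (k t : ℕ) : down α ι k k t = t := by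
  cases k <;> simp [down]

theorem down_succ {k j : ℕ} (h : k ≤ j) (t : ℕ) : down α ι k (j + 1) t =
    down α ι k j (fold (seg α ι) α (fun k => (ι (k + 1)).edges) j t) :=
  if_pos h

theorem fold_down {k j : ℕ} (h : k + 1 ≤ j) (t : ℕ) :
    fold (seg α ι) α (fun k => (ι (k + 1)).edges) k (down α ι (k + 1) j t) = down α ι k j t := by
  induction j, h using Nat.le_induction generalizing t with
  | base => rw [down_self, down_succ le_rfl, down_self]
  | succ j hj ih => rw [down_succ hj, down_succ (by omega), ih]

theorem colorAt_eq_down (j t : ℕ) : colorAt α ι j t = initialColor (α 0) (down α ι 0 j t) := by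
  induction j generalizing t with
  | zero => rfl
  | succ j ih => rw [down_succ (Nat.zero_le j), ← ih]; rfl

theorem initialColor_eq_iff (X : Letter) {s t : ℕ} (hs : s ≤ 1) (ht : t ≤ 1) :
    initialColor X s = initialColor X t ↔ s = t := by
  obtain rfl | rfl : s = 0 ∨ s = 1 := by omega
  all_goals obtain rfl | rfl : t = 0 ∨ t = 1 := by omega
  all_goals cases X <;> simp [initialColor]

section Labels

variable (hι : AdmissibleIndices d α ι) (hβ : AdmissibleLetters α β)
include hι

theorem down_row {k j : ℕ} (h : k ≤ j) (X : Letter) {t : ℕ} (ht : t ≤ (seg α ι j X).L) :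
    ∃ Y, down α ι k j t ≤ (seg α ι k Y).L ∧
      ((seg α ι j X).row d t).map (down α ι k j) = (seg α ι k Y).row d (down α ι k j t) := by
  induction j, h using Nat.le_induction generalizing X t with
  | base =>
    have e : down α ι k k = id := funext (down_self k)
    exact ⟨X, by simpa [e] using ht, by simp [e]⟩
  | succ j hj ih =>
    have S := segmentSystem hι
    have e : down α ι k (j + 1) =
        down α ι k j ∘ fold (seg α ι) α (fun k => (ι (k + 1)).edges) j := funext (down_succ hj)
    rw [e, ← Multiset.map_map, Function.comp_apply]
    rcases le_or_gt t (cut (seg α ι) α j) with hc | hc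
    · rw [S.fold_left j X t ht hc]
      refine ih _ ?_
      rw [fold, if_pos hc]
      exact Nat.sub_le _ _
    · obtain ⟨h1, h2⟩ := S.fold_right j X t ht hc
      rw [h2]
      exact ih _ h1

include hβ

/-- Folding undoes the inclusion of one level into the next (`foldAt_moveAt`), so the folded
position is independent of the level of the representative. -/
theorem down_pos {k i j : ℕ} (hki : k ≤ i) (hij : i ≤ j) {x : (graphF d α ι (β i) i).V}
    {w : (graphF d α ι (β j) j).V} (h : toLimit d α ι β j w = toLimit d α ι β i x) :
    down α ι k j (pos d α ι β j w) = down α ι k i (pos d α ι β i x) := by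
  induction j, hij using Nat.le_induction with
  | base => rw [toLimit_injective hι hβ i h]
  | succ j hj ih =>
    obtain ⟨w', h', rfl⟩ := exists_eq_next hι hβ (exists_rep_of_le hj ⟨x, rfl⟩) h
    rw [down_succ (hki.trans hj), pos_next hι hβ, ← ih h']
    congr 1
    have := (step_seg hι j).eps_le
    exact foldAt_moveAt (by omega) ((describes_pos hι j).le w')

theorem exists_label (k : ℕ) (y : (limitGraph d α ι β).V) : ∃ t, ∀ j, k ≤ j →
    ∀ x, toLimit d α ι β j x = y → down α ι k j (pos d α ι β j x) = t := by
  obtain ⟨k', hk'⟩ := exists_rep y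
  obtain ⟨x₀, hx₀⟩ := exists_rep_of_le (le_max_right k k') hk'
  refine ⟨down α ι k (max k k') (pos d α ι β _ x₀), fun j hj x hx => ?_⟩
  rcases le_total (max k k') j with h | h
  · exact down_pos hι hβ (le_max_left _ _) h (hx.trans hx₀.symm)
  · exact (down_pos hι hβ hj h (hx₀.trans hx.symm)).symm

end Labels

section Labels

variable (hι : AdmissibleIndices d α ι) (hβ : AdmissibleLetters α β)

/-- The label of level `k` of a vertex of the direct limit. -/
noncomputable def label (k : ℕ) (y : (limitGraph d α ι β).V) : ℕ :=
  (exists_label hι hβ k y).choose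

theorem down_pos_eq_label {k j : ℕ} (h : k ≤ j) (x : (graphF d α ι (β j) j).V) :
    down α ι k j (pos d α ι β j x) = label hι hβ k (toLimit d α ι β j x) :=
  (exists_label hι hβ k _).choose_spec j h x rfl

theorem fold_label (k : ℕ) (y : (limitGraph d α ι β).V) : label hι hβ k y =
    fold (seg α ι) α (fun k => (ι (k + 1)).edges) k (label hι hβ (k + 1) y) := by
  obtain ⟨k', hk'⟩ := exists_rep y
  obtain ⟨x, rfl⟩ := exists_rep_of_le (le_max_right (k + 1) k') hk'
  rw [← down_pos_eq_label hι hβ (le_max_left _ _),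
    ← down_pos_eq_label hι hβ (by have := le_max_left (k + 1) k'; omega),
    fold_down (le_max_left _ _)]

theorem label_row (hinf : {k : ℕ | β k = α k}.Infinite) (k : ℕ) (y : (limitGraph d α ι β).V) :
    ∃ X, label hι hβ k y ≤ (seg α ι k X).L ∧
      (limitRow hι hβ hinf y).map (label hι hβ k) = (seg α ι k X).row d (label hι hβ k y) := by
  obtain ⟨K, hK⟩ := limitRow_spec hι hβ hinf y
  obtain ⟨⟨x, rfl⟩, h⟩ := hK (max K k) (le_max_left _ _)
  have e : label hι hβ k ∘ toLimit d α ι β (max K k) =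
      down α ι k (max K k) ∘ pos d α ι β (max K k) :=
    funext fun z => (down_pos_eq_label hι hβ (le_max_right _ _) z).symm
  rw [← h x rfl, Multiset.map_map, e, ← Multiset.map_map, map_pos_vertexRow hι,
    ← down_pos_eq_label hι hβ (le_max_right _ _)]
  exact down_row hι (le_max_right _ _) _ ((describes_pos hι _).le x)

theorem color_eq_label (y : (limitGraph d α ι β).V) :
    (limitGraph d α ι β).color y = initialColor (α 0) (label hι hβ 0 y) := by
  obtain ⟨k, x, rfl⟩ := exists_rep y
  rw [limit_color hι hβ, color_eq_colorAt hι, colorAt_eq_down,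
    ← down_pos_eq_label hι hβ (Nat.zero_le k)]
  rfl

theorem label_zero_le (hinf : {k : ℕ | β k = α k}.Infinite) (y : (limitGraph d α ι β).V) :
    label hι hβ 0 y ≤ 1 := by
  obtain ⟨X, hX, -⟩ := label_row hι hβ hinf 0 y
  exact hX.trans (((segmentSystem hι).length_le 0 X).trans_eq (segmentSystem hι).length_zero)

end Labels

theorem map_nbrs_eq_limitRow (hι : AdmissibleIndices d α ι) (hβ : AdmissibleLetters α β)
    (hinf : {k : ℕ | β k = α k}.Infinite) {W : Type*} {T : SimpleGraph W}
    (hd : IsRegularOfDeg T d) {p : W → (limitGraph d α ι β).V}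
    (hp : IsUniversalCover T (limitGraph d α ι β) p) (x : W) :
    (nbrs T x).map p = limitRow hι hβ hinf (p x) := by
  classical
  ext v
  have h := count_map_nbrs hd p x v
  rw [hp.index, ← count_limitRow hι hβ hinf] at h
  exact_mod_cast h

theorem labeling (hι : AdmissibleIndices d α ι) (hβ : AdmissibleLetters α β)
    (hinf : {k : ℕ | β k = α k}.Infinite) {W : Type*} {T : SimpleGraph W}
    (hd : IsRegularOfDeg T d) {p : W → (limitGraph d α ι β).V}
    (hp : IsUniversalCover T (limitGraph d α ι β) p) :
    Labeling d T (fun x => (limitGraph d α ι β).color (p x)) (seg α ι) α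
      (fun k => (ι (k + 1)).edges) (fun k x => label hι hβ k (p x)) where
  fold k x := fold_label hι hβ k (p x)
  row k x := by
    rw [← Function.comp_def (label hι hβ k) p, ← Multiset.map_map,
      map_nbrs_eq_limitRow hι hβ hinf hd hp]
    exact label_row hι hβ hinf k (p x)
  color x y := by
    rw [color_eq_label hι hβ, color_eq_label hι hβ]
    exact initialColor_eq_iff _ (label_zero_le hι hβ hinf _) (label_zero_le hι hβ hinf _)
  -- At a level with `β k = α k` the limit contains the long graph, whose far end has the top label.
  -- Infinitely many such levels make the number of labels that occur unbounded.
  top n := by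
    obtain ⟨k, hk, hnk⟩ := hinf.exists_gt n
    obtain ⟨v, hv⟩ := (describes_pos (β := β) hι k).surj _ le_rfl
    obtain ⟨x, hx⟩ := hp.surjective (toLimit d α ι β k v)
    refine ⟨k, hnk.le, x, ?_⟩
    rw [hx, ← down_pos_eq_label hι hβ le_rfl, down_self, hv, show β k = α k from hk]

theorem Describes.card {G : ColoredGraph} {j f : G.V} {P : Segment} {p : G.V → ℕ}
    (D : Describes d G j f P p) : Nat.card G.V = P.L + 1 := by
  have h := Nat.card_congr (Equiv.ofBijective
    (fun v : G.V => (⟨p v, Nat.lt_succ_of_le (D.le v)⟩ : Fin (P.L + 1)))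
    ⟨fun v w h => D.inj (Fin.mk.inj h), fun t =>
      (D.surj t (Nat.le_of_lt_succ t.2)).imp fun v hv => Fin.ext hv⟩)
  rwa [Nat.card_fin] at h

/-- The length exceeds `k`, so there are at least two vertices and the subtraction in `nSeq` is not
truncated. -/
theorem card_eq_nSeq_add_two (hι : AdmissibleIndices d α ι) (k : ℕ) :
    Nat.card (graphF d α ι (α k) k).V = nSeq d α ι k + 2 := by
  have h := (describes_pos (β := α) hι k).card
  have h' := (segmentSystem hι).lt_length k
  rw [nSeq]
  omega

end Limit

end SturmianTree

theorem mainTheorem5 {W : Type*} (d : ℕ) (T : SimpleGraph W) (hT : T.IsTree)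
    (hd : SturmianTree.IsRegularOfDeg T d)
    (α : ℕ → SturmianTree.Letter) (ι : ℕ → SturmianTree.IndexData)
    (hι : SturmianTree.AdmissibleIndices d α ι)
    (β : ℕ → SturmianTree.Letter) (hβ : SturmianTree.AdmissibleLetters α β)
    (hinf : {k : ℕ | β k = α k}.Infinite) :
    SturmianTree.LimitWellDefined d α ι β ∧
    (∃ p : W → (SturmianTree.limitGraph d α ι β).V,
      SturmianTree.IsUniversalCover T (SturmianTree.limitGraph d α ι β) p) ∧
    ∀ p : W → (SturmianTree.limitGraph d α ι β).V,
      SturmianTree.IsUniversalCover T (SturmianTree.limitGraph d α ι β) p →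
      SturmianTree.IsSturmian T (fun x => (SturmianTree.limitGraph d α ι β).color (p x)) ∧
      ∀ k : ℕ,
        Nat.card (SturmianTree.graphF d α ι (α k) k).V = SturmianTree.nSeq d α ι k + 2 ∧
        SturmianTree.complexity T (fun x => (SturmianTree.limitGraph d α ι β).color (p x))
          (SturmianTree.nSeq d α ι k) = SturmianTree.nSeq d α ι k + 2 := by
  refine ⟨SturmianTree.limitWellDefined hinf hι hβ, ?_, fun p hp => ?_⟩
  · obtain ⟨k, hk⟩ := hinf.nonempty
    obtain ⟨v, -⟩ := (SturmianTree.describes_pos (β := β) hι k).surj 0 (Nat.zero_le _)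
    exact SturmianTree.exists_universalCover hd hT _ (SturmianTree.limitRow hι hβ hinf)
      (fun v w => by classical exact SturmianTree.count_limitRow hι hβ hinf v w)
      (SturmianTree.card_limitRow hι hβ hinf) (SturmianTree.limitRow_symm hι hβ hinf)
      (SturmianTree.toLimit d α ι β k v) (SturmianTree.limitRow_connected hι hβ hinf)
  · have h := (SturmianTree.labeling hι hβ hinf hd hp).isSturmian
      (SturmianTree.segmentSystem hι) hd hT
    exact ⟨h, fun k => ⟨SturmianTree.card_eq_nSeq_add_two hι k, h _⟩⟩
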